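/- Let $k$ be a commutative ring (for instance a field) and let $A$ be an associative unital $k$-algebra that is projective as a $k$-module. Write $A^e=A\otimes_k A^{\mathrm{op}}$, so that $A$-bimodules (with symmetric $k$-action) are left $A^e$-modules. Let $d\ge 0$ be an integer. Suppose that $A$ satisfies the conditions for van den Bergh duality of dimension $d$: the bimodule $A$ has a resolution of finite length by finitely generated projective $A$-bimodules, $\operatorname{Ext}^i_{A^e}(A,A\otimes_k A)=0$ for all $i\neq d$, and the dualizing bimodule $U=\operatorname{Ext}^d_{A^e}(A,A\otimes_k A)$ is an invertible $A$-bimodule, i.e. $U\otimes_A V\cong A\cong V\otimes_A U$ as bimodules for some $A$-bimodule $V$. (Here $\operatorname{Ext}$ is formed with respect to the outer bimodule structure of $A\otimes_k A$, and its bimodule structure is induced by the inner one.) Suppose moreover that $U$ is of finite order: there are $\ell\in\mathbb N$ and an isomorphism $\phi:U^{\otimes_A \ell}\to A$ of $A$-bimodules. Assume that $\phi$ is associative, that is, $$\phi(u_0\otimes\cdots\otimes u_{\ell-1})\,u_\ell=u_0\,\phi(u_1\otimes\cdots\otimes u_\ell)\qquad\text{for all }u_0,\dots,u_\ell\in U,$$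 and that $\ell$ is invertible in $A$. Let $A[U]=\bigoplus_{n\ge 0}U^{\otimes_A n}$ be the tensor algebra, with $U^{\otimes_A 0}=A$, let $J$ be the two-sided ideal of $A[U]$ generated by $\{x-\phi(x): x\in U^{\otimes_A\ell}\}$, and let $D=A[U]/J$. Then $D$ is a Calabi-Yau $k$-algebra of dimension $d$: it has a resolution of finite length by finitely generated projective $D$-bimodules, $\operatorname{Ext}^i_{D^e}(D,D\otimes_k D)=0$ for all $i\ne d$, and $\operatorname{Ext}^d_{D^e}(D,D\otimes_k D)\cong D$ as $D$-bimodules. Moreover, the inclusions $U^{\otimes_A i}\to A[U]$ followed by the projection $A[U]\to D$ induce an isomorphism of $A$-bimodules $\bigoplus_{i=0}^{\ell-1}U^{\otimes_A i}\cong D$. -/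

import Mathlib

open TensorProduct MulOpposite DirectSum CategoryTheory

universe v u

noncomputable section

namespace VdB

section Bimodules

variable (k : Type v) (A : Type u) [CommRing k] [Ring A] [Algebra k A]

/-- The enveloping algebra `Aᵉ = A ⊗ₖ Aᵒᵖ`. An `A`-bimodule (on which `k` acts symmetrically) is a
left `Aᵉ`-module, `a ⊗ op b` acting as `m ↦ a m b`. -/
abbrev Env : Type u := A ⊗[k] Aᵐᵒᵖ

variable {A}

/-- The element of `Aᵉ` that acts on bimodules as left multiplication by `a`. -/
abbrev lft (a : A) : Env k A := a ⊗ₜ[k] (1 : Aᵐᵒᵖ)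

/-- The element of `Aᵉ` that acts on bimodules as right multiplication by `a`. -/
abbrev rgt (a : A) : Env k A := (1 : A) ⊗ₜ[k] op a

variable (A)

/-- The regular bimodule: `(a ⊗ op b) • x = a * x * b`. -/
instance regularBimodule : Module (Env k A) A := TensorProduct.Algebra.module

variable {A}

theorem tmul_smul_self (a b x : A) : (a ⊗ₜ[k] op b : Env k A) • x = a * x * b := by
  change a • op b • x = _
  simp [mul_assoc]

theorem tmul_eq_lft_mul_rgt (a b : A) : (a ⊗ₜ[k] op b : Env k A) = lft k a * rgt k b := by
  simp

theorem commute_lft_rgt (a b : A) : lft k a * rgt k b = rgt k b * lft k a := by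
  simp

theorem lft_algebraMap (c : k) : lft k (algebraMap k A c) = rgt k (algebraMap k A c) := by
  rw [lft, rgt, Algebra.algebraMap_eq_smul_one, TensorProduct.smul_tmul, op_smul, op_one]

theorem lft_mul_smul {M : Type*} [AddCommGroup M] [Module (Env k A) M] (a b : A) (x : M) :
    lft k (a * b) • x = lft k a • lft k b • x := by
  rw [← mul_smul]; simp

theorem rgt_mul_smul {M : Type*} [AddCommGroup M] [Module (Env k A) M] (a b : A) (x : M) :
    rgt k (a * b) • x = rgt k b • rgt k a • x := by
  rw [← mul_smul]
  simp [rgt, op_mul]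

theorem lft_one_smul {M : Type*} [AddCommGroup M] [Module (Env k A) M] (x : M) :
    lft k (1 : A) • x = x := by
  rw [lft, ← Algebra.TensorProduct.one_def, one_smul]

theorem rgt_one_smul {M : Type*} [AddCommGroup M] [Module (Env k A) M] (x : M) :
    rgt k (1 : A) • x = x := by
  rw [rgt, op_one, ← Algebra.TensorProduct.one_def, one_smul]

theorem lft_smul_self (a b : A) : lft k a • b = a * b := by
  rw [lft, ← op_one, tmul_smul_self, mul_one]

theorem rgt_smul_self (a b : A) : rgt k a • b = b * a := by
  rw [rgt, tmul_smul_self, one_mul]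

/-- The `Aᵉ`-module structure given by commuting left and right actions of `A` that agree
on `k`. -/
@[reducible] def moduleOfActions {Q : Type*} [AddCommGroup Q] (f : A →+* AddMonoid.End Q)
    (g : Aᵐᵒᵖ →+* AddMonoid.End Q) (hfg : ∀ a b q, f a (g b q) = g b (f a q))
    (hk : ∀ (c : k) q, f (algebraMap k A c) q = g (algebraMap k Aᵐᵒᵖ c) q) :
    Module (Env k A) Q :=
  letI : Module A Q := Module.compHom Q f
  letI : Module Aᵐᵒᵖ Q := Module.compHom Q g
  letI : Module k Q := Module.compHom Q (algebraMap k A)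
  haveI : IsScalarTower k A Q := ⟨fun c a q => by
    change f (c • a) q = f (algebraMap k A c) (f a q)
    rw [Algebra.smul_def, map_mul]; rfl⟩
  haveI : IsScalarTower k Aᵐᵒᵖ Q := ⟨fun c a q => by
    change g (c • a) q = f (algebraMap k A c) (g a q)
    rw [Algebra.smul_def, map_mul, hk]; rfl⟩
  haveI : SMulCommClass A Aᵐᵒᵖ Q := ⟨fun a b q => hfg a b q⟩
  TensorProduct.Algebra.module

variable (A)
variable (M N : Type u) [AddCommGroup M] [AddCommGroup N] [Module (Env k A) M] [Module (Env k A) N]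

/-- The subgroup of `M ⊗_ℤ N` generated by the elements `m a ⊗ n - m ⊗ a n`. -/
def balancing : AddSubgroup (M ⊗[ℤ] N) :=
  AddSubgroup.closure
    {x | ∃ (m : M) (a : A) (n : N), x = (rgt k a • m) ⊗ₜ[ℤ] n - m ⊗ₜ[ℤ] (lft k a • n)}

/-- The tensor product `M ⊗_A N` of two `A`-bimodules. -/
def BTensor : Type u := (M ⊗[ℤ] N) ⧸ balancing k A M N

instance : AddCommGroup (BTensor k A M N) :=
  inferInstanceAs (AddCommGroup ((M ⊗[ℤ] N) ⧸ balancing k A M N))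

variable {M N}

/-- The pure tensor `m ⊗ n` in `M ⊗_A N`. -/
def btmul (m : M) (n : N) : BTensor k A M N := QuotientAddGroup.mk' (balancing k A M N) (m ⊗ₜ[ℤ] n)

theorem btmul_add (m : M) (n n' : N) :
    btmul k A m (n + n') = btmul k A m n + btmul k A m n' := by
  simp only [btmul, TensorProduct.tmul_add, map_add]; rfl

theorem add_btmul (m m' : M) (n : N) :
    btmul k A (m + m') n = btmul k A m n + btmul k A m' n := by
  simp only [btmul, TensorProduct.add_tmul, map_add]; rfl

theorem btmul_zero (m : M) : btmul k A m (0 : N) = 0 := by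
  simp only [btmul, TensorProduct.tmul_zero, map_zero]; rfl

theorem zero_btmul (n : N) : btmul k A (0 : M) n = 0 := by
  simp only [btmul, TensorProduct.zero_tmul, map_zero]; rfl

theorem rgt_btmul (m : M) (a : A) (n : N) :
    btmul k A (rgt k a • m) n = btmul k A m (lft k a • n) :=
  QuotientAddGroup.eq_iff_sub_mem.2 (AddSubgroup.subset_closure ⟨m, a, n, rfl⟩)

variable {k A}

theorem BTensor.induction {p : BTensor k A M N → Prop} (zero : p 0)
    (tmul : ∀ m n, p (btmul k A m n)) (add : ∀ x y, p x → p y → p (x + y)) (x) : p x := by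
  obtain ⟨y, rfl⟩ := QuotientAddGroup.mk'_surjective (balancing k A M N) x
  induction y with
  | zero => exact zero
  | tmul m n => exact tmul m n
  | add y z hy hz => exact add _ _ hy hz

theorem BTensor.hom_ext {P : Type*} [AddCommGroup P] {f g : BTensor k A M N →+ P}
    (h : ∀ m n, f (btmul k A m n) = g (btmul k A m n)) : f = g := by
  ext x
  induction x using BTensor.induction with
  | zero => simp
  | tmul m n => exact h m n
  | add x y hx hy => simp [hx, hy]

/-- The additive map out of `M ⊗_A N` defined by an `A`-balanced biadditive map. -/
def BTensor.lift {P : Type*} [AddCommGroup P] (f : M →+ N →+ P)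
    (hf : ∀ m (a : A) n, f (rgt k a • m) n = f m (lft k a • n)) : BTensor k A M N →+ P :=
  QuotientAddGroup.lift (balancing k A M N)
    (TensorProduct.liftAddHom f (fun r m n => by simp)) (by
      rw [balancing, AddSubgroup.closure_le]
      rintro _ ⟨m, a, n, rfl⟩
      simp [hf])

theorem BTensor.lift_btmul {P : Type*} [AddCommGroup P] (f : M →+ N →+ P)
    (hf : ∀ m (a : A) n, f (rgt k a • m) n = f m (lft k a • n)) (m : M) (n : N) :
    BTensor.lift f hf (btmul k A m n) = f m n := rfl

/-- The pure tensor map as a biadditive map. -/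
def btmulHom : M →+ N →+ BTensor k A M N :=
  AddMonoidHom.mk' (fun m => AddMonoidHom.mk' (fun n => btmul k A m n) (btmul_add k A m))
    (fun m m' => by ext n; exact add_btmul k A m m' n)

theorem btmulHom_apply (m : M) (n : N) : btmulHom m n = btmul k A m n := rfl

/-- The map `m ⊗ n ↦ a m ⊗ n` on `M ⊗_A N`. -/
def BTensor.mapL (a : A) : BTensor k A M N →+ BTensor k A M N :=
  BTensor.lift (btmulHom.comp (DistribSMul.toAddMonoidHom M (lft k a))) fun m b n => by
    change btmul k A (lft k a • rgt k b • m) n = btmul k A (lft k a • m) (lft k b • n)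
    rw [← rgt_btmul, ← mul_smul, ← mul_smul, commute_lft_rgt]

/-- The map `m ⊗ n ↦ m ⊗ n a` on `M ⊗_A N`. -/
def BTensor.mapR (a : A) : BTensor k A M N →+ BTensor k A M N :=
  BTensor.lift (btmulHom.compl₂ (DistribSMul.toAddMonoidHom N (rgt k a))) fun m b n => by
    change btmul k A (rgt k b • m) (rgt k a • n) = btmul k A m (rgt k a • lft k b • n)
    rw [rgt_btmul, ← mul_smul, ← mul_smul, commute_lft_rgt]

/-- The left action of `A` on `M ⊗_A N`: `a (m ⊗ n) = a m ⊗ n`. -/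
def BTensor.actL : A →+* AddMonoid.End (BTensor k A M N) where
  toFun a := BTensor.mapL a
  map_one' := BTensor.hom_ext fun m n => by
    change btmul k A (lft k (1 : A) • m) n = btmul k A m n
    rw [lft_one_smul]
  map_mul' a b := BTensor.hom_ext fun m n => by
    change btmul k A (lft k (a * b) • m) n = btmul k A (lft k a • lft k b • m) n
    rw [lft_mul_smul]
  map_zero' := BTensor.hom_ext fun m n => by
    change btmul k A (lft k (0 : A) • m) n = 0
    have h : lft k (0 : A) = 0 := TensorProduct.zero_tmul _ _
    rw [h, zero_smul (Env k A) m, zero_btmul]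
  map_add' a b := BTensor.hom_ext fun m n => by
    change btmul k A (lft k (a + b) • m) n =
      btmul k A (lft k a • m) n + btmul k A (lft k b • m) n
    rw [lft, TensorProduct.add_tmul, add_smul, add_btmul]

/-- The right action of `A` on `M ⊗_A N`: `(m ⊗ n) a = m ⊗ n a`. -/
def BTensor.actR : Aᵐᵒᵖ →+* AddMonoid.End (BTensor k A M N) where
  toFun a := BTensor.mapR a.unop
  map_one' := BTensor.hom_ext fun m n => by
    change btmul k A m (rgt k (1 : A) • n) = btmul k A m n
    rw [rgt_one_smul]
  map_mul' a b := BTensor.hom_ext fun m n => by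
    change btmul k A m (rgt k (b.unop * a.unop) • n) =
      btmul k A m (rgt k a.unop • rgt k b.unop • n)
    rw [rgt_mul_smul]
  map_zero' := BTensor.hom_ext fun m n => by
    change btmul k A m (rgt k (0 : A) • n) = 0
    have h : rgt k (0 : A) = 0 := TensorProduct.tmul_zero _ _
    rw [h, zero_smul (Env k A) n, btmul_zero]
  map_add' a b := BTensor.hom_ext fun m n => by
    change btmul k A m (rgt k (a.unop + b.unop) • n) =
      btmul k A m (rgt k a.unop • n) + btmul k A m (rgt k b.unop • n)
    rw [rgt, MulOpposite.op_add, TensorProduct.tmul_add, add_smul, btmul_add]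

theorem BTensor.actL_btmul (a : A) (m : M) (n : N) :
    BTensor.actL a (btmul k A m n) = btmul k A (lft k a • m) n := rfl

theorem BTensor.actR_btmul (a : Aᵐᵒᵖ) (m : M) (n : N) :
    BTensor.actR a (btmul k A m n) = btmul k A m (rgt k a.unop • n) := rfl

/-- The bimodule structure of `M ⊗_A N`: `a (m ⊗ n) b = a m ⊗ n b`. -/
instance : Module (Env k A) (BTensor k A M N) :=
  moduleOfActions k BTensor.actL BTensor.actR
    (fun a b q => by
      induction q using BTensor.induction with
      | zero => simp
      | tmul m n => simp only [BTensor.actL_btmul, BTensor.actR_btmul]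
      | add x y hx hy => simp only [map_add, hx, hy])
    (fun c q => by
      induction q using BTensor.induction with
      | zero => simp
      | tmul m n =>
        rw [BTensor.actL_btmul, BTensor.actR_btmul, lft_algebraMap, rgt_btmul, lft_algebraMap]
        rfl
      | add x y hx hy => simp only [map_add, hx, hy])

theorem tmul_smul_btmul (a b : A) (m : M) (n : N) :
    (a ⊗ₜ[k] op b : Env k A) • btmul k A m n = btmul k A (lft k a • m) (rgt k b • n) := rfl

theorem lft_smul_btmul (a : A) (m : M) (n : N) :
    lft k a • btmul k A m n = btmul k A (lft k a • m) n := by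
  rw [lft, ← op_one, tmul_smul_btmul, rgt_one_smul, op_one]

theorem rgt_smul_btmul (a : A) (m : M) (n : N) :
    rgt k a • btmul k A m n = btmul k A m (rgt k a • n) := by
  rw [rgt, tmul_smul_btmul, lft_one_smul]

variable (k A M)

/-- An `A`-bimodule `M` is invertible if `M ⊗_A V ≅ A ≅ V ⊗_A M` for some `A`-bimodule `V`. -/
def IsInvertibleBimodule : Prop :=
  ∃ V : ModuleCat.{u} (Env k A),
    Nonempty (BTensor k A M V ≃ₗ[Env k A] A) ∧ Nonempty (BTensor k A V M ≃ₗ[Env k A] A)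

end Bimodules

section Duality

variable (k : Type v) (A : Type u) [CommRing k] [Ring A] [Algebra k A]

/-- The `k`-linear involution of `Aᵉ` with `a ⊗ op b ↦ b ⊗ op a`. -/
def envSwap : Env k A →ₗ[k] Env k A :=
  TensorProduct.map (opLinearEquiv k (M := A)).symm.toLinearMap (opLinearEquiv k (M := A)).toLinearMap
    ∘ₗ (TensorProduct.comm k A Aᵐᵒᵖ).toLinearMap

theorem envSwap_tmul (a b : A) : envSwap k A (a ⊗ₜ op b) = b ⊗ₜ op a := rfl

theorem envSwap_one : envSwap k A 1 = 1 := rfl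

theorem envSwap_mul (x y : Env k A) : envSwap k A (x * y) = envSwap k A y * envSwap k A x := by
  induction x using TensorProduct.induction_on with
  | zero => simp
  | add x x' hx hx' => simp [add_mul, mul_add, hx, hx']
  | tmul a b =>
    induction y using TensorProduct.induction_on with
    | zero => simp
    | add y y' hy hy' => simp [add_mul, mul_add, hy, hy']
    | tmul c d =>
      induction b using MulOpposite.rec'
      induction d using MulOpposite.rec'
      simp [envSwap_tmul, ← op_mul]

/-- The inner bimodule action on `A ⊗ A`. With `A ⊗ A` carrying the outer structure, that is,
identified with the left regular `Aᵉ`-module by `x ⊗ y ↦ x ⊗ op y`, the element `a ⊗ op b` acts by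
`x ⊗ y ↦ x b ⊗ a y`, which is right multiplication by `b ⊗ op a`. -/
def innerAct (e : Env k A) :
    ModuleCat.of (Env k A) (Env k A) ⟶ ModuleCat.of (Env k A) (Env k A) :=
  ModuleCat.ofHom (LinearMap.toSpanSingleton (Env k A) (Env k A) (envSwap k A e))

theorem innerAct_apply (e x : Env k A) : (innerAct k A e).hom x = x * envSwap k A e := rfl

/-- `Ext^i_{Aᵉ}(A, A ⊗ A)`, formed with respect to the outer bimodule structure of `A ⊗ A`. -/
def ExtEnv (i : ℕ) : Type u :=
  Abelian.Ext.{u} (ModuleCat.of (Env k A) A) (ModuleCat.of (Env k A) (Env k A)) i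

instance (i : ℕ) : AddCommGroup (ExtEnv k A i) :=
  inferInstanceAs (AddCommGroup
    (Abelian.Ext.{u} (ModuleCat.of (Env k A) A) (ModuleCat.of (Env k A) (Env k A)) i))

/-- The bimodule structure of `Ext^i_{Aᵉ}(A, A ⊗ A)`, induced by the inner bimodule structure
of `A ⊗ A`. -/
@[reducible] def extModule (i : ℕ) : Module (Env k A)
    (Abelian.Ext.{u} (ModuleCat.of (Env k A) A) (ModuleCat.of (Env k A) (Env k A)) i) where
  smul e x := x.comp (Abelian.Ext.mk₀ (innerAct k A e)) (add_zero i)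
  one_smul x := by
    change x.comp (Abelian.Ext.mk₀ (innerAct k A 1)) (add_zero i) = x
    have : innerAct k A 1 = 𝟙 _ := by
      ext
      simp [innerAct, envSwap_one]
    rw [this, Abelian.Ext.comp_mk₀_id]
  mul_smul e f x := by
    change x.comp (Abelian.Ext.mk₀ (innerAct k A (e * f))) (add_zero i) =
      (x.comp (Abelian.Ext.mk₀ (innerAct k A f)) (add_zero i)).comp
        (Abelian.Ext.mk₀ (innerAct k A e)) (add_zero i)
    have : innerAct k A (e * f) = innerAct k A f ≫ innerAct k A e := by
      ext
      simp [innerAct, envSwap_mul]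
    rw [this, Abelian.Ext.comp_assoc_of_third_deg_zero, Abelian.Ext.mk₀_comp_mk₀]
  smul_zero e := Abelian.Ext.zero_comp _ _ _ _ _
  smul_add e x y := Abelian.Ext.add_comp _ _ _ _
  zero_smul x := by
    change x.comp (Abelian.Ext.mk₀ (innerAct k A 0)) (add_zero i) = 0
    have : innerAct k A 0 = 0 := by
      ext
      simp [innerAct]
    rw [this, Abelian.Ext.mk₀_zero, Abelian.Ext.comp_zero]
  add_smul e f x := by
    change x.comp (Abelian.Ext.mk₀ (innerAct k A (e + f))) (add_zero i) =
      x.comp (Abelian.Ext.mk₀ (innerAct k A e)) (add_zero i) +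
        x.comp (Abelian.Ext.mk₀ (innerAct k A f)) (add_zero i)
    have : innerAct k A (e + f) = innerAct k A e + innerAct k A f := by
      ext
      simp [innerAct]
    rw [this, Abelian.Ext.mk₀_add, Abelian.Ext.comp_add]

instance (i : ℕ) : Module (Env k A) (ExtEnv k A i) := extModule k A i

/-- `A` has a resolution of finite length by finitely generated projective `A`-bimodules. -/
def HasGoodResolution : Prop :=
  ∃ P : ProjectiveResolution (ModuleCat.of (Env k A) A),
    (∀ i, Module.Finite (Env k A) (P.complex.X i)) ∧
      ∃ n : ℕ, ∀ i, n < i → Limits.IsZero (P.complex.X i)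

/-- `A` satisfies the conditions for van den Bergh duality of dimension `d`. -/
structure HasVdBDuality (d : ℕ) : Prop where
  resolution : HasGoodResolution k A
  ext_eq_zero : ∀ i, i ≠ d → Subsingleton (ExtEnv k A i)
  invertible : IsInvertibleBimodule k A (ExtEnv k A d)

/-- `A` is a Calabi-Yau algebra of dimension `d`. -/
structure IsCalabiYau (d : ℕ) : Prop where
  resolution : HasGoodResolution k A
  ext_eq_zero : ∀ i, i ≠ d → Subsingleton (ExtEnv k A i)
  ext_iso : Nonempty (ExtEnv k A d ≃ₗ[Env k A] A)

end Duality

section TensorAlgebra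

variable (k : Type v) (A : Type u) [CommRing k] [Ring A] [Algebra k A]
variable (U : Type u) [AddCommGroup U] [Module (Env k A) U]

/-- The tensor powers: `U^{⊗ 0} = A` and `U^{⊗ (n + 1)} = U ⊗_A U^{⊗ n}`. -/
def TPow : ℕ → ModuleCat.{u} (Env k A)
  | 0 => ModuleCat.of (Env k A) A
  | n + 1 => ModuleCat.of (Env k A) (BTensor k A U (TPow n))

/-- The identification `A = U^{⊗ 0}`. -/
def TPow.zeroEquiv : A ≃ₗ[Env k A] TPow k A U 0 := LinearEquiv.refl _ _

/-- The identification `U ⊗_A U^{⊗ n} = U^{⊗ (n + 1)}`. -/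
def TPow.succEquiv (n : ℕ) : BTensor k A U (TPow k A U n) ≃ₗ[Env k A] TPow k A U (n + 1) :=
  LinearEquiv.refl _ _

/-- The element `v 0 ⊗ ⋯ ⊗ v (n - 1)` of `U^{⊗ n}`. -/
def TPow.tprod : (n : ℕ) → (Fin n → U) → TPow k A U n
  | 0, _ => TPow.zeroEquiv k A U 1
  | n + 1, v => TPow.succEquiv k A U n (btmul k A (v 0) (tprod n (Fin.tail v)))

/-- The underlying bimodule `⨁ₙ U^{⊗ n}` of the tensor algebra `A[U]`. -/
def TensorAlg : Type u := ⨁ n, TPow k A U n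

namespace TensorAlg

instance : AddCommGroup (TensorAlg k A U) := inferInstanceAs (AddCommGroup (⨁ n, TPow k A U n))

instance : Module (Env k A) (TensorAlg k A U) :=
  inferInstanceAs (Module (Env k A) (⨁ n, TPow k A U n))

/-- The inclusion of the component `U^{⊗ n}`. -/
def of (n : ℕ) : TPow k A U n →ₗ[Env k A] TensorAlg k A U :=
  DirectSum.lof (Env k A) ℕ (fun n => TPow k A U n) n

variable {k A U}

theorem hom_ext {P : Type*} [AddCommGroup P] {f g : TensorAlg k A U →+ P}
    (h : ∀ n t, f (of k A U n t) = g (of k A U n t)) : f = g :=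
  DirectSum.addHom_ext h

theorem induction {p : TensorAlg k A U → Prop} (zero : p 0) (of : ∀ n t, p (of k A U n t))
    (add : ∀ x y, p x → p y → p (x + y)) (x) : p x :=
  DirectSum.induction_on x zero of add

/-- `t ↦ u ⊗ t` on `⨁ₙ U^{⊗ n}`, biadditively. -/
def consHom : U →+ TensorAlg k A U →+ TensorAlg k A U :=
  AddMonoidHom.flip (DirectSum.toAddMonoid fun n =>
    AddMonoidHom.flip ((btmulHom (k := k) (A := A) (M := U) (N := TPow k A U n)).compr₂
      ((of k A U (n + 1)).toAddMonoidHom.comp (TPow.succEquiv k A U n).toLinearMap.toAddMonoidHom)))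

theorem consHom_of (u : U) (n : ℕ) (t : TPow k A U n) :
    consHom u (of k A U n t) = of k A U (n + 1) (TPow.succEquiv k A U n (btmul k A u t)) := by
  refine (DFunLike.congr_fun (DirectSum.toAddMonoid_of (β := fun n => TPow k A U n)
    (fun n => AddMonoidHom.flip ((btmulHom (k := k) (A := A) (M := U) (N := TPow k A U n)).compr₂
      ((of k A U (n + 1)).toAddMonoidHom.comp
        (TPow.succEquiv k A U n).toLinearMap.toAddMonoidHom))) n t) u).trans ?_
  rfl

theorem consHom_rgt (u : U) (a : A) (x : TensorAlg k A U) :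
    consHom (rgt k a • u) x = consHom u (lft k a • x) := by
  induction x using induction with
  | zero => simp
  | of n t => rw [← map_smul, consHom_of, consHom_of, rgt_btmul]
  | add x y hx hy => simp only [map_add, smul_add, hx, hy]

theorem consHom_lft (u : U) (a : A) (x : TensorAlg k A U) :
    consHom (lft k a • u) x = lft k a • consHom u x := by
  induction x using induction with
  | zero => simp
  | of n t =>
    rw [consHom_of, consHom_of, ← map_smul, ← map_smul, lft_smul_btmul]
  | add x y hx hy => simp only [map_add, smul_add, hx, hy]

theorem consHom_smul_rgt (u : U) (a : A) (x : TensorAlg k A U) :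
    consHom u (rgt k a • x) = rgt k a • consHom u x := by
  induction x using induction with
  | zero => simp
  | of n t =>
    rw [← map_smul, consHom_of, consHom_of, ← map_smul, ← map_smul, rgt_smul_btmul]
  | add x y hx hy => simp only [map_add, smul_add, hx, hy]

/-- The left action of `A`, as an additive map. -/
def lftHom : A →+ TensorAlg k A U →+ TensorAlg k A U :=
  AddMonoidHom.mk' (fun a => DistribSMul.toAddMonoidHom _ (lft k a)) fun a b => by
    ext x
    simp [lft, TensorProduct.add_tmul, add_smul]

theorem lftHom_apply (a : A) (x : TensorAlg k A U) : lftHom a x = lft k a • x := rfl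

/-- Given left multiplication by elements of `U^{⊗ n}`, left multiplication by elements of
`U ⊗_A U^{⊗ n}`, with `(u ⊗ t) * x = u ⊗ (t * x)`. -/
def mulStep {n : ℕ} (f : TPow k A U n →+ TensorAlg k A U →+ TensorAlg k A U)
    (hf : ∀ (a : A) t x, f (lft k a • t) x = lft k a • f t x) :
    BTensor k A U (TPow k A U n) →+ TensorAlg k A U →+ TensorAlg k A U :=
  BTensor.lift
    (AddMonoidHom.mk' (fun u => (AddMonoidHom.compHom (consHom u)).comp f)
      (fun u u' => by
        ext t x
        change consHom (u + u') (f t x) = consHom u (f t x) + consHom u' (f t x)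
        rw [map_add, AddMonoidHom.add_apply]))
    (fun u a t => by
      ext x
      change consHom (rgt k a • u) (f t x) = consHom u (f (lft k a • t) x)
      rw [consHom_rgt, hf])

theorem mulStep_btmul {n : ℕ} (f : TPow k A U n →+ TensorAlg k A U →+ TensorAlg k A U)
    (hf : ∀ (a : A) t x, f (lft k a • t) x = lft k a • f t x) (u : U) (t : TPow k A U n)
    (x : TensorAlg k A U) : mulStep f hf (btmul k A u t) x = consHom u (f t x) := rfl

theorem mulStep_lft {n : ℕ} (f : TPow k A U n →+ TensorAlg k A U →+ TensorAlg k A U)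
    (hf : ∀ (a : A) t x, f (lft k a • t) x = lft k a • f t x) (a : A)
    (t : BTensor k A U (TPow k A U n)) (x : TensorAlg k A U) :
    mulStep f hf (lft k a • t) x = lft k a • mulStep f hf t x := by
  induction t using BTensor.induction with
  | zero => simp only [smul_zero, map_zero, AddMonoidHom.zero_apply]
  | tmul u t => rw [lft_smul_btmul, mulStep_btmul, mulStep_btmul, consHom_lft]
  | add t t' ht ht' => simp only [smul_add, map_add, AddMonoidHom.add_apply, ht, ht']

/-- Left multiplication by elements of `U^{⊗ n}`, by concatenation of tensors: elements of
`U^{⊗ 0} = A` act by the left action of `A`, and `(u ⊗ t) * x = u ⊗ (t * x)`. The recursion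
carries along the left `A`-linearity that makes the second formula well defined. -/
def mulAux : (n : ℕ) → {f : TPow k A U n →+ TensorAlg k A U →+ TensorAlg k A U //
    ∀ (a : A) t x, f (lft k a • t) x = lft k a • f t x}
  | 0 => ⟨lftHom.comp (TPow.zeroEquiv k A U).symm.toLinearMap.toAddMonoidHom, fun a t x => by
      change lft k ((TPow.zeroEquiv k A U).symm (lft k a • t)) • x =
        lft k a • lft k ((TPow.zeroEquiv k A U).symm t) • x
      rw [map_smul, lft_smul_self, lft_mul_smul]⟩
  | n + 1 => ⟨(mulStep (mulAux n).1 (mulAux n).2).comp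
        (TPow.succEquiv k A U n).symm.toLinearMap.toAddMonoidHom,
      fun a t x => mulStep_lft (mulAux n).1 (mulAux n).2 a ((TPow.succEquiv k A U n).symm t) x⟩

/-- The multiplication of `A[U]`. -/
def mulHom : TensorAlg k A U →+ TensorAlg k A U →+ TensorAlg k A U :=
  DirectSum.toAddMonoid fun n => (mulAux n).1

instance : Mul (TensorAlg k A U) := ⟨fun x y => mulHom x y⟩

instance : One (TensorAlg k A U) := ⟨of k A U 0 (TPow.zeroEquiv k A U 1)⟩

theorem mul_def (x y : TensorAlg k A U) : x * y = mulHom x y := rfl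

theorem one_def : (1 : TensorAlg k A U) = of k A U 0 (TPow.zeroEquiv k A U 1) := rfl

theorem mulHom_of (n : ℕ) (t : TPow k A U n) : mulHom (of k A U n t) = (mulAux n).1 t :=
  DirectSum.toAddMonoid_of _ _ _

theorem of_zero_mul (a : A) (x : TensorAlg k A U) :
    of k A U 0 (TPow.zeroEquiv k A U a) * x = lft k a • x := by
  rw [mul_def, mulHom_of]
  rfl

theorem of_succ_mul (n : ℕ) (u : U) (t : TPow k A U n) (x : TensorAlg k A U) :
    of k A U (n + 1) (TPow.succEquiv k A U n (btmul k A u t)) * x =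
      consHom u (of k A U n t * x) := by
  rw [mul_def, mul_def, mulHom_of, mulHom_of]
  rfl

protected theorem add_mul (x y z : TensorAlg k A U) : (x + y) * z = x * z + y * z := by
  simp only [mul_def, map_add, AddMonoidHom.add_apply]

protected theorem mul_add (x y z : TensorAlg k A U) : x * (y + z) = x * y + x * z := by
  simp only [mul_def, map_add]

protected theorem zero_mul (x : TensorAlg k A U) : 0 * x = 0 := by
  simp only [mul_def, map_zero, AddMonoidHom.zero_apply]

protected theorem mul_zero (x : TensorAlg k A U) : x * 0 = 0 := by
  simp only [mul_def, map_zero]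

/-- Induction over the generators `a ∈ A` and `u ⊗ t`. -/
theorem induction' {p : TensorAlg k A U → Prop} (zero : p 0)
    (scalar : ∀ a, p (of k A U 0 (TPow.zeroEquiv k A U a)))
    (cons : ∀ u n t, p (of k A U n t) → p (consHom u (of k A U n t)))
    (add : ∀ x y, p x → p y → p (x + y)) (x) : p x := by
  induction x using induction with
  | zero => exact zero
  | add x y hx hy => exact add x y hx hy
  | of n t =>
    induction n with
    | zero => exact scalar t
    | succ n ih =>
      obtain ⟨t, rfl⟩ := (TPow.succEquiv k A U n).surjective t
      induction t using BTensor.induction with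
      | zero => simpa using zero
      | tmul u t => rw [← consHom_of]; exact cons u n t (ih t)
      | add t t' ht ht' => simpa only [map_add] using add _ _ ht ht'

theorem consHom_mul (u : U) (x y : TensorAlg k A U) : consHom u x * y = consHom u (x * y) := by
  induction x using induction with
  | zero => simp only [map_zero, TensorAlg.zero_mul]
  | of n t => rw [consHom_of, of_succ_mul]
  | add x x' hx hx' => simp only [map_add, TensorAlg.add_mul, hx, hx']

theorem lft_smul_mul (a : A) (x y : TensorAlg k A U) : (lft k a • x) * y = lft k a • (x * y) := by
  induction x using induction' with
  | zero => simp only [smul_zero, TensorAlg.zero_mul]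
  | scalar b =>
    rw [← map_smul, ← map_smul, lft_smul_self, of_zero_mul, of_zero_mul, lft_mul_smul]
  | cons u n t h => rw [← consHom_lft, consHom_mul, consHom_mul, consHom_lft]
  | add x x' hx hx' => simp only [smul_add, TensorAlg.add_mul, hx, hx']

theorem mul_rgt_smul (a : A) (x y : TensorAlg k A U) : x * (rgt k a • y) = rgt k a • (x * y) := by
  induction x using induction' with
  | zero => simp only [smul_zero, TensorAlg.zero_mul]
  | scalar b => rw [of_zero_mul, of_zero_mul, ← mul_smul, ← mul_smul, commute_lft_rgt]
  | cons u n t h => rw [consHom_mul, consHom_mul, h, consHom_smul_rgt]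
  | add x x' hx hx' => simp only [smul_add, TensorAlg.add_mul, hx, hx']

protected theorem mul_assoc (x y z : TensorAlg k A U) : x * y * z = x * (y * z) := by
  induction x using induction' with
  | zero => simp only [TensorAlg.zero_mul]
  | scalar a => rw [of_zero_mul, of_zero_mul, lft_smul_mul]
  | cons u n t h => rw [consHom_mul, consHom_mul, consHom_mul, h]
  | add x x' hx hx' => simp only [TensorAlg.add_mul, hx, hx']

protected theorem one_mul (x : TensorAlg k A U) : 1 * x = x := by
  rw [one_def, of_zero_mul, lft_one_smul]

protected theorem mul_one (x : TensorAlg k A U) : x * 1 = x := by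
  induction x using induction' with
  | zero => simp only [TensorAlg.zero_mul]
  | scalar a => rw [of_zero_mul, one_def, ← map_smul, ← map_smul, lft_smul_self, mul_one]
  | cons u n t h => rw [consHom_mul, h]
  | add x x' hx hx' => simp only [TensorAlg.add_mul, hx, hx']

/-- The tensor algebra `A[U] = ⨁ₙ U^{⊗ n}`, with concatenation of tensors as multiplication. -/
instance : Ring (TensorAlg k A U) where
  __ := (inferInstance : AddCommGroup (TensorAlg k A U))
  left_distrib := TensorAlg.mul_add
  right_distrib := TensorAlg.add_mul
  zero_mul := TensorAlg.zero_mul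
  mul_zero := TensorAlg.mul_zero
  mul_assoc := TensorAlg.mul_assoc
  one_mul := TensorAlg.one_mul
  mul_one := TensorAlg.mul_one

theorem mul_of_zero (x : TensorAlg k A U) (a : A) :
    x * of k A U 0 (TPow.zeroEquiv k A U a) = rgt k a • x := by
  conv_rhs => rw [← mul_one x, ← mul_rgt_smul, one_def, ← map_smul, ← map_smul, rgt_smul_self,
    one_mul]

variable (k A U)

/-- The inclusion of `A` in `A[U]`, as the component of degree zero. -/
def ofBase : A →+* TensorAlg k A U where
  toFun a := of k A U 0 (TPow.zeroEquiv k A U a)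
  map_one' := rfl
  map_mul' a b := by rw [of_zero_mul, ← map_smul, ← map_smul, lft_smul_self]
  map_zero' := by simp
  map_add' a b := by simp

instance : Algebra k (TensorAlg k A U) :=
  ((ofBase k A U).comp (algebraMap k A)).toAlgebra' fun c x => by
    change of k A U 0 (TPow.zeroEquiv k A U _) * x = x * of k A U 0 (TPow.zeroEquiv k A U _)
    rw [of_zero_mul, mul_of_zero, lft_algebraMap]

end TensorAlg

variable {k A U}

/-- The isomorphism `φ : U^{⊗ ℓ} → A` is associative if the maps `φ ⊗ id` and `id ⊗ φ` from
`U^{⊗ (ℓ + 1)}` to `U` coincide, that is, if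
`φ(u₀ ⊗ ⋯ ⊗ u_{ℓ-1}) u_ℓ = u₀ φ(u₁ ⊗ ⋯ ⊗ u_ℓ)` for all `u₀, …, u_ℓ ∈ U`. -/
def IsAssociative {l : ℕ} (φ : TPow k A U l ≃ₗ[Env k A] A) : Prop :=
  ∀ v : Fin (l + 1) → U,
    lft k (φ (TPow.tprod k A U l (Fin.init v))) • v (Fin.last l) =
      rgt k (φ (TPow.tprod k A U l (Fin.tail v))) • v 0

/-- The two-sided ideal `J` of `A[U]` generated by `{x - φ(x) : x ∈ U^{⊗ ℓ}}`. -/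
def relIdeal {l : ℕ} (φ : TPow k A U l ≃ₗ[Env k A] A) : TwoSidedIdeal (TensorAlg k A U) :=
  TwoSidedIdeal.span
    (Set.range fun x => TensorAlg.of k A U l x - TensorAlg.ofBase k A U (φ x))

/-- The `k`-algebra `D = A[U]/J`. -/
abbrev CyclicQuotient {l : ℕ} (φ : TPow k A U l ≃ₗ[Env k A] A) : Type u :=
  (relIdeal φ).ringCon.Quotient

/-- The projection `A[U] → D`. -/
def CyclicQuotient.mk {l : ℕ} (φ : TPow k A U l ≃ₗ[Env k A] A) :
    TensorAlg k A U →ₐ[k] CyclicQuotient φ :=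
  (relIdeal φ).ringCon.mkₐ k

end TensorAlgebra

end VdB

end

noncomputable section

namespace VdB

section Along

variable {B S : Type*} [Ring B] [Ring S]

/-- The `S`-module `M`, seen as a `B`-module by means of `θ : B → S`. -/
def Along (_θ : B →+* S) (M : Type*) : Type _ := M

variable {θ : B →+* S} {M N : Type*} [AddCommGroup M] [AddCommGroup N] [Module S M] [Module S N]

instance : AddCommGroup (Along θ M) := inferInstanceAs (AddCommGroup M)

instance : Module B (Along θ M) := Module.compHom M θ

variable (θ)

/-- An `S`-linear map is `B`-linear. -/
def alongMap (f : M →ₗ[S] N) : Along θ M →ₗ[B] Along θ N where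
  toFun := f
  map_add' := f.map_add
  map_smul' b x := f.map_smul (θ b) x

theorem projective_along [Module.Projective B (Along θ S)] [Module.Projective S M] :
    Module.Projective B (Along θ M) := by
  classical
  obtain ⟨s, hs⟩ := (Module.projective_def' (R := S) (P := M)).1 inferInstance
  have h : Module.Projective B (M →₀ Along θ S) :=
    Module.Projective.of_equiv' (finsuppLequivDFinsupp B).symm
  have e : Along θ (M →₀ S) ≃ₗ[B] (M →₀ Along θ S) :=
    { toFun := fun x => x
      invFun := fun x => x
      left_inv := fun _ => rfl
      right_inv := fun _ => rfl
      map_add' := fun _ _ => rfl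
      map_smul' := fun _ _ => rfl }
  have : Module.Projective B (Along θ (M →₀ S)) := Module.Projective.of_equiv' e.symm
  exact Module.Projective.of_split (alongMap θ s)
    (alongMap θ (Finsupp.linearCombination S id)) (by ext x; exact DFunLike.congr_fun hs x)

theorem finite_along [Module.Finite B (Along θ S)] [Module.Finite S M] :
    Module.Finite B (Along θ M) := by
  obtain ⟨n, f, hf⟩ := Module.Finite.exists_fin' S M
  have e : Along θ (Fin n → S) ≃ₗ[B] (Fin n → Along θ S) :=
    { toFun := fun x => x
      invFun := fun x => x
      left_inv := fun _ => rfl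
      right_inv := fun _ => rfl
      map_add' := fun _ _ => rfl
      map_smul' := fun _ _ => rfl }
  have : Module.Finite B (Along θ (Fin n → S)) := Module.Finite.equiv e.symm
  exact Module.Finite.of_surjective (alongMap θ f) hf

theorem finite_of_along [h : Module.Finite B (Along θ M)] : Module.Finite S M := by
  obtain ⟨s, hs⟩ := h.fg_top
  have key : ∀ x : Along θ M, x ∈ Submodule.span B (s : Set (Along θ M)) →
      (show M from x) ∈ Submodule.span S (show Finset M from s : Set M) := by
    intro x hx
    induction hx using Submodule.span_induction with
    | mem x hx => exact Submodule.subset_span hx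
    | zero => exact Submodule.zero_mem _
    | add x y _ _ hx hy => exact Submodule.add_mem _ hx hy
    | smul b x _ hx => exact Submodule.smul_mem _ (θ b) hx
  exact ⟨⟨s, top_le_iff.1 fun x _ => key x (hs ▸ Submodule.mem_top)⟩⟩

end Along

section Complexes

variable {S : Type*} [Ring S] {P Q : ℕ → Type*} [∀ n, AddCommGroup (P n)] [∀ n, Module S (P n)]
  [∀ n, AddCommGroup (Q n)] [∀ n, Module S (Q n)] {M N : Type*} [AddCommGroup M] [Module S M]
  [AddCommGroup N] [Module S N]

theorem exists_lift_of_range_le {P Q R : Type*} [AddCommGroup P] [AddCommGroup Q] [AddCommGroup R]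
    [Module S P] [Module S Q] [Module S R] [Module.Projective S P] (g : Q →ₗ[S] R) (f : P →ₗ[S] R)
    (h : ∀ x, ∃ y, g y = f x) : ∃ f' : P →ₗ[S] Q, ∀ x, g (f' x) = f x := by
  obtain ⟨f', hf'⟩ := Module.projective_lifting_property g.rangeRestrict
    (f.codRestrict (LinearMap.range g) h) g.surjective_rangeRestrict
  exact ⟨f', fun x => congrArg Subtype.val (DFunLike.congr_fun hf' x)⟩

/-- The maps `d` and `ε` form an augmented chain complex. -/
structure IsAugmented (d : ∀ n, P (n + 1) →ₗ[S] P n) (ε : P 0 →ₗ[S] M) : Prop where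
  d_d : ∀ n x, d n (d (n + 1) x) = 0
  ε_d : ∀ x, ε (d 0 x) = 0

/-- The augmented chain complex formed by `d` and `ε` is exact. -/
structure IsResolution (d : ∀ n, P (n + 1) →ₗ[S] P n) (ε : P 0 →ₗ[S] M) : Prop
    extends IsAugmented d ε where
  surjective : Function.Surjective ε
  exact_zero : ∀ x, ε x = 0 → ∃ y, d 0 y = x
  exact_succ : ∀ n x, d n x = 0 → ∃ y, d (n + 1) y = x

variable {dP : ∀ n, P (n + 1) →ₗ[S] P n} {εP : P 0 →ₗ[S] M}
  {dQ : ∀ n, Q (n + 1) →ₗ[S] Q n} {εQ : Q 0 →ₗ[S] N}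

variable (dP dQ) in
/-- The maps `F n` form a chain map. -/
def IsChainMap (F : ∀ n, P n →ₗ[S] Q n) : Prop := ∀ n x, dQ n (F (n + 1) x) = F n (dP n x)

theorem exists_chainMap [∀ n, Module.Projective S (P n)] (hP : IsAugmented dP εP)
    (hQ : IsResolution dQ εQ) (f : M →ₗ[S] N) :
    ∃ F : ∀ n, P n →ₗ[S] Q n, IsChainMap dP dQ F ∧ ∀ x, εQ (F 0 x) = f (εP x) := by
  let good : ∀ n, (P n →ₗ[S] Q n) → Prop := fun n => match n with
    | 0 => fun F => ∀ x, εQ (F (dP 0 x)) = 0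
    | n + 1 => fun F => ∀ x, dQ n (F (dP (n + 1) x)) = 0
  have step : ∀ n F, good n F → ∃ F' : P (n + 1) →ₗ[S] Q (n + 1),
      good (n + 1) F' ∧ ∀ x, dQ n (F' x) = F (dP n x) := by
    intro n F hF
    obtain ⟨F', hF'⟩ := exists_lift_of_range_le (dQ n) (F ∘ₗ dP n) (fun x => by
      cases n with
      | zero => exact hQ.exact_zero _ (hF x)
      | succ n => exact hQ.exact_succ _ _ (hF x))
    exact ⟨F', fun x => by simp [hF', hP.d_d], hF'⟩
  choose next hgood hnext using step
  obtain ⟨F₀, hF₀⟩ := exists_lift_of_range_le εQ (f ∘ₗ εP) (fun x => hQ.surjective _)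
  have hF₀' : good 0 F₀ := fun x => by simp [hF₀, hP.ε_d]
  let seq : ∀ n, {F : P n →ₗ[S] Q n // good n F} := fun n =>
    Nat.rec ⟨F₀, hF₀'⟩ (fun n F => ⟨next n F.1 F.2, hgood n F.1 F.2⟩) n
  exact ⟨fun n => (seq n).1, fun n x => hnext n (seq n).1 (seq n).2 x, hF₀⟩

theorem exists_nullHomotopy [∀ n, Module.Projective S (P n)]
    (hQ : IsResolution dQ εQ) {F : ∀ n, P n →ₗ[S] Q n} (hF : IsChainMap dP dQ F)
    (hd : ∀ n x, dP n (dP (n + 1) x) = 0)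
    (h₀ : ∀ x, εQ (F 0 x) = 0) :
    ∃ H : ∀ n, P n →ₗ[S] Q (n + 1), (∀ x, F 0 x = dQ 0 (H 0 x)) ∧
      ∀ n x, F (n + 1) x = dQ (n + 1) (H (n + 1) x) + H n (dP n x) := by
  let good : ∀ n, (P n →ₗ[S] Q (n + 1)) → Prop := fun n H =>
    ∀ x, dQ n (F (n + 1) x - H (dP n x)) = 0
  have step : ∀ n H, good n H → ∃ H' : P (n + 1) →ₗ[S] Q (n + 2),
      good (n + 1) H' ∧ ∀ x, dQ (n + 1) (H' x) = F (n + 1) x - H (dP n x) := by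
    intro n H hH
    obtain ⟨H', hH'⟩ := exists_lift_of_range_le (dQ (n + 1)) (F (n + 1) - H ∘ₗ dP n)
      (fun x => hQ.exact_succ _ _ (hH x))
    refine ⟨H', fun x => ?_, hH'⟩
    rw [map_sub, hF (n + 1), hH']
    simp [hd]
  choose next hgood hnext using step
  obtain ⟨H₀, hH₀⟩ := exists_lift_of_range_le (dQ 0) (F 0) (fun x => hQ.exact_zero _ (h₀ x))
  have hH₀' : good 0 H₀ := fun x => by rw [map_sub, hF 0, hH₀, sub_self]
  let seq : ∀ n, {H : P n →ₗ[S] Q (n + 1) // good n H} := fun n =>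
    Nat.rec ⟨H₀, hH₀'⟩ (fun n F => ⟨next n F.1 F.2, hgood n F.1 F.2⟩) n
  refine ⟨fun n => (seq n).1, fun x => (hH₀ x).symm, fun n x => ?_⟩
  have := hnext n (seq n).1 (seq n).2 x
  exact (sub_eq_iff_eq_add.1 this.symm)

variable (dP N) in
/-- The coboundaries of degree `n` among the cochains with values in `N`. -/
def coboundaries : ∀ n, AddSubgroup (P n →ₗ[S] N)
  | 0 => ⊥
  | n + 1 => AddMonoidHom.range
      (AddMonoidHom.mk' (fun g : P n →ₗ[S] N => g ∘ₗ dP n) fun _ _ => LinearMap.add_comp _ _ _)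

theorem mem_coboundaries_succ {n : ℕ} {f : P (n + 1) →ₗ[S] N} :
    f ∈ coboundaries N dP (n + 1) ↔ ∃ g : P n →ₗ[S] N, ∀ x, g (dP n x) = f x := by
  constructor
  · rintro ⟨g, rfl⟩
    exact ⟨g, fun x => rfl⟩
  · rintro ⟨g, hg⟩
    exact ⟨g, LinearMap.ext hg⟩

variable (dP) in
/-- The cochain `f` is a cocycle. -/
def IsCocycle {n : ℕ} (f : P n →ₗ[S] N) : Prop := ∀ x, f (dP n x) = 0

/-- Additive maps of cochains that commute with the differentials preserve coboundaries. -/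
theorem map_mem_coboundaries {S' : Type*} [Ring S'] {P' : ℕ → Type*} [∀ n, AddCommGroup (P' n)]
    [∀ n, Module S' (P' n)] {N' : Type*} [AddCommGroup N'] [Module S' N']
    {d' : ∀ n, P' (n + 1) →ₗ[S'] P' n} (Φ : ∀ n, (P n →ₗ[S] N) →+ (P' n →ₗ[S'] N'))
    (hΦ : ∀ n g, Φ (n + 1) (g ∘ₗ dP n) = Φ n g ∘ₗ d' n) {n : ℕ} {f : P n →ₗ[S] N}
    (hf : f ∈ coboundaries N dP n) : Φ n f ∈ coboundaries N' d' n := by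
  cases n with
  | zero =>
    rw [show f = 0 from hf, map_zero]
    exact zero_mem _
  | succ n =>
    obtain ⟨g, rfl⟩ := hf
    exact ⟨Φ n g, (hΦ n g).symm⟩

/-- Homotopic chain maps induce cohomologous cocycles. -/
theorem comp_sub_comp_mem_coboundaries {M' : Type*} [AddCommGroup M'] [Module S M']
    [∀ n, Module.Projective S (P n)] (hP : IsAugmented dP εP)
    (hQ : IsResolution dQ εQ) {F G : ∀ n, P n →ₗ[S] Q n} (hF : IsChainMap dP dQ F)
    (hG : IsChainMap dP dQ G) (hFG : ∀ x, εQ (F 0 x) = εQ (G 0 x)) {n : ℕ} {f : Q n →ₗ[S] M'}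
    (hf : IsCocycle dQ f) : f ∘ₗ F n - f ∘ₗ G n ∈ coboundaries M' dP n := by
  obtain ⟨H, hH₀, hH⟩ := exists_nullHomotopy (F := fun n => F n - G n) hQ
    (fun n x => by simp [hF n x, hG n x]) hP.d_d (fun x => by simp [hFG])
  cases n with
  | zero =>
    have : f ∘ₗ F 0 - f ∘ₗ G 0 = 0 := by
      ext x
      have := congrArg f (hH₀ x)
      rw [hf] at this
      simpa using this
    rw [this]
    exact zero_mem _
  | succ n =>
    refine mem_coboundaries_succ.2 ⟨f ∘ₗ H n, fun x => ?_⟩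
    have := congrArg f (hH n x)
    rw [map_add, hf, zero_add] at this
    simpa using this.symm

end Complexes

section FiniteResolutions

variable {S : Type u} [Ring S]

/-- The module `M` has a resolution of length `n` by finitely generated projective modules. -/
def HasFiniteResolution (S : Type u) [Ring S] :
    ℕ → ∀ (M : Type u) [AddCommGroup M] [Module S M], Prop
  | 0, M, _, _ => Module.Finite S M ∧ Module.Projective S M
  | n + 1, M, _, _ => ∃ (F : ModuleCat.{u} S) (f : F →ₗ[S] M), Module.Finite S F ∧
      Module.Projective S F ∧ Function.Surjective f ∧ HasFiniteResolution S n (LinearMap.ker f)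

namespace HasFiniteResolution

variable {M M' : Type u} [AddCommGroup M] [Module S M] [AddCommGroup M'] [Module S M']

theorem finite {n : ℕ} (h : HasFiniteResolution S n M) : Module.Finite S M := by
  cases n with
  | zero => exact h.1
  | succ n =>
    obtain ⟨F, f, hF, -, hf, -⟩ := h
    exact Module.Finite.of_surjective f hf

theorem of_equiv {n : ℕ} (e : M ≃ₗ[S] M') (h : HasFiniteResolution S n M) :
    HasFiniteResolution S n M' := by
  cases n with
  | zero =>
    obtain ⟨h₁, h₂⟩ := h
    exact ⟨Module.Finite.equiv e, Module.Projective.of_equiv' e⟩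
  | succ n =>
    obtain ⟨F, f, h₁, h₂, hf, h⟩ := h
    refine ⟨F, e.toLinearMap ∘ₗ f, h₁, h₂, e.surjective.comp hf, ?_⟩
    rwa [LinearEquiv.ker_comp]

theorem prod {n : ℕ} (h : HasFiniteResolution S n M) [Module.Finite S M']
    [Module.Projective S M'] : HasFiniteResolution S n (M × M') := by
  cases n with
  | zero =>
    obtain ⟨h₁, h₂⟩ := h
    exact ⟨inferInstance, inferInstance⟩
  | succ n =>
    obtain ⟨F, f, h₁, h₂, hf, h⟩ := h
    refine ⟨ModuleCat.of S (F × M'), LinearMap.prodMap f LinearMap.id,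
      inferInstanceAs (Module.Finite S (F × M')), inferInstanceAs (Module.Projective S (F × M')),
      hf.prodMap Function.surjective_id, h.of_equiv ?_⟩
    exact LinearEquiv.ofBijective
      (((LinearMap.inl S F M') ∘ₗ (LinearMap.ker f).subtype).codRestrict _ fun x => by simp)
      ⟨fun x y hxy => by
        have := congrArg (fun z => z.1.1) hxy
        exact Subtype.ext this,
      fun ⟨⟨x, y⟩, hxy⟩ => by
        simp only [LinearMap.mem_ker, LinearMap.prodMap_apply, Prod.mk_eq_zero] at hxy
        exact ⟨⟨x, hxy.1⟩, Subtype.ext (Prod.ext rfl hxy.2.symm)⟩⟩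

/-- If retracts inherit resolutions of length `n`, then the kernel of any finitely generated
projective cover of a module with a resolution of length `n + 1` has one of length `n`. -/
theorem ker_of_retract {n : ℕ}
    (hret : ∀ {X Y : Type u} [AddCommGroup X] [Module S X] [AddCommGroup Y] [Module S Y]
      (i : Y →ₗ[S] X) (r : X →ₗ[S] Y), r ∘ₗ i = LinearMap.id → HasFiniteResolution S n X →
        HasFiniteResolution S n Y)
    (h : HasFiniteResolution S (n + 1) M) {G : Type u} [AddCommGroup G] [Module S G]
    [Module.Finite S G] [Module.Projective S G] (g : G →ₗ[S] M) (hg : Function.Surjective g) :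
    HasFiniteResolution S n (LinearMap.ker g) := by
  obtain ⟨F, f, h₁, h₂, hf, h⟩ := h
  obtain ⟨a, ha⟩ := exists_lift_of_range_le g f fun x => hg _
  obtain ⟨b, hb⟩ := exists_lift_of_range_le f g fun x => hf _
  have hi : ∀ y : LinearMap.ker g, -b y.1 ∈ LinearMap.ker f := fun y => by
    simp [hb]
  have hr : ∀ z : LinearMap.ker f × G, z.2 - a (z.1.1 + b z.2) ∈ LinearMap.ker g := fun z => by
    have hz : f z.1 = 0 := z.1.2
    simp [hb, ha, hz]
  let i : LinearMap.ker g →ₗ[S] LinearMap.ker f × G :=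
    LinearMap.prod ((-(b ∘ₗ (LinearMap.ker g).subtype)).codRestrict _ hi) (LinearMap.ker g).subtype
  let r : LinearMap.ker f × G →ₗ[S] LinearMap.ker g :=
    (LinearMap.snd S _ G - a ∘ₗ ((LinearMap.ker f).subtype ∘ₗ LinearMap.fst S _ G +
      b ∘ₗ LinearMap.snd S _ G)).codRestrict _ hr
  refine hret i r (LinearMap.ext fun y => Subtype.ext ?_) h.prod
  change y.1 - a (-b y.1 + b y.1) = y.1
  simp

theorem of_retract {n : ℕ} : ∀ {X Y : Type u} [AddCommGroup X] [Module S X] [AddCommGroup Y]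
    [Module S Y] (i : Y →ₗ[S] X) (r : X →ₗ[S] Y), r ∘ₗ i = LinearMap.id →
    HasFiniteResolution S n X → HasFiniteResolution S n Y := by
  induction n with
  | zero =>
    rintro X Y _ _ _ _ i r hri ⟨h₁, h₂⟩
    exact ⟨Module.Finite.of_surjective r fun y => ⟨i y, DFunLike.congr_fun hri y⟩,
      Module.Projective.of_split i r hri⟩
  | succ n ih =>
    intro X Y _ _ _ _ i r hri h
    have hri' : ∀ y, r (i y) = y := fun y => DFunLike.congr_fun hri y
    have : Module.Finite S X := h.finite
    have : Module.Finite S Y := Module.Finite.of_surjective r fun y => ⟨i y, hri' y⟩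
    obtain ⟨m, g, hg⟩ := Module.Finite.exists_fin' S Y
    obtain ⟨m', f, hf⟩ := Module.Finite.exists_fin' S X
    let p : ((Fin m → S) × (Fin m' → S)) →ₗ[S] X :=
      i ∘ₗ g ∘ₗ LinearMap.fst S _ _ + (LinearMap.id - i ∘ₗ r) ∘ₗ f ∘ₗ LinearMap.snd S _ _
    have hp : Function.Surjective p := by
      intro x
      obtain ⟨a, ha⟩ := hg (r x)
      obtain ⟨b, hb⟩ := hf x
      exact ⟨(a, b), by simp [p, ha, hb]⟩
    have hk := h.ker_of_retract ih p hp
    refine ⟨ModuleCat.of S (Fin m → S), g, inferInstanceAs (Module.Finite S (Fin m → S)),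
      inferInstanceAs (Module.Projective S (Fin m → S)), hg, ?_⟩
    refine ih ((LinearMap.inl S _ _ ∘ₗ (LinearMap.ker g).subtype).codRestrict _ fun y => ?_)
      ((LinearMap.fst S _ _ ∘ₗ (LinearMap.ker p).subtype).codRestrict _ fun y => ?_) ?_ hk
    · simp [p]
    · have e : ∀ z, r (p z) = g z.1 := fun z => by simp [p, hri']
      have e := e y.1
      rw [LinearMap.mem_ker.1 y.2, map_zero] at e
      exact e.symm
    · rfl

theorem ker {n : ℕ} (h : HasFiniteResolution S (n + 1) M) {G : Type u} [AddCommGroup G]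
    [Module S G] [Module.Finite S G] [Module.Projective S G] (g : G →ₗ[S] M)
    (hg : Function.Surjective g) : HasFiniteResolution S n (LinearMap.ker g) :=
  h.ker_of_retract of_retract g hg

theorem of_resolution {n : ℕ} : ∀ {M : Type u} [AddCommGroup M] [Module S M] {P : ℕ → Type u}
    [∀ n, AddCommGroup (P n)] [∀ n, Module S (P n)] {d : ∀ n, P (n + 1) →ₗ[S] P n}
    {ε : P 0 →ₗ[S] M}, IsResolution d ε → (∀ i, Module.Finite S (P i)) →
    (∀ i, Module.Projective S (P i)) → (∀ i, n < i → Subsingleton (P i)) →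
    HasFiniteResolution S n M := by
  induction n with
  | zero =>
    intro M _ _ P _ _ d ε h hfin hproj hzero
    have e : P 0 ≃ₗ[S] M := LinearEquiv.ofBijective ε ⟨by
      rw [← LinearMap.ker_eq_bot, LinearMap.ker_eq_bot']
      intro x hx
      obtain ⟨y, rfl⟩ := h.exact_zero x hx
      have := hzero 1 one_pos
      rw [Subsingleton.elim y 0, map_zero], h.surjective⟩
    exact ⟨Module.Finite.equiv e, Module.Projective.of_equiv' e⟩
  | succ n ih =>
    intro M _ _ P _ _ d ε h hfin hproj hzero
    refine ⟨ModuleCat.of S (P 0), ε, hfin 0, hproj 0, h.surjective,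
      ih (P := fun n => P (n + 1)) (d := fun n => d (n + 1))
        (ε := (d 0).codRestrict (LinearMap.ker ε) h.ε_d) ⟨⟨fun n => h.d_d (n + 1), fun x => ?_⟩,
          ?_, fun x hx => ?_, fun n => h.exact_succ (n + 1)⟩ (fun i => hfin _) (fun i => hproj _)
          (fun i hi => hzero _ (by lia))⟩
    · exact Subtype.ext (h.d_d 0 x)
    · rintro ⟨x, hx⟩
      obtain ⟨y, hy⟩ := h.exact_zero x hx
      exact ⟨y, Subtype.ext hy⟩
    · exact h.exact_succ 0 x (congrArg Subtype.val hx)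

theorem exists_resolution {n : ℕ} : ∀ {M : Type u} [AddCommGroup M] [Module S M],
    HasFiniteResolution S n M → ∃ (P : ℕ → ModuleCat.{u} S) (d : ∀ n, P (n + 1) →ₗ[S] P n)
      (ε : P 0 →ₗ[S] M), IsResolution (P := fun n => P n) d ε ∧ (∀ i, Module.Finite S (P i)) ∧
      (∀ i, Module.Projective S (P i)) ∧ ∀ i, n < i → Subsingleton (P i) := by
  induction n with
  | zero =>
    rintro M _ _ ⟨h₁, h₂⟩
    let P : ℕ → ModuleCat.{u} S := fun i => match i with
      | 0 => ModuleCat.of S M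
      | _ + 1 => ModuleCat.of S PUnit.{u + 1}
    refine ⟨P, fun i => 0, (LinearMap.id : M →ₗ[S] M), ⟨⟨fun i x => rfl, fun x => rfl⟩,
      fun x => ⟨x, rfl⟩, fun x hx => ⟨0, hx.symm⟩, fun i x _ => ⟨0, ?_⟩⟩, fun i => ?_, fun i => ?_,
      fun i hi => ?_⟩
    · exact Subsingleton.elim (α := PUnit.{u + 1}) _ _
    · cases i with
      | zero => exact h₁
      | succ i => exact inferInstanceAs (Module.Finite S PUnit.{u + 1})
    · cases i with
      | zero => exact h₂
      | succ i => exact inferInstanceAs (Module.Projective S PUnit.{u + 1})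
    · cases i with
      | zero => exact absurd hi (lt_irrefl 0)
      | succ i => exact inferInstanceAs (Subsingleton PUnit.{u + 1})
  | succ n ih =>
    rintro M _ _ ⟨F, f, h₁, h₂, hf, h⟩
    obtain ⟨P, d, ε, hres, hfin, hproj, hzero⟩ := ih h
    let P' : ℕ → ModuleCat.{u} S := fun i => match i with
      | 0 => F
      | i + 1 => P i
    let d' : ∀ i, P' (i + 1) →ₗ[S] P' i := fun i => match i with
      | 0 => (LinearMap.ker f).subtype ∘ₗ ε
      | i + 1 => d i
    refine ⟨P', d', f, ⟨⟨fun i x => ?_, fun x => (ε x).2⟩, hf, fun x hx => ?_, fun i x hx => ?_⟩,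
      fun i => ?_, fun i => ?_, fun i hi => ?_⟩
    · cases i with
      | zero => exact congrArg Subtype.val (hres.ε_d x)
      | succ i => exact hres.d_d i x
    · obtain ⟨y, hy⟩ := hres.surjective ⟨x, hx⟩
      exact ⟨y, congrArg Subtype.val hy⟩
    · cases i with
      | zero => exact hres.exact_zero x (Subtype.ext hx)
      | succ i => exact hres.exact_succ i x hx
    · cases i with
      | zero => exact h₁
      | succ i => exact hfin i
    · cases i with
      | zero => exact h₂
      | succ i => exact hproj i
    · cases i with
      | zero => exact absurd hi (Nat.not_lt_zero _)
      | succ i => exact hzero i (by lia)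

end HasFiniteResolution

theorem isResolution_projectiveResolution {M : ModuleCat.{u} S} (R : ProjectiveResolution M) :
    IsResolution (P := fun n => R.complex.X n) (fun n => (R.complex.d (n + 1) n).hom)
      (R.π.f 0).hom where
  d_d n x := by
    have := R.complex.d_comp_d (n + 2) (n + 1) n
    exact DFunLike.congr_fun (congrArg ModuleCat.Hom.hom this) x
  ε_d x := DFunLike.congr_fun (congrArg ModuleCat.Hom.hom R.complex_d_comp_π_f_zero) x
  surjective := (ModuleCat.epi_iff_surjective (R.π.f 0)).1 inferInstance
  exact_zero x hx := (ShortComplex.moduleCat_exact_iff _).1 R.exact₀ x hx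
  exact_succ n x hx := (ShortComplex.moduleCat_exact_iff _).1 (R.exact_succ n) x hx

theorem exists_projectiveResolution {M : Type u} [AddCommGroup M] [Module S M]
    {P : ℕ → ModuleCat.{u} S} {d : ∀ n, P (n + 1) →ₗ[S] P n} {ε : P 0 →ₗ[S] M}
    (h : IsResolution (P := fun n => P n) d ε) (hproj : ∀ i, Module.Projective S (P i)) :
    ∃ R : ProjectiveResolution (ModuleCat.of S M), R.complex.X = P := by
  have hdd : ∀ n, ModuleCat.ofHom (d (n + 1)) ≫ ModuleCat.ofHom (d n) = 0 := fun n => by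
    ext x
    exact h.d_d n x
  let C : ChainComplex (ModuleCat.{u} S) ℕ := ChainComplex.of P (fun n => ModuleCat.ofHom (d n)) hdd
  have hC : ∀ n, C.d (n + 1) n = ModuleCat.ofHom (d n) := fun n =>
    ChainComplex.of_d (X := P) (d := fun n => ModuleCat.ofHom (d n)) n
  have hπ : C.d 1 0 ≫ ModuleCat.ofHom ε = 0 := by
    rw [hC]
    ext x
    exact h.ε_d x
  refine ⟨{ complex := C
            projective := fun n => (IsProjective.iff_projective (R := S) (P n)).1 (hproj n)
            π := (ChainComplex.toSingle₀Equiv C (ModuleCat.of S M)).symm ⟨ModuleCat.ofHom ε, hπ⟩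
            quasiIso := ⟨fun n => ?_⟩ }, rfl⟩
  cases n with
  | zero =>
    rw [ChainComplex.quasiIsoAt₀_iff, ShortComplex.quasiIso_iff_of_zeros' _ rfl rfl rfl]
    refine (ShortComplex.exact_and_epi_g_iff_of_iso (S₂ := ShortComplex.mk _ _ hπ)
      (ShortComplex.isoMk (Iso.refl _) (Iso.refl _) (Iso.refl _) (by simp) (by simp))).2
      ⟨?_, (ModuleCat.epi_iff_surjective _).2 h.surjective⟩
    refine (ShortComplex.moduleCat_exact_iff _).2 fun x hx => ?_
    obtain ⟨y, hy⟩ := h.exact_zero x hx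
    exact ⟨y, by simpa [hC] using hy⟩
  | succ n =>
    rw [quasiIsoAt_iff_exactAt' _ _ (ChainComplex.exactAt_succ_single_obj _ _),
      HomologicalComplex.exactAt_iff' _ (n + 1 + 1) (n + 1) n (by simp) (by simp)]
    refine (ShortComplex.moduleCat_exact_iff _).2 fun x hx => ?_
    have hx' : d n x = 0 := by
      have : (C.d (n + 1) n).hom x = 0 := hx
      rw [hC] at this
      exact this
    obtain ⟨y, hy⟩ := h.exact_succ n x hx'
    refine ⟨y, ?_⟩
    change (C.d (n + 1 + 1) (n + 1)).hom y = x
    rw [hC]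
    exact hy

end FiniteResolutions

section BimoduleMaps

variable {k : Type v} {A : Type u} [CommRing k] [Ring A] [Algebra k A]
variable {M N P : Type u} [AddCommGroup M] [AddCommGroup N] [AddCommGroup P]
  [Module (Env k A) M] [Module (Env k A) N] [Module (Env k A) P]

theorem env_induction {p : Env k A → Prop} (lft : ∀ a, p (lft k a)) (rgt : ∀ a, p (rgt k a))
    (mul : ∀ x y, p x → p y → p (x * y)) (add : ∀ x y, p x → p y → p (x + y)) (e : Env k A) :
    p e := by
  induction e using TensorProduct.induction_on with
  | zero =>
    have h : VdB.lft k (0 : A) = 0 := TensorProduct.zero_tmul _ _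
    exact h ▸ lft 0
  | tmul a b =>
    induction b using MulOpposite.rec'
    rw [tmul_eq_lft_mul_rgt]
    exact mul _ _ (lft _) (rgt _)
  | add x y hx hy => exact add x y hx hy

/-- An additive map that commutes with the left and right actions of `A` is a map of bimodules. -/
def bimoduleHom (f : M →+ N) (hl : ∀ (a : A) m, f (lft k a • m) = lft k a • f m)
    (hr : ∀ (a : A) m, f (rgt k a • m) = rgt k a • f m) : M →ₗ[Env k A] N where
  toFun := f
  map_add' := f.map_add
  map_smul' e := by
    induction e using env_induction with
    | lft a => exact hl a
    | rgt a => exact hr a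
    | mul x y hx hy =>
      intro m
      simp only [RingHom.id_apply] at hx hy ⊢
      rw [mul_smul, mul_smul, hx, hy]
    | add x y hx hy =>
      intro m
      simp only [RingHom.id_apply] at hx hy ⊢
      rw [add_smul, add_smul, map_add, hx, hy]

variable (k A) in
/-- The ring homomorphism `a ↦ a ⊗ 1`. -/
abbrev lftRing : A →+* Env k A := Algebra.TensorProduct.includeLeftRingHom

variable (k A) in
/-- The ring homomorphism `b ↦ 1 ⊗ b`. -/
abbrev rgtRing : Aᵐᵒᵖ →+* Env k A :=
  (Algebra.TensorProduct.includeRight : Aᵐᵒᵖ →ₐ[k] Env k A).toRingHom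

theorem lft_zero : lft k (0 : A) = 0 := TensorProduct.zero_tmul _ _

theorem rgt_zero : rgt k (0 : A) = 0 := TensorProduct.tmul_zero _ _

theorem lft_add (a b : A) : lft k (a + b) = lft k a + lft k b := TensorProduct.add_tmul _ _ _

theorem rgt_add (a b : A) : rgt k (a + b) = rgt k a + rgt k b := TensorProduct.tmul_add _ _ _

theorem rgt_mul (a b : A) : rgt k (a * b) = rgt k b * rgt k a := by
  simp [rgt, op_mul]

theorem rgt_lft_comm (a b : A) (m : M) : rgt k a • lft k b • m = lft k b • rgt k a • m := by
  rw [← mul_smul, ← mul_smul, commute_lft_rgt]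

instance [Module.Projective k A] : Module.Projective A (Along (lftRing k A) (Env k A)) := by
  have : Module.Projective k Aᵐᵒᵖ := Module.Projective.of_equiv' (opLinearEquiv k)
  let e : A ⊗[k] Aᵐᵒᵖ ≃ₗ[A] Along (lftRing k A) (Env k A) :=
    { toFun := fun x => x
      invFun := fun x => x
      left_inv := fun _ => rfl
      right_inv := fun _ => rfl
      map_add' := fun _ _ => rfl
      map_smul' := fun a x => by
        change a • x = lft k a * x
        induction x using TensorProduct.induction_on with
        | zero => simp
        | tmul x y => simp [TensorProduct.smul_tmul']
        | add x y hx hy => rw [smul_add, mul_add, hx, hy] }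
  exact Module.Projective.of_equiv' e

instance [Module.Projective k A] : Module.Projective Aᵐᵒᵖ (Along (rgtRing k A) (Env k A)) := by
  let e : Aᵐᵒᵖ ⊗[k] A ≃ₗ[Aᵐᵒᵖ] Along (rgtRing k A) (Env k A) :=
    { (TensorProduct.comm k Aᵐᵒᵖ A).toAddEquiv with
      map_smul' := fun a x => by
        change TensorProduct.comm k Aᵐᵒᵖ A (a • x) =
          ((1 : A) ⊗ₜ[k] a : Env k A) * TensorProduct.comm k Aᵐᵒᵖ A x
        induction x using TensorProduct.induction_on with
        | zero => simp
        | tmul x y => simp [TensorProduct.smul_tmul']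
        | add x y hx hy => rw [smul_add, map_add, map_add, mul_add, hx, hy] }
  exact Module.Projective.of_equiv' e

namespace BTensor

/-- The map of bimodules out of `M ⊗_A N` defined by a balanced biadditive map. -/
def liftHom (f : M →+ N →+ P) (hf : ∀ m (a : A) n, f (rgt k a • m) n = f m (lft k a • n))
    (hl : ∀ (a : A) m n, f (lft k a • m) n = lft k a • f m n)
    (hr : ∀ (a : A) m n, f m (rgt k a • n) = rgt k a • f m n) : BTensor k A M N →ₗ[Env k A] P :=
  bimoduleHom (lift f hf)
    (fun a x => by
      induction x using BTensor.induction with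
      | zero => simp
      | tmul m n => rw [lft_smul_btmul, lift_btmul, lift_btmul, hl]
      | add x y hx hy => simp only [smul_add, map_add, hx, hy])
    (fun a x => by
      induction x using BTensor.induction with
      | zero => simp
      | tmul m n => rw [rgt_smul_btmul, lift_btmul, lift_btmul, hr]
      | add x y hx hy => simp only [smul_add, map_add, hx, hy])

theorem linearMap_ext {f g : BTensor k A M N →ₗ[Env k A] P}
    (h : ∀ m n, f (btmul k A m n) = g (btmul k A m n)) : f = g :=
  LinearMap.toAddMonoidHom_injective (hom_ext h)

variable (M) in
/-- The map `id ⊗ f`. -/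
def mapRight (f : N →ₗ[Env k A] P) : BTensor k A M N →ₗ[Env k A] BTensor k A M P :=
  liftHom (btmulHom.compl₂ f.toAddMonoidHom)
    (fun m a n => by simp [btmulHom_apply, rgt_btmul])
    (fun a m n => by simp [btmulHom_apply, lft_smul_btmul])
    (fun a m n => by simp [btmulHom_apply, rgt_smul_btmul])

variable (P) in
/-- The map `f ⊗ id`. -/
def mapLeft (f : M →ₗ[Env k A] N) : BTensor k A M P →ₗ[Env k A] BTensor k A N P :=
  liftHom (btmulHom.comp f.toAddMonoidHom)
    (fun m a n => by simp [btmulHom_apply, rgt_btmul])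
    (fun a m n => by simp [btmulHom_apply, lft_smul_btmul])
    (fun a m n => by simp [btmulHom_apply, rgt_smul_btmul])

theorem mapRight_btmul (f : N →ₗ[Env k A] P) (m : M) (n : N) :
    mapRight M f (btmul k A m n) = btmul k A m (f n) := rfl

theorem mapLeft_btmul (f : M →ₗ[Env k A] N) (m : M) (p : P) :
    mapLeft P f (btmul k A m p) = btmul k A (f m) p := rfl

theorem mapRight_surjective {f : N →ₗ[Env k A] P} (hf : Function.Surjective f) :
    Function.Surjective (mapRight M f) := by
  intro x
  induction x using BTensor.induction with
  | zero => exact ⟨0, map_zero _⟩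
  | tmul m p =>
    obtain ⟨n, rfl⟩ := hf p
    exact ⟨btmul k A m n, rfl⟩
  | add x y hx hy =>
    obtain ⟨x, rfl⟩ := hx
    obtain ⟨y, rfl⟩ := hy
    exact ⟨x + y, map_add _ _ _⟩

theorem mapLeft_surjective {f : M →ₗ[Env k A] N} (hf : Function.Surjective f) :
    Function.Surjective (mapLeft P f) := by
  intro x
  induction x using BTensor.induction with
  | zero => exact ⟨0, map_zero _⟩
  | tmul m p =>
    obtain ⟨n, rfl⟩ := hf m
    exact ⟨btmul k A n p, rfl⟩
  | add x y hx hy =>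
    obtain ⟨x, rfl⟩ := hx
    obtain ⟨y, rfl⟩ := hy
    exact ⟨x + y, map_add _ _ _⟩

/-- The map `m ⊗ a ↦ m ε(a)`, for `ε : N → A`. -/
def augRight (M : Type u) [AddCommGroup M] [Module (Env k A) M] (ε : N →ₗ[Env k A] A) :
    BTensor k A M N →ₗ[Env k A] M :=
  liftHom (AddMonoidHom.mk' (fun m => AddMonoidHom.mk' (fun n => rgt k (ε n) • m)
      (fun n n' => by rw [map_add, rgt_add, add_smul]))
      (fun m m' => by ext n; exact smul_add _ _ _))
    (fun m a n => by
      change rgt k (ε n) • rgt k a • m = rgt k (ε (lft k a • n)) • m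
      rw [map_smul, lft_smul_self, rgt_mul_smul])
    (fun a m n => rgt_lft_comm _ _ _)
    (fun a m n => by
      change rgt k (ε (rgt k a • n)) • m = rgt k a • rgt k (ε n) • m
      rw [map_smul, rgt_smul_self, rgt_mul_smul])

/-- The map `n ⊗ m ↦ ε(n) m`, for `ε : N → A`. -/
def augLeft (M : Type u) [AddCommGroup M] [Module (Env k A) M] (ε : N →ₗ[Env k A] A) :
    BTensor k A N M →ₗ[Env k A] M :=
  liftHom (AddMonoidHom.mk' (fun n => AddMonoidHom.mk' (fun m => lft k (ε n) • m)
      (fun m m' => smul_add _ _ _))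
      (fun n n' => by ext m; exact (by rw [map_add, lft_add, add_smul] :
        lft k (ε (n + n')) • m = lft k (ε n) • m + lft k (ε n') • m)))
    (fun n a m => by
      change lft k (ε (rgt k a • n)) • m = lft k (ε n) • lft k a • m
      rw [map_smul, rgt_smul_self, lft_mul_smul])
    (fun a n m => by
      change lft k (ε (lft k a • n)) • m = lft k a • lft k (ε n) • m
      rw [map_smul, lft_smul_self, lft_mul_smul])
    (fun a n m => (rgt_lft_comm _ _ _).symm)

theorem augRight_btmul (ε : N →ₗ[Env k A] A) (m : M) (n : N) :
    augRight M ε (btmul k A m n) = rgt k (ε n) • m := rfl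

theorem augLeft_btmul (ε : N →ₗ[Env k A] A) (m : M) (n : N) :
    augLeft M ε (btmul k A n m) = lft k (ε n) • m := rfl

end BTensor

end BimoduleMaps

section Projectivity

variable {k : Type v} {A : Type u} [CommRing k] [Ring A] [Algebra k A]
variable (U Y : Type u) [AddCommGroup U] [AddCommGroup Y] [Module (Env k A) U] [Module (Env k A) Y]

variable (k A) in
/-- The left `A`-linear maps. -/
def LHom : AddSubgroup (U →+ Y) where
  carrier := {h | ∀ (a : A) u, h (lft k a • u) = lft k a • h u}
  zero_mem' a u := by simp
  add_mem' {h h'} hh hh' a u := by simp [hh a u, hh' a u]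
  neg_mem' {h} hh a u := by simp [hh a u]

variable (k A) in
/-- The right `A`-linear maps. -/
def RHom : AddSubgroup (U →+ Y) where
  carrier := {h | ∀ (a : A) u, h (rgt k a • u) = rgt k a • h u}
  zero_mem' a u := by simp
  add_mem' {h h'} hh hh' a u := by simp [hh a u, hh' a u]
  neg_mem' {h} hh a u := by simp [hh a u]

/-- The bimodule structure `(a h b)(u) = h(u a) b` on the left `A`-linear maps. -/
instance : Module (Env k A) (LHom k A U Y) :=
  moduleOfActions k
    { toFun := fun a => AddMonoidHom.mk' (fun h =>
        ⟨h.1.comp (DistribSMul.toAddMonoidHom U (rgt k a)), fun b u => by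
          simp [rgt_lft_comm, h.2 b]⟩) (fun h h' => rfl)
      map_one' := by ext h u; exact congrArg h.1 (rgt_one_smul k u)
      map_mul' := fun a b => by ext h u; exact congrArg h.1 (rgt_mul_smul k a b u)
      map_zero' := by
        ext h u
        change h.1 (rgt k (0 : A) • u) = 0
        rw [rgt_zero, zero_smul (Env k A) u, map_zero]
      map_add' := fun a b => by
        ext h u
        change h.1 (rgt k (a + b) • u) = h.1 (rgt k a • u) + h.1 (rgt k b • u)
        rw [rgt_add, add_smul, map_add] }
    { toFun := fun a => AddMonoidHom.mk' (fun h =>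
        ⟨(DistribSMul.toAddMonoidHom Y (rgt k a.unop)).comp h.1, fun b u => by
          simp [rgt_lft_comm, h.2 b]⟩) (fun h h' => by ext u; exact smul_add _ _ _)
      map_one' := by ext h u; exact rgt_one_smul k (h.1 u)
      map_mul' := fun a b => by ext h u; exact rgt_mul_smul k b.unop a.unop (h.1 u)
      map_zero' := by
        ext h u
        change rgt k (0 : A) • h.1 u = 0
        rw [rgt_zero, zero_smul (Env k A) (h.1 u)]
      map_add' := fun a b => by
        ext h u
        change rgt k (a.unop + b.unop) • h.1 u = rgt k a.unop • h.1 u + rgt k b.unop • h.1 u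
        rw [rgt_add, add_smul] }
    (fun a b h => rfl)
    (fun c h => by
      ext u
      change h.1 (rgt k (algebraMap k A c) • u) = rgt k (algebraMap k A c) • h.1 u
      rw [← lft_algebraMap, h.2])

/-- The bimodule structure `(a h b)(u) = a h(b u)` on the right `A`-linear maps. -/
instance : Module (Env k A) (RHom k A U Y) :=
  moduleOfActions k
    { toFun := fun a => AddMonoidHom.mk' (fun h =>
        ⟨(DistribSMul.toAddMonoidHom Y (lft k a)).comp h.1, fun b u => by
          simp [rgt_lft_comm, h.2 b]⟩) (fun h h' => by ext u; exact smul_add _ _ _)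
      map_one' := by ext h u; exact lft_one_smul k (h.1 u)
      map_mul' := fun a b => by ext h u; exact lft_mul_smul k a b (h.1 u)
      map_zero' := by
        ext h u
        change lft k (0 : A) • h.1 u = 0
        rw [lft_zero, zero_smul (Env k A) (h.1 u)]
      map_add' := fun a b => by
        ext h u
        change lft k (a + b) • h.1 u = lft k a • h.1 u + lft k b • h.1 u
        rw [lft_add, add_smul] }
    { toFun := fun a => AddMonoidHom.mk' (fun h =>
        ⟨h.1.comp (DistribSMul.toAddMonoidHom U (lft k a.unop)), fun b u => by
          simp [← rgt_lft_comm, h.2 b]⟩) (fun h h' => rfl)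
      map_one' := by ext h u; exact congrArg h.1 (lft_one_smul k u)
      map_mul' := fun a b => by ext h u; exact congrArg h.1 (lft_mul_smul k b.unop a.unop u)
      map_zero' := by
        ext h u
        change h.1 (lft k (0 : A) • u) = 0
        rw [lft_zero, zero_smul (Env k A) u, map_zero]
      map_add' := fun a b => by
        ext h u
        change h.1 (lft k (a.unop + b.unop) • u) = h.1 (lft k a.unop • u) + h.1 (lft k b.unop • u)
        rw [lft_add, add_smul, map_add] }
    (fun a b h => rfl)
    (fun c h => by
      ext u
      change lft k (algebraMap k A c) • h.1 u = h.1 (lft k (algebraMap k A c) • u)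
      rw [lft_algebraMap, h.2])

variable {U Y}

theorem LHom.lft_smul_apply (a : A) (h : LHom k A U Y) (u : U) :
    (lft k a • h).1 u = h.1 (rgt k a • u) := rgt_one_smul k (h.1 (rgt k a • u))

theorem LHom.rgt_smul_apply (a : A) (h : LHom k A U Y) (u : U) :
    (rgt k a • h).1 u = rgt k a • h.1 u :=
  congrArg (fun x => rgt k a • h.1 x) (rgt_one_smul k u)

theorem RHom.lft_smul_apply (a : A) (h : RHom k A U Y) (u : U) :
    (lft k a • h).1 u = lft k a • h.1 u :=
  congrArg (fun x => lft k a • h.1 x) (lft_one_smul k u)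

theorem RHom.rgt_smul_apply (a : A) (h : RHom k A U Y) (u : U) :
    (rgt k a • h).1 u = h.1 (lft k a • u) := lft_one_smul k (h.1 (lft k a • u))

/-- If `U` is projective as a left module and `P` is a projective bimodule, then `U ⊗_A P` is a
projective bimodule. -/
theorem projective_btensor_left [Module.Projective A (Along (lftRing k A) U)] {P : Type u}
    [AddCommGroup P] [Module (Env k A) P] [Module.Projective (Env k A) P] :
    Module.Projective (Env k A) (BTensor k A U P) := by
  refine Module.Projective.of_lifting_property fun {X Y} _ _ _ _ f g₀ hf => ?_
  let post : LHom k A U X →ₗ[Env k A] LHom k A U Y :=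
    bimoduleHom
      (AddMonoidHom.mk' (fun h => ⟨f.toAddMonoidHom.comp h.1, fun a u => by simp [h.2 a]⟩)
        fun h h' => by ext u; exact map_add f _ _)
      (fun a h => by ext u; simp [LHom.lft_smul_apply])
      (fun a h => by ext u; simp [LHom.rgt_smul_apply])
  have hpost : Function.Surjective post := by
    intro h
    obtain ⟨h', hh'⟩ := Module.projective_lifting_property (alongMap (lftRing k A) f)
      (show Along (lftRing k A) U →ₗ[A] Along (lftRing k A) Y from
        { toFun := h.1, map_add' := h.1.map_add, map_smul' := h.2 }) hf
    exact ⟨⟨h'.toAddMonoidHom, h'.map_smul⟩, by ext u; exact DFunLike.congr_fun hh' u⟩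
  let unit : P →ₗ[Env k A] LHom k A U Y :=
    bimoduleHom (AddMonoidHom.mk' (fun p =>
        ⟨g₀.toAddMonoidHom.comp ((btmulHom (k := k) (A := A) (M := U)).flip p), fun a u => by
          change g₀ (btmul k A (lft k a • u) p) = lft k a • g₀ (btmul k A u p)
          rw [← lft_smul_btmul, map_smul]⟩) fun p p' => by
            ext u; exact (congrArg g₀ (btmul_add k A u p p')).trans (map_add _ _ _))
      (fun a p => by ext u; rw [LHom.lft_smul_apply]; exact congrArg g₀ (rgt_btmul k A u a p).symm)
      (fun a p => by
        ext u
        rw [LHom.rgt_smul_apply]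
        exact (congrArg g₀ (rgt_smul_btmul a u p).symm).trans (map_smul _ _ _))
  obtain ⟨g, hg⟩ := Module.projective_lifting_property post unit hpost
  have hg' : ∀ p u, f ((g p).1 u) = g₀ (btmul k A u p) := fun p u =>
    DFunLike.congr_fun (congrArg Subtype.val (DFunLike.congr_fun hg p)) u
  refine ⟨BTensor.liftHom (AddMonoidHom.flip ((LHom k A U X).subtype.comp g.toAddMonoidHom))
    (fun u a p => ?_) (fun a u p => (g p).2 a u) (fun a u p => ?_), ?_⟩
  · change (g p).1 (rgt k a • u) = (g (lft k a • p)).1 u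
    rw [map_smul g, LHom.lft_smul_apply]
  · change (g (rgt k a • p)).1 u = rgt k a • (g p).1 u
    rw [map_smul, LHom.rgt_smul_apply]
  · exact BTensor.linearMap_ext fun u p => hg' p u

/-- If `U` is projective as a right module and `P` is a projective bimodule, then `P ⊗_A U` is a
projective bimodule. -/
theorem projective_btensor_right [Module.Projective Aᵐᵒᵖ (Along (rgtRing k A) U)] {P : Type u}
    [AddCommGroup P] [Module (Env k A) P] [Module.Projective (Env k A) P] :
    Module.Projective (Env k A) (BTensor k A P U) := by
  refine Module.Projective.of_lifting_property fun {X Y} _ _ _ _ f g₀ hf => ?_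
  let post : RHom k A U X →ₗ[Env k A] RHom k A U Y :=
    bimoduleHom
      (AddMonoidHom.mk' (fun h => ⟨f.toAddMonoidHom.comp h.1, fun a u => by simp [h.2 a]⟩)
        fun h h' => by ext u; exact map_add f _ _)
      (fun a h => by ext u; simp [RHom.lft_smul_apply])
      (fun a h => by ext u; simp [RHom.rgt_smul_apply])
  have hpost : Function.Surjective post := by
    intro h
    obtain ⟨h', hh'⟩ := Module.projective_lifting_property (alongMap (rgtRing k A) f)
      (show Along (rgtRing k A) U →ₗ[Aᵐᵒᵖ] Along (rgtRing k A) Y from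
        { toFun := h.1, map_add' := h.1.map_add, map_smul' := fun a => h.2 a.unop }) hf
    exact ⟨⟨h'.toAddMonoidHom, fun a => h'.map_smul (op a)⟩, by
      ext u; exact DFunLike.congr_fun hh' u⟩
  let unit : P →ₗ[Env k A] RHom k A U Y :=
    bimoduleHom (AddMonoidHom.mk' (fun p =>
        ⟨g₀.toAddMonoidHom.comp (btmulHom (k := k) (A := A) (N := U) p), fun a u => by
          change g₀ (btmul k A p (rgt k a • u)) = rgt k a • g₀ (btmul k A p u)
          rw [← rgt_smul_btmul, map_smul]⟩) fun p p' => by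
            ext u; exact (congrArg g₀ (add_btmul k A p p' u)).trans (map_add _ _ _))
      (fun a p => by
        ext u
        rw [RHom.lft_smul_apply]
        exact (congrArg g₀ (lft_smul_btmul a p u).symm).trans (map_smul _ _ _))
      (fun a p => by ext u; rw [RHom.rgt_smul_apply]; exact congrArg g₀ (rgt_btmul k A p a u))
  obtain ⟨g, hg⟩ := Module.projective_lifting_property post unit hpost
  have hg' : ∀ p u, f ((g p).1 u) = g₀ (btmul k A p u) := fun p u =>
    DFunLike.congr_fun (congrArg Subtype.val (DFunLike.congr_fun hg p)) u
  refine ⟨BTensor.liftHom ((RHom k A U X).subtype.comp g.toAddMonoidHom)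
    (fun p a u => ?_) (fun a p u => ?_) (fun a p u => (g p).2 a u), ?_⟩
  · change (g (rgt k a • p)).1 u = (g p).1 (lft k a • u)
    rw [map_smul, RHom.rgt_smul_apply]
  · change (g (lft k a • p)).1 u = lft k a • (g p).1 u
    rw [map_smul, RHom.lft_smul_apply]
  · exact BTensor.linearMap_ext fun u p => hg' u p

end Projectivity

section FinsuppRetract

variable {I X Y Z TX TY TZ : Type*} [AddCommGroup X] [AddCommGroup Y] [AddCommGroup Z]
  [AddCommGroup TX] [AddCommGroup TY] [AddCommGroup TZ]

/-- A natural retract of an exact sequence of groups of finitely supported functions is exact. -/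
theorem exact_of_finsupp_retract (f : X →+ Y) (g : Y →+ Z) (hfg : ∀ y, g y = 0 → ∃ x, f x = y)
    (f' : TX →+ TY) (g' : TY →+ TZ) (βX : (I →₀ X) →+ TX) (βY : (I →₀ Y) →+ TY)
    (αY : TY →+ (I →₀ Y)) (αZ : TZ →+ (I →₀ Z)) (hβα : ∀ y, βY (αY y) = y)
    (hα : ∀ y i, αZ (g' y) i = g (αY y i))
    (hβ : ∀ i x, βY (Finsupp.single i (f x)) = f' (βX (Finsupp.single i x))) {y : TY}
    (hy : g' y = 0) : ∃ x, f' x = y := by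
  have key : ∀ z : I →₀ Y, (∀ i, g (z i) = 0) → ∃ x, f' x = βY z := by
    intro z
    induction z using Finsupp.induction with
    | zero => exact fun _ => ⟨0, by simp⟩
    | single_add i b z hi hb ih =>
      intro hz
      have hzi : z i = 0 := Finsupp.notMem_support_iff.1 hi
      obtain ⟨x, hx⟩ := ih fun j => by
        by_cases hj : i = j
        · rw [← hj, hzi, map_zero]
        · simpa [Finsupp.single_apply, hj] using hz j
      obtain ⟨w, rfl⟩ := hfg b (by simpa [hzi] using hz i)
      exact ⟨βX (Finsupp.single i w) + x, by rw [map_add, map_add, hx, hβ]⟩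
  obtain ⟨x, hx⟩ := key (αY y) fun i => by rw [← hα, hy, map_zero, Finsupp.zero_apply]
  exact ⟨x, hx.trans (hβα y)⟩

theorem injective_of_finsupp_retract (g : Y →+ Z) (hg : Function.Injective g) (g' : TY →+ TZ)
    (βY : (I →₀ Y) →+ TY) (αY : TY →+ (I →₀ Y)) (αZ : TZ →+ (I →₀ Z))
    (hβα : ∀ y, βY (αY y) = y) (hα : ∀ y i, αZ (g' y) i = g (αY y i)) :
    Function.Injective g' := by
  refine (injective_iff_map_eq_zero g').2 fun y hy => ?_
  have : αY y = 0 := by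
    ext i
    exact (injective_iff_map_eq_zero g).1 hg _ (by rw [← hα, hy, map_zero, Finsupp.zero_apply])
  rw [← hβα y, this, map_zero]

end FinsuppRetract

section Exactness

variable {k : Type v} {A : Type u} [CommRing k] [Ring A] [Algebra k A]

variable (k) in
/-- The additive map `a ↦ m a`. -/
def rgtHom {M : Type u} [AddCommGroup M] [Module (Env k A) M] (m : M) : A →+ M :=
  AddMonoidHom.mk' (fun a => rgt k a • m) fun a b => by rw [rgt_add, add_smul]

variable (k) in
/-- The additive map `a ↦ a m`. -/
def lftHom {M : Type u} [AddCommGroup M] [Module (Env k A) M] (m : M) : A →+ M :=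
  AddMonoidHom.mk' (fun a => lft k a • m) fun a b => by rw [lft_add, add_smul]

section Left

variable {U : Type u} [AddCommGroup U] [Module (Env k A) U]

theorem exists_leftCoord (k : Type v) {A : Type u} [CommRing k] [Ring A] [Algebra k A]
    (U : Type u) [AddCommGroup U] [Module (Env k A) U]
    [h : Module.Projective A (Along (lftRing k A) U)] :
    ∃ s : U →+ (U →₀ A), (∀ (a : A) u q, s (lft k a • u) q = a * s u q) ∧
      ∀ u, Finsupp.liftAddHom (lftHom k) (s u) = u := by
  obtain ⟨s, hs⟩ := h.out
  refine ⟨s.toAddMonoidHom, fun a u q => DFunLike.congr_fun (s.map_smul a u) q, fun u => ?_⟩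
  exact hs u

variable (s : U →+ (U →₀ A)) (hs : ∀ (a : A) u q, s (lft k a • u) q = a * s u q)
  (hs' : ∀ u, Finsupp.liftAddHom (lftHom k) (s u) = u)
  (M : Type u) [AddCommGroup M] [Module (Env k A) M]

/-- The coordinates of `m ⊗ u`, in terms of the coordinates of `u`. -/
def leftCoord : BTensor k A M U →+ (U →₀ M) :=
  BTensor.lift (AddMonoidHom.mk' (fun m =>
      (Finsupp.mapRange.addMonoidHom (rgtHom k m)).comp s)
      (fun m m' => by
        ext u q
        exact smul_add (rgt k (s u q)) m m'))
    (fun m a u => by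
      ext q
      change rgt k (s u q) • rgt k a • m = rgt k (s (lft k a • u) q) • m
      rw [hs, rgt_mul_smul])

variable (k A U) in
/-- The element of `M ⊗_A U` with given coordinates. -/
def leftCoordInv : (U →₀ M) →+ BTensor k A M U := Finsupp.liftAddHom fun q => btmulHom.flip q

theorem leftCoordInv_single (q : U) (m : M) :
    leftCoordInv k A U M (Finsupp.single q m) = btmul k A m q :=
  Finsupp.liftAddHom_apply_single _ _ _

include hs' in
theorem leftCoordInv_leftCoord (x : BTensor k A M U) :
    leftCoordInv k A U M (leftCoord s hs M x) = x := by
  induction x using BTensor.induction with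
  | zero => simp
  | add x y hx hy => rw [map_add, map_add, hx, hy]
  | tmul m u =>
    have key : ∀ f : U →₀ A,
        leftCoordInv k A U M (Finsupp.mapRange.addMonoidHom (rgtHom k m) f) =
          btmul k A m (Finsupp.liftAddHom (lftHom k) f) := by
      intro f
      induction f using Finsupp.induction_linear with
      | zero => rw [map_zero, map_zero, map_zero, btmul_zero]
      | add f g hf hg => rw [map_add, map_add, hf, hg, map_add, btmul_add]
      | single q a =>
        rw [Finsupp.mapRange.addMonoidHom_apply, Finsupp.mapRange_single,
          leftCoordInv_single, Finsupp.liftAddHom_apply_single]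
        exact rgt_btmul k A m a q
    exact (key (s u)).trans (congrArg (btmul k A m) (hs' u))

variable (U) {X Y Z : Type u} [AddCommGroup X] [AddCommGroup Y] [AddCommGroup Z]
  [Module (Env k A) X] [Module (Env k A) Y] [Module (Env k A) Z]

/-- Tensoring with a bimodule that is projective as a left module is exact. -/
theorem exact_mapLeft [Module.Projective A (Along (lftRing k A) U)] (f : X →ₗ[Env k A] Y)
    (g : Y →ₗ[Env k A] Z) (hfg : ∀ y, g y = 0 → ∃ x, f x = y) (y : BTensor k A Y U)
    (hy : BTensor.mapLeft U g y = 0) : ∃ x, BTensor.mapLeft U f x = y := by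
  obtain ⟨s, hs, hs'⟩ := exists_leftCoord k (A := A) U
  refine exact_of_finsupp_retract f.toAddMonoidHom g.toAddMonoidHom hfg
    (BTensor.mapLeft U f).toAddMonoidHom (BTensor.mapLeft U g).toAddMonoidHom
    (leftCoordInv k A U X) (leftCoordInv k A U Y) (leftCoord s hs Y) (leftCoord s hs Z)
    (leftCoordInv_leftCoord s hs hs' Y) (fun y i => ?_) (fun i x => ?_) hy
  · induction y using BTensor.induction with
    | zero => simp
    | tmul y u => exact (map_smul g _ _).symm
    | add x y hx hy => rw [map_add, map_add, Finsupp.add_apply, hx, hy, map_add, Finsupp.add_apply,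
        map_add]
  · rw [leftCoordInv_single, leftCoordInv_single]
    rfl

theorem exact_augLeft [Module.Projective A (Along (lftRing k A) U)] (f : X →ₗ[Env k A] Y)
    (g : Y →ₗ[Env k A] A) (hfg : ∀ y, g y = 0 → ∃ x, f x = y) (y : BTensor k A Y U)
    (hy : BTensor.augLeft U g y = 0) : ∃ x, BTensor.mapLeft U f x = y := by
  obtain ⟨s, hs, hs'⟩ := exists_leftCoord k (A := A) U
  refine exact_of_finsupp_retract f.toAddMonoidHom g.toAddMonoidHom hfg
    (BTensor.mapLeft U f).toAddMonoidHom (BTensor.augLeft U g).toAddMonoidHom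
    (leftCoordInv k A U X) (leftCoordInv k A U Y) (leftCoord s hs Y) s
    (leftCoordInv_leftCoord s hs hs' Y) (fun y i => ?_) (fun i x => ?_) hy
  · induction y using BTensor.induction with
    | zero => simp
    | tmul y u =>
      change s (lft k (g y) • u) i = g (rgt k (s u i) • y)
      rw [map_smul g, rgt_smul_self, hs]
    | add x y hx hy => rw [map_add, map_add, Finsupp.add_apply, hx, hy, map_add, Finsupp.add_apply,
        map_add]
  · rw [leftCoordInv_single, leftCoordInv_single]
    rfl

variable {P : ℕ → Type u} [∀ n, AddCommGroup (P n)] [∀ n, Module (Env k A) (P n)]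
  {d : ∀ n, P (n + 1) →ₗ[Env k A] P n} {ε : P 0 →ₗ[Env k A] A}

theorem IsAugmented.mapRight (hP : IsAugmented d ε) :
    IsAugmented (P := fun n => BTensor k A U (P n)) (fun n => BTensor.mapRight U (d n))
      (BTensor.augRight U ε) where
  d_d n x := by
    induction x using BTensor.induction with
    | zero => simp
    | tmul u p => simp only [BTensor.mapRight_btmul, hP.d_d, btmul_zero]
    | add x y hx hy => simp only [map_add, hx, hy, add_zero]
  ε_d x := by
    induction x using BTensor.induction with
    | zero => simp
    | tmul u p =>
      rw [BTensor.mapRight_btmul, BTensor.augRight_btmul, hP.ε_d, rgt_zero]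
      exact zero_smul (Env k A) u
    | add x y hx hy => simp only [map_add, hx, hy, add_zero]

theorem IsAugmented.mapLeft (hP : IsAugmented d ε) :
    IsAugmented (P := fun n => BTensor k A (P n) U) (fun n => BTensor.mapLeft U (d n))
      (BTensor.augLeft U ε) where
  d_d n x := by
    induction x using BTensor.induction with
    | zero => simp
    | tmul p u => simp only [BTensor.mapLeft_btmul, hP.d_d, zero_btmul]
    | add x y hx hy => simp only [map_add, hx, hy, add_zero]
  ε_d x := by
    induction x using BTensor.induction with
    | zero => simp
    | tmul p u =>
      rw [BTensor.mapLeft_btmul, BTensor.augLeft_btmul, hP.ε_d, lft_zero]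
      exact zero_smul (Env k A) u
    | add x y hx hy => simp only [map_add, hx, hy, add_zero]

theorem IsResolution.mapLeft [Module.Projective A (Along (lftRing k A) U)]
    (hP : IsResolution d ε) :
    IsResolution (P := fun n => BTensor k A (P n) U) (fun n => BTensor.mapLeft U (d n))
      (BTensor.augLeft U ε) where
  toIsAugmented := hP.toIsAugmented.mapLeft U
  surjective u := by
    obtain ⟨p, hp⟩ := hP.surjective 1
    exact ⟨btmul k A p u, by rw [BTensor.augLeft_btmul, hp, lft_one_smul]⟩
  exact_zero := exact_augLeft U _ _ hP.exact_zero
  exact_succ n := exact_mapLeft U _ _ (hP.exact_succ n)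

end Left

section Right

variable {P : Type u} [AddCommGroup P] [Module (Env k A) P]

theorem exists_rightCoord (k : Type v) {A : Type u} [CommRing k] [Ring A] [Algebra k A]
    (P : Type u) [AddCommGroup P] [Module (Env k A) P]
    [h : Module.Projective Aᵐᵒᵖ (Along (rgtRing k A) P)] :
    ∃ s : P →+ (P →₀ A), (∀ (a : A) p q, s (rgt k a • p) q = s p q * a) ∧
      ∀ p, Finsupp.liftAddHom (rgtHom k) (s p) = p := by
  obtain ⟨s, hs⟩ := h.out
  refine ⟨(Finsupp.mapRange.addMonoidHom (opAddEquiv (α := A)).symm.toAddMonoidHom).comp s.toAddMonoidHom,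
    fun a p q => congrArg unop (DFunLike.congr_fun (s.map_smul (op a) p) q), fun p => ?_⟩
  have key : ∀ f : P →₀ Aᵐᵒᵖ, Finsupp.liftAddHom (rgtHom k)
      (Finsupp.mapRange.addMonoidHom (opAddEquiv (α := A)).symm.toAddMonoidHom f) =
        (Finsupp.linearCombination Aᵐᵒᵖ (id : Along (rgtRing k A) P → _) f : P) := by
    intro f
    induction f using Finsupp.induction_linear with
    | zero =>
      rw [map_zero, map_zero]
      exact (map_zero (Finsupp.linearCombination Aᵐᵒᵖ (id : Along (rgtRing k A) P → _))).symm
    | add f g hf hg =>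
      rw [map_add, map_add, hf, hg]
      exact (map_add (Finsupp.linearCombination Aᵐᵒᵖ (id : Along (rgtRing k A) P → _)) f g).symm
    | single q a =>
      refine Eq.trans ?_ (Finsupp.linearCombination_single Aᵐᵒᵖ a
        (v := (id : Along (rgtRing k A) P → _)) q).symm
      rw [Finsupp.mapRange.addMonoidHom_apply, Finsupp.mapRange_single,
        Finsupp.liftAddHom_apply_single]
      rfl
  exact (key (s p)).trans (hs p)

variable (s : P →+ (P →₀ A)) (hs : ∀ (a : A) p q, s (rgt k a • p) q = s p q * a)
  (hs' : ∀ p, Finsupp.liftAddHom (rgtHom k) (s p) = p)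
  (M : Type u) [AddCommGroup M] [Module (Env k A) M]

/-- The coordinates of `p ⊗ m`, in terms of the coordinates of `p`. -/
def rightCoord : BTensor k A P M →+ (P →₀ M) :=
  BTensor.lift (AddMonoidHom.flip (AddMonoidHom.mk' (fun m =>
      (Finsupp.mapRange.addMonoidHom (lftHom k m)).comp s)
      (fun m m' => by
        ext u q
        exact smul_add (lft k (s u q)) m m')))
    (fun p a m => by
      ext q
      change lft k (s (rgt k a • p) q) • m = lft k (s p q) • lft k a • m
      rw [hs, lft_mul_smul])

variable (k A P) in
/-- The element of `P ⊗_A M` with given coordinates. -/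
def rightCoordInv : (P →₀ M) →+ BTensor k A P M := Finsupp.liftAddHom fun q => btmulHom q

theorem rightCoordInv_single (q : P) (m : M) :
    rightCoordInv k A P M (Finsupp.single q m) = btmul k A q m :=
  Finsupp.liftAddHom_apply_single _ _ _

include hs' in
theorem rightCoordInv_rightCoord (x : BTensor k A P M) :
    rightCoordInv k A P M (rightCoord s hs M x) = x := by
  induction x using BTensor.induction with
  | zero => simp
  | add x y hx hy => rw [map_add, map_add, hx, hy]
  | tmul p m =>
    have key : ∀ f : P →₀ A,
        rightCoordInv k A P M (Finsupp.mapRange.addMonoidHom (lftHom k m) f) =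
          btmul k A (Finsupp.liftAddHom (rgtHom k) f) m := by
      intro f
      induction f using Finsupp.induction_linear with
      | zero => rw [map_zero, map_zero, map_zero, zero_btmul]
      | add f g hf hg => rw [map_add, map_add, hf, hg, map_add, add_btmul]
      | single q a =>
        rw [Finsupp.mapRange.addMonoidHom_apply, Finsupp.mapRange_single,
          rightCoordInv_single, Finsupp.liftAddHom_apply_single]
        exact (rgt_btmul k A q a m).symm
    exact (key (s p)).trans (congrArg (fun p => btmul k A p m) (hs' p))

variable (P) {X Y Z : Type u} [AddCommGroup X] [AddCommGroup Y] [AddCommGroup Z]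
  [Module (Env k A) X] [Module (Env k A) Y] [Module (Env k A) Z]

theorem rightCoord_mapRight (g : Y →ₗ[Env k A] Z) (y : BTensor k A P Y) (i : P) :
    rightCoord s hs Z (BTensor.mapRight P g y) i = g (rightCoord s hs Y y i) := by
  induction y using BTensor.induction with
  | zero => simp
  | tmul y u => exact (map_smul g _ _).symm
  | add x y hx hy => rw [map_add, map_add, Finsupp.add_apply, hx, hy, map_add, Finsupp.add_apply,
      map_add]

/-- Tensoring with a bimodule that is projective as a right module is exact. -/
theorem exact_mapRight [Module.Projective Aᵐᵒᵖ (Along (rgtRing k A) P)] (f : X →ₗ[Env k A] Y)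
    (g : Y →ₗ[Env k A] Z) (hfg : ∀ y, g y = 0 → ∃ x, f x = y) (y : BTensor k A P Y)
    (hy : BTensor.mapRight P g y = 0) : ∃ x, BTensor.mapRight P f x = y := by
  obtain ⟨s, hs, hs'⟩ := exists_rightCoord k (A := A) P
  refine exact_of_finsupp_retract f.toAddMonoidHom g.toAddMonoidHom hfg
    (BTensor.mapRight P f).toAddMonoidHom (BTensor.mapRight P g).toAddMonoidHom
    (rightCoordInv k A P X) (rightCoordInv k A P Y) (rightCoord s hs Y) (rightCoord s hs Z)
    (rightCoordInv_rightCoord s hs hs' Y) (rightCoord_mapRight P s hs g) (fun i x => ?_) hy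
  rw [rightCoordInv_single, rightCoordInv_single]
  rfl

theorem injective_mapRight [Module.Projective Aᵐᵒᵖ (Along (rgtRing k A) P)]
    (g : Y →ₗ[Env k A] Z) (hg : Function.Injective g) :
    Function.Injective (BTensor.mapRight P g) := by
  obtain ⟨s, hs, hs'⟩ := exists_rightCoord k (A := A) P
  exact injective_of_finsupp_retract g.toAddMonoidHom hg (BTensor.mapRight P g).toAddMonoidHom
    (rightCoordInv k A P Y) (rightCoord s hs Y) (rightCoord s hs Z)
    (rightCoordInv_rightCoord s hs hs' Y) (rightCoord_mapRight P s hs g)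

end Right

end Exactness

section Cyc

variable (k : Type v) (A : Type u) [CommRing k] [Ring A] [Algebra k A]

/-- The subgroup generated by the commutators `a m - m a`. -/
def commutators (M : Type u) [AddCommGroup M] [Module (Env k A) M] : AddSubgroup M :=
  AddSubgroup.closure {x | ∃ (a : A) (m : M), x = lft k a • m - rgt k a • m}

/-- The quotient `M / [A, M]` of a bimodule. -/
def Cyc (M : Type u) [AddCommGroup M] [Module (Env k A) M] : Type u := M ⧸ commutators k A M

variable {U M N P : Type u} [AddCommGroup M] [AddCommGroup N] [AddCommGroup P] [AddCommGroup U]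
  [Module (Env k A) M] [Module (Env k A) N] [Module (Env k A) P] [Module (Env k A) U]

instance : AddCommGroup (Cyc k A M) := inferInstanceAs (AddCommGroup (M ⧸ commutators k A M))

namespace Cyc

/-- The projection `M → M / [A, M]`. -/
def mk : M →+ Cyc k A M := QuotientAddGroup.mk' (commutators k A M)

theorem mk_surjective : Function.Surjective (mk k A : M →+ Cyc k A M) :=
  QuotientAddGroup.mk'_surjective _

theorem mk_eq_zero_iff {m : M} : mk k A m = 0 ↔ m ∈ commutators k A M :=
  QuotientAddGroup.eq_zero_iff m

theorem mk_lft_smul (a : A) (m : M) : mk k A (lft k a • m) = mk k A (rgt k a • m) := by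
  rw [← sub_eq_zero, ← map_sub, mk_eq_zero_iff]
  exact AddSubgroup.subset_closure ⟨a, m, rfl⟩

variable {k A}

/-- The map out of `M / [A, M]` defined by a trace. -/
def lift {X : Type*} [AddCommGroup X] (f : M →+ X)
    (hf : ∀ (a : A) m, f (lft k a • m) = f (rgt k a • m)) : Cyc k A M →+ X :=
  QuotientAddGroup.lift (commutators k A M) f (by
    rw [commutators, AddSubgroup.closure_le]
    rintro _ ⟨a, m, rfl⟩
    simp [hf])

/-- The map induced by a map of bimodules. -/
def map (f : M →ₗ[Env k A] N) : Cyc k A M →+ Cyc k A N :=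
  lift ((mk k A).comp f.toAddMonoidHom) fun a m => by
    change mk k A (f (lft k a • m)) = mk k A (f (rgt k a • m))
    rw [map_smul f, map_smul f, mk_lft_smul]

theorem map_mk (f : M →ₗ[Env k A] N) (m : M) : map f (mk k A m) = mk k A (f m) := rfl

theorem map_map {L : Type u} [AddCommGroup L] [Module (Env k A) L] (f : M →ₗ[Env k A] N)
    (g : N →ₗ[Env k A] L) (x : Cyc k A M) : map g (map f x) = map (g ∘ₗ f) x := by
  obtain ⟨m, rfl⟩ := mk_surjective k A x
  rfl

theorem map_zero_apply (x : Cyc k A M) : map (0 : M →ₗ[Env k A] N) x = 0 := by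
  obtain ⟨m, rfl⟩ := mk_surjective k A x
  rw [map_mk, LinearMap.zero_apply, map_zero]

theorem map_surjective {f : M →ₗ[Env k A] N} (hf : Function.Surjective f) :
    Function.Surjective (map f) := by
  intro x
  obtain ⟨n, rfl⟩ := mk_surjective k A x
  obtain ⟨m, rfl⟩ := hf n
  exact ⟨mk k A m, rfl⟩

/-- The functor `M ↦ M / [A, M]` is right exact. -/
theorem exact_map (f : P →ₗ[Env k A] M) (g : M →ₗ[Env k A] N) (hg : Function.Surjective g)
    (hfg : ∀ m, g m = 0 → ∃ p, f p = m) {x : Cyc k A M} (hx : map g x = 0) :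
    ∃ y, map f y = x := by
  obtain ⟨m, rfl⟩ := mk_surjective k A x
  rw [map_mk, mk_eq_zero_iff] at hx
  have key : ∀ n ∈ commutators k A N, ∃ m ∈ commutators k A M, g m = n := by
    intro n hn
    induction hn using AddSubgroup.closure_induction with
    | mem n hn =>
      obtain ⟨a, n, rfl⟩ := hn
      obtain ⟨m, rfl⟩ := hg n
      exact ⟨_, AddSubgroup.subset_closure ⟨a, m, rfl⟩, by simp⟩
    | zero => exact ⟨0, zero_mem _, map_zero g⟩
    | add x y _ _ hx hy =>
      obtain ⟨x, hx, rfl⟩ := hx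
      obtain ⟨y, hy, rfl⟩ := hy
      exact ⟨x + y, add_mem hx hy, map_add _ _ _⟩
    | neg x _ hx =>
      obtain ⟨x, hx, rfl⟩ := hx
      exact ⟨-x, neg_mem hx, map_neg _ _⟩
  obtain ⟨c, hc, hgc⟩ := key _ hx
  obtain ⟨p, hp⟩ := hfg (m - c) (by rw [map_sub, hgc, sub_self])
  refine ⟨mk k A p, ?_⟩
  rw [map_mk, hp, map_sub, (mk_eq_zero_iff k A).2 hc, sub_zero]

variable (k A U P) in
/-- The rotation `u ⊗ p ↦ p ⊗ u`. -/
def rot : Cyc k A (BTensor k A U P) →+ Cyc k A (BTensor k A P U) :=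
  lift (BTensor.lift (AddMonoidHom.flip (btmulHom.compr₂ (mk k A))) fun u a p => by
      change mk k A (btmul k A p (rgt k a • u)) = mk k A (btmul k A (lft k a • p) u)
      rw [← lft_smul_btmul, mk_lft_smul, rgt_smul_btmul])
    fun a x => by
      induction x using BTensor.induction with
      | zero => simp
      | tmul u p =>
        rw [lft_smul_btmul, rgt_smul_btmul]
        change mk k A (btmul k A p (lft k a • u)) = mk k A (btmul k A (rgt k a • p) u)
        rw [rgt_btmul]
      | add x y hx hy => simp only [smul_add, map_add, hx, hy]

theorem hom_ext_btmul {X : Type*} [AddCommGroup X] {f g : Cyc k A (BTensor k A M N) →+ X}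
    (h : ∀ m n, f (mk k A (btmul k A m n)) = g (mk k A (btmul k A m n))) : f = g := by
  ext x
  obtain ⟨x, rfl⟩ := mk_surjective k A x
  exact DFunLike.congr_fun (BTensor.hom_ext (f := f.comp (mk k A)) (g := g.comp (mk k A)) h) x

theorem rot_mapLeft (f : M →ₗ[Env k A] N) (x : Cyc k A (BTensor k A M P)) :
    rot k A N P (map (BTensor.mapLeft P f) x) = map (BTensor.mapRight P f) (rot k A M P x) :=
  DFunLike.congr_fun (hom_ext_btmul (f := (rot k A N P).comp (map (BTensor.mapLeft P f)))
    (g := (map (BTensor.mapRight P f)).comp (rot k A M P)) fun _ _ => rfl) x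

theorem rot_mapRight (f : M →ₗ[Env k A] N) (x : Cyc k A (BTensor k A P M)) :
    rot k A P N (map (BTensor.mapRight P f) x) = map (BTensor.mapLeft P f) (rot k A P M x) :=
  DFunLike.congr_fun (hom_ext_btmul (f := (rot k A P N).comp (map (BTensor.mapRight P f)))
    (g := (map (BTensor.mapLeft P f)).comp (rot k A P M)) fun _ _ => rfl) x

theorem mk_envSwap_btmul (e : Env k A) (m : M) (p : P) :
    mk k A (btmul k A (envSwap k A e • m) p) = mk k A (btmul k A m (e • p)) := by
  induction e using env_induction generalizing m p with
  | lft a =>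
    rw [show envSwap k A (lft k a) = rgt k a from rfl, rgt_btmul]
  | rgt a =>
    rw [show envSwap k A (rgt k a) = lft k a from rfl, ← lft_smul_btmul, mk_lft_smul,
      rgt_smul_btmul]
  | mul x y hx hy => rw [envSwap_mul, mul_smul, hy, hx, mul_smul]
  | add x y hx hy => rw [map_add, add_smul, add_smul, add_btmul, btmul_add, map_add, map_add, hx, hy]

/-- The additive map `e ↦ swap e • m`. -/
def swapHom (m : M) : Env k A →+ M :=
  AddMonoidHom.mk' (fun e => envSwap k A e • m) fun a b => by rw [map_add, add_smul]

section Coord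

variable (s : P →ₗ[Env k A] (P →₀ Env k A)) (M)

/-- The coordinates of the class of `m ⊗ p`, in terms of the coordinates of `p`. -/
def coord : Cyc k A (BTensor k A M P) →+ (P →₀ M) :=
  lift (BTensor.lift (AddMonoidHom.mk' (fun m =>
      (Finsupp.mapRange.addMonoidHom (swapHom m)).comp s.toAddMonoidHom)
      (fun m m' => by ext u q; exact smul_add _ _ _))
    (fun m a p => by
      ext q
      change envSwap k A (s p q) • rgt k a • m = envSwap k A (s (lft k a • p) q) • m
      rw [map_smul, Finsupp.smul_apply, smul_eq_mul, envSwap_mul, mul_smul]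
      rfl))
    fun a x => by
      induction x using BTensor.induction with
      | zero => simp
      | tmul m p =>
        rw [lft_smul_btmul, rgt_smul_btmul]
        ext q
        change envSwap k A (s p q) • lft k a • m = envSwap k A (s (rgt k a • p) q) • m
        rw [map_smul, Finsupp.smul_apply, smul_eq_mul, envSwap_mul, mul_smul]
        rfl
      | add x y hx hy => simp only [smul_add, map_add, hx, hy]

variable (k A P) in
/-- The element with given coordinates. -/
def coordInv : (P →₀ M) →+ Cyc k A (BTensor k A M P) :=
  Finsupp.liftAddHom fun q => (mk k A).comp (btmulHom.flip q)

theorem coordInv_single (q : P) (m : M) :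
    coordInv k A M P (Finsupp.single q m) = mk k A (btmul k A m q) :=
  Finsupp.liftAddHom_apply_single _ _ _

variable (hs : Function.LeftInverse (Finsupp.linearCombination (Env k A) id) s)

include hs in
theorem coordInv_coord (x : Cyc k A (BTensor k A M P)) :
    coordInv k A M P (coord M s x) = x := by
  refine DFunLike.congr_fun (hom_ext_btmul (f := (coordInv k A M P).comp (coord M s))
    (g := AddMonoidHom.id _) fun m p => ?_) x
  have key : ∀ f : P →₀ Env k A,
      coordInv k A M P (Finsupp.mapRange.addMonoidHom (swapHom m) f) =
        mk k A (btmul k A m (Finsupp.linearCombination (Env k A) id f)) := by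
    intro f
    induction f using Finsupp.induction_linear with
    | zero => rw [map_zero, map_zero, map_zero, btmul_zero, map_zero]
    | add f g hf hg => rw [map_add, map_add, hf, hg, map_add, btmul_add, map_add]
    | single q e =>
      rw [Finsupp.mapRange.addMonoidHom_apply, Finsupp.mapRange_single,
        coordInv_single, Finsupp.linearCombination_single]
      exact mk_envSwap_btmul e m q
  exact (key (s p)).trans (congrArg (fun p => mk k A (btmul k A m p)) (hs p))

variable {M}

theorem coord_mapLeft (g : M →ₗ[Env k A] N) (x : Cyc k A (BTensor k A M P)) (i : P) :
    coord N s (map (BTensor.mapLeft P g) x) i = g (coord M s x i) := by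
  refine DFunLike.congr_fun (hom_ext_btmul
    (f := ((Finsupp.applyAddHom i).comp (coord N s)).comp (map (BTensor.mapLeft P g)))
    (g := (g.toAddMonoidHom.comp (Finsupp.applyAddHom i)).comp (coord M s)) fun m p => ?_) x
  exact (map_smul g _ _).symm

end Coord

variable (P) {X Y Z : Type u} [AddCommGroup X] [AddCommGroup Y] [AddCommGroup Z]
  [Module (Env k A) X] [Module (Env k A) Y] [Module (Env k A) Z]

theorem exact_mapLeft [h : Module.Projective (Env k A) P] (f : X →ₗ[Env k A] Y)
    (g : Y →ₗ[Env k A] Z) (hfg : ∀ y, g y = 0 → ∃ x, f x = y) {y : Cyc k A (BTensor k A Y P)}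
    (hy : map (BTensor.mapLeft P g) y = 0) : ∃ x, map (BTensor.mapLeft P f) x = y := by
  obtain ⟨s, hs⟩ := h.out
  refine exact_of_finsupp_retract f.toAddMonoidHom g.toAddMonoidHom hfg
    (map (BTensor.mapLeft P f)) (map (BTensor.mapLeft P g))
    (coordInv k A X P) (coordInv k A Y P) (coord Y s) (coord Z s)
    (coordInv_coord Y s hs) (coord_mapLeft s g) (fun i x => ?_) hy
  rw [coordInv_single, coordInv_single]
  rfl

theorem injective_mapLeft [h : Module.Projective (Env k A) P]
    (g : Y →ₗ[Env k A] Z) (hg : Function.Injective g) :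
    Function.Injective (map (BTensor.mapLeft P g)) := by
  obtain ⟨s, hs⟩ := h.out
  exact injective_of_finsupp_retract g.toAddMonoidHom hg (map (BTensor.mapLeft P g))
    (coordInv k A Y P) (coord Y s) (coord Z s)
    (coordInv_coord Y s hs) (coord_mapLeft s g)

end Cyc

end Cyc

section LiftChainMap

variable {S : Type*} [Ring S] {X Q Q' : ℕ → Type*} [∀ n, AddCommGroup (X n)] [∀ n, Module S (X n)]
  [∀ n, AddCommGroup (Q n)] [∀ n, Module S (Q n)] [∀ n, AddCommGroup (Q' n)]
  [∀ n, Module S (Q' n)] {L M N : Type*} [AddCommGroup L] [Module S L] [AddCommGroup M] [Module S M]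
  [AddCommGroup N] [Module S N] {dX : ∀ n, X (n + 1) →ₗ[S] X n} {εX : X 0 →ₗ[S] L}
  {dQ : ∀ n, Q (n + 1) →ₗ[S] Q n} {εQ : Q 0 →ₗ[S] M}
  {dQ' : ∀ n, Q' (n + 1) →ₗ[S] Q' n} {εQ' : Q' 0 →ₗ[S] N}

/-- A chain map into the target of a degreewise surjective chain map `q` of resolutions lifts
along `q`, if it does so in homology. -/
theorem exists_chainMap_lift [∀ n, Module.Projective S (X n)] (hX : IsAugmented dX εX)
    (hQ : IsResolution dQ εQ) (hQ' : IsResolution dQ' εQ') {q : ∀ n, Q n →ₗ[S] Q' n}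
    (hq : IsChainMap dQ dQ' q) (hqs : ∀ n, Function.Surjective (q n)) (f : M →ₗ[S] N)
    (hqf : ∀ x, εQ' (q 0 x) = f (εQ x)) (g : L →ₗ[S] M) {σ : ∀ n, X n →ₗ[S] Q' n}
    (hσ : IsChainMap dX dQ' σ) (hσε : ∀ x, εQ' (σ 0 x) = f (g (εX x))) :
    ∃ τ : ∀ n, X n →ₗ[S] Q n, IsChainMap dX dQ τ ∧ (∀ x, εQ (τ 0 x) = g (εX x)) ∧
      ∀ n x, q n (τ n x) = σ n x := by
  obtain ⟨τ, hτ, hτε⟩ := exists_chainMap hX hQ g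
  obtain ⟨H, hH₀, hH⟩ := exists_nullHomotopy (F := fun n => q n ∘ₗ τ n - σ n) (dP := dX) hQ'
    (fun n x => by simp [hq n, hτ n x, hσ n x]) hX.d_d (fun x => by simp [hqf, hτε, hσε])
  have hlift : ∀ n, ∃ K : X n →ₗ[S] Q (n + 1), ∀ x, q (n + 1) (K x) = H n x := fun n =>
    exists_lift_of_range_le (q (n + 1)) (H n) fun x => hqs (n + 1) _
  choose K hK using hlift
  let ρ : ∀ n, X n →ₗ[S] Q n := fun n => match n with
    | 0 => τ 0 - dQ 0 ∘ₗ K 0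
    | n + 1 => τ (n + 1) - (dQ (n + 1) ∘ₗ K (n + 1) + K n ∘ₗ dX n)
  refine ⟨ρ, fun n x => ?_, fun x => ?_, fun n x => ?_⟩
  · cases n with
    | zero =>
      change dQ 0 (τ 1 x - (dQ 1 (K 1 x) + K 0 (dX 0 x))) = τ 0 (dX 0 x) - dQ 0 (K 0 (dX 0 x))
      rw [map_sub, map_add, hQ.d_d, hτ 0]
      exact congrArg _ (zero_add _)
    | succ n =>
      change dQ (n + 1) (τ (n + 2) x - (dQ (n + 2) (K (n + 2) x) + K (n + 1) (dX (n + 1) x))) =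
        τ (n + 1) (dX (n + 1) x) -
          (dQ (n + 1) (K (n + 1) (dX (n + 1) x)) + K n (dX n (dX (n + 1) x)))
      rw [map_sub, map_add, hQ.d_d, hτ, zero_add, hX.d_d, map_zero, add_zero]
  · change εQ (τ 0 x - dQ 0 (K 0 x)) = _
    rw [map_sub, hQ.ε_d, sub_zero, hτε]
  · cases n with
    | zero =>
      change q 0 (τ 0 x - dQ 0 (K 0 x)) = σ 0 x
      rw [map_sub, ← hq, hK, ← hH₀]
      simp
    | succ n =>
      change q (n + 1) (τ (n + 1) x - (dQ (n + 1) (K (n + 1) x) + K n (dX n x))) = σ (n + 1) x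
      rw [map_sub, map_add, ← hq, hK, hK, ← hH]
      simp

end LiftChainMap

section Rotation

theorem exists_projective_cover (S : Type u) [Ring S] (U : Type u) [AddCommGroup U] [Module S U] :
    ∃ F : ModuleCat.{u} S, Module.Projective S F ∧ ∃ π : F →ₗ[S] U, Function.Surjective π :=
  ⟨ModuleCat.of S (U →₀ S), inferInstanceAs (Module.Projective S (U →₀ S)),
    Finsupp.linearCombination S id, Finsupp.linearCombination_id_surjective S U⟩

theorem projective_ker_along {B S : Type*} [Ring B] [Ring S] (θ : B →+* S) {K F U : Type*}
    [AddCommGroup K] [AddCommGroup F] [AddCommGroup U] [Module S K] [Module S F] [Module S U]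
    (ι : K →ₗ[S] F) (hι : Function.Injective ι) (π : F →ₗ[S] U)
    (hπ : Function.Surjective π) (hιπ : ∀ x, π x = 0 → ∃ y, ι y = x) (hπι : ∀ x, π (ι x) = 0)
    [Module.Projective B (Along θ F)] [Module.Projective B (Along θ U)] :
    Module.Projective B (Along θ K) := by
  obtain ⟨t, ht⟩ := Module.projective_lifting_property (alongMap θ π) LinearMap.id hπ
  have ht' : ∀ u, alongMap θ π (t u) = u := DFunLike.congr_fun ht
  obtain ⟨r, hr⟩ := exists_lift_of_range_le (alongMap θ ι) (LinearMap.id - t ∘ₗ alongMap θ π)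
    fun x => hιπ _ (by
      change alongMap θ π (x - t (alongMap θ π x)) = 0
      rw [map_sub, ht', sub_self])
  refine Module.Projective.of_split (alongMap θ ι) r (LinearMap.ext fun x => hι ?_)
  have h0 : alongMap θ π (alongMap θ ι x) = 0 := hπι x
  refine (hr _).trans ?_
  rw [LinearMap.sub_apply, LinearMap.comp_apply, h0, map_zero, sub_zero]
  rfl

variable {k : Type v} {A : Type u} [CommRing k] [Ring A] [Algebra k A]
  {P : ℕ → Type u} [∀ n, AddCommGroup (P n)] [∀ n, Module (Env k A) (P n)]
  {d : ∀ n, P (n + 1) →ₗ[Env k A] P n} {ε : P 0 →ₗ[Env k A] A}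

variable (d) in
/-- The cycles of the complex `(U ⊗_A P) / [A, U ⊗_A P]`. -/
def IsCycCycle (U : Type u) [AddCommGroup U] [Module (Env k A) U] :
    ∀ n, Cyc k A (BTensor k A U (P n)) → Prop
  | 0, _ => True
  | n + 1, c => Cyc.map (BTensor.mapRight U (d n)) c = 0

theorem Cyc.map_comm {M N M' N' : Type u} [AddCommGroup M] [AddCommGroup N] [AddCommGroup M']
    [AddCommGroup N'] [Module (Env k A) M] [Module (Env k A) N] [Module (Env k A) M']
    [Module (Env k A) N'] {f : M →ₗ[Env k A] N} {g : N →ₗ[Env k A] N'} {f' : M →ₗ[Env k A] M'}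
    {g' : M' →ₗ[Env k A] N'} (h : ∀ x, g (f x) = g' (f' x)) (x : Cyc k A M) :
    Cyc.map g (Cyc.map f x) = Cyc.map g' (Cyc.map f' x) := by
  rw [Cyc.map_map, Cyc.map_map]
  exact congrArg (fun f => Cyc.map f x) (LinearMap.ext h)

theorem BTensor.mapLeft_mapRight {M N M' N' : Type u} [AddCommGroup M] [AddCommGroup N]
    [AddCommGroup M'] [AddCommGroup N'] [Module (Env k A) M] [Module (Env k A) N]
    [Module (Env k A) M'] [Module (Env k A) N'] (f : M →ₗ[Env k A] N) (g : M' →ₗ[Env k A] N')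
    (x : BTensor k A M M') :
    mapLeft N' f (mapRight M g x) = mapRight N g (mapLeft M' f x) :=
  DFunLike.congr_fun (linearMap_ext (f := mapLeft N' f ∘ₗ mapRight M g)
    (g := mapRight N g ∘ₗ mapLeft M' f) fun _ _ => rfl) x

variable (d ε) in
/-- For chain maps `U ⊗_A P → P ⊗_A U` over the identity of `U`, the induced map and the rotation
`u ⊗ p ↦ p ⊗ u` modulo commutators agree in homology of degree `n`. -/
def RotationProperty (n : ℕ) (U : Type u) [AddCommGroup U] [Module (Env k A) U] : Prop :=
  ∀ σ : ∀ n, BTensor k A U (P n) →ₗ[Env k A] BTensor k A (P n) U,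
    IsChainMap (P := fun n => BTensor k A U (P n)) (Q := fun n => BTensor k A (P n) U)
      (fun n => BTensor.mapRight U (d n)) (fun n => BTensor.mapLeft U (d n)) σ →
    (∀ x, BTensor.augLeft U ε (σ 0 x) = BTensor.augRight U ε x) →
    ∀ c : Cyc k A (BTensor k A U (P n)), IsCycCycle d U n c →
    ∃ b, Cyc.map (BTensor.mapLeft U (d n)) b = Cyc.map (σ n) c - Cyc.rot k A U (P n) c

theorem rotationProperty_zero (hP : IsResolution d ε) {U : Type u} [AddCommGroup U]
    [Module (Env k A) U] [Module.Projective A (Along (lftRing k A) U)] :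
    RotationProperty d ε 0 U := by
  intro σ hσ hσε c _
  have hU := hP.mapLeft U
  refine Cyc.exact_map _ (BTensor.augLeft U ε) hU.surjective hU.exact_zero ?_
  rw [map_sub, Cyc.map_map, LinearMap.ext (f := BTensor.augLeft U ε ∘ₗ σ 0) hσε, sub_eq_zero]
  refine DFunLike.congr_fun (Cyc.hom_ext_btmul (f := Cyc.map (BTensor.augRight U ε))
    (g := (Cyc.map (BTensor.augLeft U ε)).comp (Cyc.rot k A U (P 0))) fun u p => ?_) c
  exact (Cyc.mk_lft_smul k A (ε p) u).symm

variable [Module.Projective k A] [∀ n, Module.Projective (Env k A) (P n)]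

theorem rotationProperty_succ (hP : IsResolution d ε) {U' F U : Type u} [AddCommGroup U']
    [AddCommGroup F] [AddCommGroup U] [Module (Env k A) U'] [Module (Env k A) F]
    [Module (Env k A) U] [Module.Projective A (Along (lftRing k A) U)]
    [Module.Projective A (Along (lftRing k A) U')] [Module.Projective (Env k A) F]
    (ι : U' →ₗ[Env k A] F) (hι : Function.Injective ι) (π : F →ₗ[Env k A] U)
    (hπ : Function.Surjective π) (hιπ : ∀ x, π x = 0 → ∃ y, ι y = x) (hπι : ∀ x, π (ι x) = 0)
    {n : ℕ} (ih : RotationProperty d ε n U') : RotationProperty d ε (n + 1) U := by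
  intro σ hσ hσε c hc
  have hPr : ∀ n, Module.Projective Aᵐᵒᵖ (Along (rgtRing k A) (P n)) := fun n =>
    projective_along (rgtRing k A)
  have hF : Module.Projective A (Along (lftRing k A) F) := projective_along (lftRing k A)
  have hFP : ∀ n, Module.Projective (Env k A) (BTensor k A F (P n)) := fun n =>
    projective_btensor_left
  have hU'P : ∀ n, Module.Projective (Env k A) (BTensor k A U' (P n)) := fun n =>
    projective_btensor_left
  -- a lift of `σ` to the free cover
  obtain ⟨τ, hτ, hτε, hτσ⟩ := exists_chainMap_lift (X := fun n => BTensor k A F (P n))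
    (Q := fun n => BTensor k A (P n) F) (Q' := fun n => BTensor k A (P n) U)
    (hP.toIsAugmented.mapRight F)
    (hP.mapLeft F) (hP.mapLeft U) (q := fun n => BTensor.mapRight (P n) π)
    (fun n x => BTensor.mapLeft_mapRight (d n) π x) (fun n => BTensor.mapRight_surjective hπ) π
    (fun x => by
      refine DFunLike.congr_fun (BTensor.linearMap_ext
        (f := BTensor.augLeft U ε ∘ₗ BTensor.mapRight (P 0) π)
        (g := π ∘ₗ BTensor.augLeft F ε) fun p y => ?_) x
      exact (map_smul π _ _).symm) LinearMap.id
    (σ := fun n => σ n ∘ₗ BTensor.mapLeft (P n) π)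
    (fun n x => by
      simp only [LinearMap.comp_apply, hσ n, BTensor.mapLeft_mapRight])
    (fun x => by
      simp only [LinearMap.comp_apply, hσε]
      refine DFunLike.congr_fun (BTensor.linearMap_ext
        (f := BTensor.augRight U ε ∘ₗ BTensor.mapLeft (P 0) π)
        (g := π ∘ₗ BTensor.augRight F ε) fun y p => ?_) x
      exact (map_smul π _ _).symm)
  -- its restriction to the kernel
  have hres : ∀ n, ∃ ρ : BTensor k A U' (P n) →ₗ[Env k A] BTensor k A (P n) U',
      ∀ x, BTensor.mapRight (P n) ι (ρ x) = τ n (BTensor.mapLeft (P n) ι x) := fun n =>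
    exists_lift_of_range_le (BTensor.mapRight (P n) ι) (τ n ∘ₗ BTensor.mapLeft (P n) ι)
      fun x => exact_mapRight (P n) ι π hιπ _ (by
        have h := hτσ n (BTensor.mapLeft (P n) ι x)
        refine h.trans ((congrArg (σ n) ?_).trans (map_zero (σ n)))
        refine DFunLike.congr_fun (BTensor.linearMap_ext
          (f := BTensor.mapLeft (P n) π ∘ₗ BTensor.mapLeft (P n) ι) (g := 0) fun y p => ?_) x
        change btmul k A (π (ι y)) p = 0
        rw [hπι, zero_btmul])
  choose ρ hρ using hres
  have hιinj : ∀ n, Function.Injective (BTensor.mapRight (P n) ι) := fun n =>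
    injective_mapRight (P n) ι hι
  have hρd : IsChainMap (P := fun n => BTensor k A U' (P n)) (Q := fun n => BTensor k A (P n) U')
      (fun n => BTensor.mapRight U' (d n)) (fun n => BTensor.mapLeft U' (d n)) ρ := fun n x => by
    apply hιinj n
    rw [← BTensor.mapLeft_mapRight, hρ, hρ, BTensor.mapLeft_mapRight]
    exact hτ n _
  have hρε : ∀ x, BTensor.augLeft U' ε (ρ 0 x) = BTensor.augRight U' ε x := fun x => by
    apply hι
    have h := hτε (BTensor.mapLeft (P 0) ι x)
    rw [← hρ] at h
    refine Eq.trans ?_ (h.trans ?_)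
    · exact DFunLike.congr_fun (BTensor.linearMap_ext (f := ι ∘ₗ BTensor.augLeft U' ε)
        (g := BTensor.augLeft F ε ∘ₗ BTensor.mapRight (P 0) ι) fun _ _ => map_smul ι _ _) (ρ 0 x)
    · exact DFunLike.congr_fun (BTensor.linearMap_ext
        (f := BTensor.augRight F ε ∘ₗ BTensor.mapLeft (P 0) ι)
        (g := ι ∘ₗ BTensor.augRight U' ε) fun _ _ => (map_smul ι _ _).symm) x
  -- the dimension shift
  obtain ⟨c, rfl⟩ := Cyc.map_surjective (BTensor.mapLeft_surjective hπ) c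
  obtain ⟨c', hc'⟩ := Cyc.exact_mapLeft (P n) ι π hιπ
    (y := Cyc.map (BTensor.mapRight F (d n)) c) (by
      rw [Cyc.map_comm (BTensor.mapLeft_mapRight π (d n))]; exact hc)
  have hcyc : IsCycCycle d U' n c' := by
    cases n with
    | zero => trivial
    | succ n =>
      apply Cyc.injective_mapLeft (P n) ι hι
      rw [Cyc.map_comm (BTensor.mapLeft_mapRight ι (d n)), hc', Cyc.map_map, map_zero]
      rw [LinearMap.ext (f := BTensor.mapRight F (d n) ∘ₗ BTensor.mapRight F (d (n + 1))) (g := 0)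
        ((hP.toIsAugmented.mapRight F).d_d n), Cyc.map_zero_apply]
  obtain ⟨b', hb'⟩ := ih ρ hρd hρε c' hcyc
  let z := Cyc.map (τ (n + 1)) c - Cyc.rot k A F (P (n + 1)) c -
    Cyc.map (BTensor.mapRight (P (n + 1)) ι) b'
  have hz : Cyc.map (BTensor.mapLeft F (d n)) z = 0 := by
    have h1 : Cyc.map (BTensor.mapLeft F (d n)) (Cyc.map (τ (n + 1)) c) =
        Cyc.map (τ n) (Cyc.map (BTensor.mapRight F (d n)) c) := Cyc.map_comm (hτ n) c
    have h2 : Cyc.map (BTensor.mapRight (P n) ι) (Cyc.map (ρ n) c') =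
      Cyc.map (τ n) (Cyc.map (BTensor.mapLeft (P n) ι) c') := Cyc.map_comm (hρ n) c'
    rw [map_sub, map_sub, h1, ← Cyc.rot_mapRight, ← hc',
      Cyc.map_comm (BTensor.mapLeft_mapRight (d n) ι), hb', map_sub, h2, Cyc.rot_mapLeft,
      sub_self]
  obtain ⟨e, he⟩ := Cyc.exact_mapLeft F (d (n + 1)) (d n) (hP.exact_succ n) hz
  refine ⟨Cyc.map (BTensor.mapRight (P (n + 2)) π) e, ?_⟩
  have h3 : Cyc.map (BTensor.mapRight (P (n + 1)) π) (Cyc.map (τ (n + 1)) c) =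
      Cyc.map (σ (n + 1)) (Cyc.map (BTensor.mapLeft (P (n + 1)) π) c) :=
    Cyc.map_comm (hτσ (n + 1)) c
  have h4 : Cyc.map (BTensor.mapRight (P (n + 1)) π)
      (Cyc.map (BTensor.mapRight (P (n + 1)) ι) b') = 0 := by
    rw [Cyc.map_map]
    refine (congrArg (fun f => Cyc.map f b') (BTensor.linearMap_ext (g := 0) fun p y => ?_)).trans
      (Cyc.map_zero_apply b')
    change btmul k A p (π (ι y)) = 0
    rw [hπι, btmul_zero]
  rw [Cyc.map_comm (BTensor.mapLeft_mapRight (d (n + 1)) π), he, map_sub, map_sub, h3, h4,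
    Cyc.rot_mapLeft, sub_zero]

/-- If `σ : U ⊗_A P → P ⊗_A U` is a chain map over the identity of `U`, then the maps induced by `σ`
and by the rotation `u ⊗ p ↦ p ⊗ u` modulo commutators agree in homology. -/
theorem rotationProperty (hP : IsResolution d ε) (n : ℕ) :
    ∀ (U : Type u) [AddCommGroup U] [Module (Env k A) U]
      [Module.Projective A (Along (lftRing k A) U)], RotationProperty d ε n U := by
  induction n with
  | zero => exact fun U _ _ _ => rotationProperty_zero hP
  | succ n ih =>
    intro U _ _ _
    obtain ⟨F, hFp, π, hπ⟩ := exists_projective_cover (Env k A) U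
    have hF : Module.Projective A (Along (lftRing k A) F) := projective_along (lftRing k A)
    let ι := (LinearMap.ker π).subtype
    have hι : Function.Injective ι := Subtype.val_injective
    have hιπ : ∀ x, π x = 0 → ∃ y, ι y = x := fun x hx => ⟨⟨x, hx⟩, rfl⟩
    have hπι : ∀ x, π (ι x) = 0 := fun x => x.2
    have hK := projective_ker_along (lftRing k A) ι hι π hπ hιπ hπι
    exact rotationProperty_succ hP ι hι π hπ hιπ hπι (ih _)

end Rotation

section ExtDegreeZero

open CochainComplex HomComplex Abelian

theorem extMk_zero_eq_zero_iff {C : Type*} [Category C] [Abelian C] [HasExt C]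
    {X Y : C} (R : ProjectiveResolution X) (f : R.complex.X 0 ⟶ Y) (hf : R.complex.d 1 0 ≫ f = 0) :
    R.extMk f 1 rfl hf = 0 ↔ f = 0 := by
  refine ⟨fun h => ?_, fun h => by subst h; exact R.extMk_zero 1 rfl⟩
  have h' := congrArg R.extEquivCohomologyClass h
  rw [R.extEquivCohomologyClass_extMk, R.extEquivCohomologyClass_zero,
    CohomologyClass.mk_eq_zero_iff,
    Cocycle.toSingleMk_mem_coboundaries_iff _ _ _ _ _ 1 (by simp)] at h'
  obtain ⟨g, hg⟩ := h'
  have hz : Limits.IsZero (R.cochainComplex.X 1) :=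
    R.cochainComplex.isZero_of_isStrictlyLE 0 1 (by simp)
  rw [hz.eq_of_src g 0, Limits.comp_zero] at hg
  rw [← cancel_epi (R.cochainComplexXIso (-(0 : ℕ)) 0 rfl).hom, Limits.comp_zero]
  exact hg.symm

end ExtDegreeZero

section Dual

theorem exists_dualBasis (S P : Type*) [Ring S] [AddCommGroup P] [Module S P] [Module.Finite S P]
    [Module.Projective S P] :
    ∃ (n : ℕ) (p : Fin n → P) (f : Fin n → P →ₗ[S] S), ∀ x, ∑ i, f i x • p i = x := by
  obtain ⟨n, g, hg⟩ := Module.Finite.exists_fin' S P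
  obtain ⟨h, hh⟩ := Module.projective_lifting_property g LinearMap.id hg
  refine ⟨n, fun i => g (Pi.single i 1), fun i => LinearMap.proj i ∘ₗ h, fun x => ?_⟩
  refine Eq.trans ?_ (DFunLike.congr_fun hh x)
  conv_rhs => rw [LinearMap.comp_apply, LinearMap.pi_apply_eq_sum_univ g (h x)]
  exact Finset.sum_congr rfl fun i _ => by
    change h x i • g (Pi.single i 1) = _
    congr 2
    funext j
    simp [Pi.single_apply, eq_comm]

variable {k : Type v} {A : Type u} [CommRing k] [Ring A] [Algebra k A]

theorem envSwap_envSwap (e : Env k A) : envSwap k A (envSwap k A e) = e := by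
  induction e using env_induction with
  | lft a => rfl
  | rgt a => rfl
  | mul x y hx hy => rw [envSwap_mul, envSwap_mul, hx, hy]
  | add x y hx hy => rw [map_add, map_add, hx, hy]

variable (k A) in
/-- The dual `Hom(P, A ⊗ A)` of a bimodule with respect to the outer structure of `A ⊗ A`, with the
bimodule structure that is induced by the inner one. -/
def EnvDual (P : Type*) [AddCommGroup P] [Module (Env k A) P] : Type _ := P →ₗ[Env k A] Env k A

variable {P : Type*} [AddCommGroup P] [Module (Env k A) P]

instance : AddCommGroup (EnvDual k A P) := inferInstanceAs (AddCommGroup (P →ₗ[Env k A] Env k A))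

instance : FunLike (EnvDual k A P) P (Env k A) :=
  inferInstanceAs (FunLike (P →ₗ[Env k A] Env k A) P (Env k A))

theorem EnvDual.add_apply (f g : EnvDual k A P) (p : P) : (f + g) p = f p + g p := rfl

theorem EnvDual.ext {f g : EnvDual k A P} (h : ∀ p, f p = g p) : f = g := LinearMap.ext h

instance : SMul (Env k A) (EnvDual k A P) :=
  ⟨fun e f => LinearMap.toSpanSingleton (Env k A) (Env k A) (envSwap k A e) ∘ₗ f⟩

theorem EnvDual.smul_apply (e : Env k A) (f : EnvDual k A P) (p : P) :
    (e • f) p = f p * envSwap k A e := rfl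

instance : Module (Env k A) (EnvDual k A P) where
  one_smul f := EnvDual.ext fun p => by rw [EnvDual.smul_apply, envSwap_one, mul_one]
  mul_smul e e' f := EnvDual.ext fun p => by
    simp only [EnvDual.smul_apply, envSwap_mul, mul_assoc]
  smul_zero e := EnvDual.ext fun p => zero_mul _
  smul_add e f g := EnvDual.ext fun p => add_mul _ _ _
  add_smul e e' f := EnvDual.ext fun p => by
    simp only [EnvDual.add_apply, EnvDual.smul_apply, map_add, mul_add]
  zero_smul f := EnvDual.ext fun p => by
    rw [EnvDual.smul_apply, map_zero, mul_zero]; rfl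

/-- The evaluation of linear forms at a fixed element. -/
def EnvDual.eval (p : P) : EnvDual k A P →+ Env k A :=
  AddMonoidHom.mk' (fun f => f p) fun _ _ => rfl

theorem EnvDual.sum_apply {ι : Type*} (s : Finset ι) (f : ι → EnvDual k A P) (p : P) :
    (∑ i ∈ s, f i) p = ∑ i ∈ s, f i p := _root_.map_sum (EnvDual.eval p) f s

/-- The transpose of a map of bimodules. -/
def EnvDual.transpose {Q : Type*} [AddCommGroup Q] [Module (Env k A) Q] (g : Q →ₗ[Env k A] P) :
    EnvDual k A P →ₗ[Env k A] EnvDual k A Q where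
  toFun f := (show P →ₗ[Env k A] Env k A from f) ∘ₗ g
  map_add' _ _ := rfl
  map_smul' _ _ := rfl

variable (k A P) in
theorem EnvDual.exists_basis [Module.Finite (Env k A) P] [Module.Projective (Env k A) P] :
    ∃ (n : ℕ) (p : Fin n → P) (f : Fin n → EnvDual k A P), ∀ x, ∑ i, f i x • p i = x :=
  exists_dualBasis (Env k A) P

theorem EnvDual.map_sum {ι : Type*} (f : EnvDual k A P) (s : Finset ι) (x : ι → P) :
    f (∑ i ∈ s, x i) = ∑ i ∈ s, f (x i) :=
  _root_.map_sum (show P →ₗ[Env k A] Env k A from f) x s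

theorem EnvDual.map_smul (f : EnvDual k A P) (e : Env k A) (x : P) : f (e • x) = e * f x :=
  LinearMap.map_smul (show P →ₗ[Env k A] Env k A from f) e x

theorem EnvDual.map_zero (f : EnvDual k A P) : f 0 = 0 :=
  LinearMap.map_zero (show P →ₗ[Env k A] Env k A from f)

theorem EnvDual.sum_swap_smul {n : ℕ} {p : Fin n → P} {f : Fin n → EnvDual k A P}
    (h : ∀ x, ∑ i, f i x • p i = x) (g : EnvDual k A P) :
    ∑ i, envSwap k A (g (p i)) • f i = g := by
  refine EnvDual.ext fun x => ?_
  rw [EnvDual.sum_apply]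
  conv_rhs => rw [← h x]
  rw [EnvDual.map_sum]
  refine Finset.sum_congr rfl fun i _ => ?_
  rw [EnvDual.smul_apply, envSwap_envSwap, EnvDual.map_smul]

/-- The linear map `f ↦ ∑ swap (f pᵢ) • gᵢ`. -/
def EnvDual.combination {T : Type*} [AddCommGroup T] [Module (Env k A) T] {n : ℕ} (p : Fin n → P)
    (g : Fin n → T) : EnvDual k A P →ₗ[Env k A] T where
  toFun f := ∑ i, envSwap k A (f (p i)) • g i
  map_add' f f' := by
    simp only [EnvDual.add_apply, map_add, add_smul, Finset.sum_add_distrib]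
  map_smul' e f := by
    simp only [EnvDual.smul_apply, envSwap_mul, envSwap_envSwap, mul_smul, Finset.smul_sum,
      RingHom.id_apply]

theorem EnvDual.combination_apply {T : Type*} [AddCommGroup T] [Module (Env k A) T] {n : ℕ}
    (p : Fin n → P) (g : Fin n → T) (f : EnvDual k A P) :
    combination p g f = ∑ i, envSwap k A (f (p i)) • g i := rfl

end Dual

section Cocycles

variable {k : Type v} {A : Type u} [CommRing k] [Ring A] [Algebra k A]
  {P : ℕ → Type u} [∀ n, AddCommGroup (P n)] [∀ n, Module (Env k A) (P n)]
  (d : ∀ n, P (n + 1) →ₗ[Env k A] P n)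

/-- The bimodule of cocycles with values in `A ⊗ A`. -/
def cocycles (n : ℕ) : Submodule (Env k A) (EnvDual k A (P n)) :=
  LinearMap.ker (EnvDual.transpose (d n))

variable {d}

theorem mem_cocycles {n : ℕ} {f : EnvDual k A (P n)} :
    f ∈ cocycles d n ↔ IsCocycle d (show P n →ₗ[Env k A] Env k A from f) :=
  ⟨fun h x => DFunLike.congr_fun (show EnvDual.transpose (d n) f = 0 from h) x,
    fun h => EnvDual.ext h⟩

/-- If there is no cohomology above degree `n`, and the complex is finite, then the cocycles of
degree `n` form a direct summand. -/
theorem exists_retraction_cocycles [∀ n, Module.Finite (Env k A) (P n)]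
    [∀ n, Module.Projective (Env k A) (P n)] (hdd : ∀ n x, d n (d (n + 1) x) = 0) {N : ℕ}
    (hN : ∀ i, N < i → Subsingleton (P i)) {n : ℕ}
    (hn : ∀ i, n < i → ∀ f : P i →ₗ[Env k A] Env k A, IsCocycle d f →
      f ∈ coboundaries (Env k A) d i) :
    ∃ r : EnvDual k A (P n) →ₗ[Env k A] cocycles d n, ∀ z : cocycles d n, r z = z := by
  suffices H : ∀ m i, n ≤ i → N < i + m →
      ∃ r : EnvDual k A (P i) →ₗ[Env k A] cocycles d i, ∀ z : cocycles d i, r z = z from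
    H (N + 1) n le_rfl (by lia)
  intro m
  induction m with
  | zero =>
    intro i _ hi
    have := hN i hi
    exact ⟨0, fun z => Subtype.ext (EnvDual.ext fun p => by
      rw [Subsingleton.elim p 0]
      rw [EnvDual.map_zero, EnvDual.map_zero])⟩
  | succ m ih =>
    intro i hi him
    obtain ⟨r, hr⟩ := ih (i + 1) (by lia) (by lia)
    obtain ⟨l, p, f, hf⟩ := EnvDual.exists_basis k A (P (i + 1))
    have hg : ∀ s, ∃ g : EnvDual k A (P i), EnvDual.transpose (d i) g = (r (f s)).1 := fun s => by
      obtain ⟨g, hg⟩ := mem_coboundaries_succ.1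
        (hn (i + 1) (by lia) _ (mem_cocycles.1 (r (f s)).2))
      exact ⟨g, EnvDual.ext hg⟩
    choose g hg using hg
    let s : EnvDual k A (P (i + 1)) →ₗ[Env k A] EnvDual k A (P i) := EnvDual.combination p g
    have hs : ∀ f', EnvDual.transpose (d i) (s f') = (r f').1 := fun f' => by
      conv_rhs => rw [← EnvDual.sum_swap_smul hf f']
      simp only [s, EnvDual.combination_apply, map_sum, map_smul, hg,
        Submodule.coe_sum, Submodule.coe_smul]
    have hd : ∀ f : EnvDual k A (P i), f ∈ cocycles d i →
      EnvDual.transpose (d i) f = 0 := fun f hf => hf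
    refine ⟨(LinearMap.id - s ∘ₗ EnvDual.transpose (d i)).codRestrict (cocycles d i) ?_,
      fun z => Subtype.ext ?_⟩
    rotate_left
    · intro f
      change EnvDual.transpose (d i) (f - s (EnvDual.transpose (d i) f)) = 0
      have hf' : EnvDual.transpose (d i) f ∈ cocycles d (i + 1) := EnvDual.ext fun x =>
        (congrArg f (hdd i x)).trans f.map_zero
      rw [map_sub, hs, hr ⟨_, hf'⟩, sub_self]
    · change z.1 - s (EnvDual.transpose (d i) z.1) = z.1
      rw [hd _ z.2, map_zero, sub_zero]

/-- The map `cls` identifies the bimodule `T` with the cohomology of degree `n` with values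
in `A ⊗ A`. -/
structure IsClassMap {n : ℕ} {T : Type*} [AddCommGroup T] [Module (Env k A) T]
    (cls : cocycles d n →ₗ[Env k A] T) : Prop where
  surjective : Function.Surjective cls
  eq_zero_iff : ∀ z, cls z = 0 ↔ (show P n →ₗ[Env k A] Env k A from z.1) ∈
    coboundaries (Env k A) d n

/-- The fundamental class: the identity of the cohomology `T` of degree `n`, as a class in the
homology of degree `n` with coefficients in `T`. -/
theorem IsClassMap.exists_fundamentalClass [∀ n, Module.Finite (Env k A) (P n)]
    [∀ n, Module.Projective (Env k A) (P n)] (hdd : ∀ n x, d n (d (n + 1) x) = 0) {N : ℕ}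
    (hN : ∀ i, N < i → Subsingleton (P i)) {n : ℕ}
    (hn : ∀ i, n < i → ∀ f : P i →ₗ[Env k A] Env k A, IsCocycle d f →
      f ∈ coboundaries (Env k A) d i) {T : Type u} [AddCommGroup T] [Module (Env k A) T]
    {cls : cocycles d n →ₗ[Env k A] T} (hcls : IsClassMap cls) :
    ∃ (l : ℕ) (t : Fin l → T) (p : Fin l → P n),
      (∀ z : cocycles d n, ∑ i, envSwap k A (z.1 (p i)) • t i = cls z) ∧
      IsCycCycle d T n (∑ i, Cyc.mk k A (btmul k A (t i) (p i))) := by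
  obtain ⟨r, hr⟩ := exists_retraction_cocycles hdd hN hn
  obtain ⟨l, p, f, hf⟩ := EnvDual.exists_basis k A (P n)
  have key : ∀ z : cocycles d n, ∑ i, envSwap k A (z.1 (p i)) • cls (r (f i)) = cls z := fun z => by
    conv_rhs => rw [← hr z, ← EnvDual.sum_swap_smul hf z.1]
    simp only [map_sum, map_smul]
  refine ⟨l, fun i => cls (r (f i)), p, key, ?_⟩
  cases n with
  | zero => trivial
  | succ n =>
    obtain ⟨m, q, g, hg⟩ := EnvDual.exists_basis k A (P n)
    have hz : ∀ t, EnvDual.transpose (d n) (g t) ∈ cocycles d (n + 1) := fun t =>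
      EnvDual.ext fun x => (congrArg (g t) (hdd n x)).trans (g t).map_zero
    have hsum : ∀ t, ∑ i, envSwap k A (g t (d n (p i))) • cls (r (f i)) = 0 := fun t =>
      (key ⟨_, hz t⟩).trans ((hcls.eq_zero_iff _).2 ⟨g t, rfl⟩)
    change Cyc.map (BTensor.mapRight T (d n)) _ = 0
    simp only [map_sum, Cyc.map_mk, BTensor.mapRight_btmul]
    have hexp : ∀ i, Cyc.mk k A (btmul k A (cls (r (f i))) (d n (p i))) =
        ∑ t, Cyc.mk k A (btmul k A (envSwap k A (g t (d n (p i))) • cls (r (f i))) (q t)) := by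
      intro i
      conv_lhs => rw [← hg (d n (p i))]
      simp only [Cyc.mk_envSwap_btmul]
      exact map_sum ((Cyc.mk k A).comp (btmulHom (cls (r (f i))))) _ _
    simp only [hexp]
    rw [Finset.sum_comm]
    refine Finset.sum_eq_zero fun t _ => ?_
    let φ : T →+ Cyc k A (BTensor k A T (P n)) := (Cyc.mk k A).comp (btmulHom.flip (q t))
    have := map_sum φ (fun i => envSwap k A (g t (d n (p i))) • cls (r (f i))) Finset.univ
    rw [hsum, map_zero] at this
    exact this.symm

end Cocycles

section ExtClass

variable {k : Type v} {A : Type u} [CommRing k] [Ring A] [Algebra k A]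
  (R : ProjectiveResolution (ModuleCat.of (Env k A) A))

/-- The differentials of a projective resolution. -/
abbrev resD (n : ℕ) : R.complex.X (n + 1) →ₗ[Env k A] R.complex.X n :=
  (R.complex.d (n + 1) n).hom

theorem resD_comp_eq_zero {n : ℕ} {f : EnvDual k A (R.complex.X n)}
    (hf : f ∈ cocycles (P := fun n => R.complex.X n) (resD R) n) :
    R.complex.d (n + 1) n ≫
      ModuleCat.ofHom (show R.complex.X n →ₗ[Env k A] Env k A from f) = 0 := by
  ext x
  exact DFunLike.congr_fun (show EnvDual.transpose (resD R n) f = 0 from hf) x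

/-- The class of a cocycle in `Ext`. -/
def extClassFun (n : ℕ) (f : EnvDual k A (R.complex.X n))
    (hf : f ∈ cocycles (P := fun n => R.complex.X n) (resD R) n) : ExtEnv k A n :=
  R.extMk (ModuleCat.ofHom (show R.complex.X n →ₗ[Env k A] Env k A from f)) (n + 1)
    rfl (resD_comp_eq_zero R hf)

theorem extClassFun_add (n : ℕ) (f g : EnvDual k A (R.complex.X n))
    (hf : f ∈ cocycles (P := fun n => R.complex.X n) (resD R) n)
    (hg : g ∈ cocycles (P := fun n => R.complex.X n) (resD R) n) :
    extClassFun R n (f + g) (Submodule.add_mem _ hf hg) =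
      extClassFun R n f hf + extClassFun R n g hg :=
  (R.add_extMk (ModuleCat.ofHom (show R.complex.X n →ₗ[Env k A] Env k A from f))
    (ModuleCat.ofHom (show R.complex.X n →ₗ[Env k A] Env k A from g)) (n + 1)
    rfl (resD_comp_eq_zero R hf) (resD_comp_eq_zero R hg)).symm

theorem extClassFun_smul (n : ℕ) (e : Env k A) (f : EnvDual k A (R.complex.X n))
    (hf : f ∈ cocycles (P := fun n => R.complex.X n) (resD R) n) :
    extClassFun R n (e • f) (Submodule.smul_mem _ e hf) = e • extClassFun R n f hf :=
  (R.extMk_comp_mk₀ (ModuleCat.ofHom (show R.complex.X n →ₗ[Env k A] Env k A from f)) (n + 1)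
    rfl (resD_comp_eq_zero R hf) (innerAct k A e)).symm

/-- The class of a cocycle in `Ext`, as a linear map. -/
def extClass (n : ℕ) :
    cocycles (P := fun n => R.complex.X n) (resD R) n →ₗ[Env k A] ExtEnv k A n where
  toFun z := extClassFun R n z.1 z.2
  map_add' z z' := extClassFun_add R n z.1 z'.1 z.2 z'.2
  map_smul' e z := by
    rw [RingHom.id_apply, ← extClassFun_smul]
    rfl

theorem extClassFun_eq_zero_iff (n : ℕ) (f : EnvDual k A (R.complex.X n))
    (hf : f ∈ cocycles (P := fun n => R.complex.X n) (resD R) n) :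
    extClassFun R n f hf = 0 ↔ (show R.complex.X n →ₗ[Env k A] Env k A from f) ∈
      coboundaries (P := fun n => R.complex.X n) (Env k A) (resD R) n := by
  cases n with
  | zero =>
    refine (extMk_zero_eq_zero_iff R _ (resD_comp_eq_zero R hf)).trans ⟨fun h => ?_, fun h => ?_⟩
    · exact congrArg ModuleCat.Hom.hom h
    · ext x
      exact DFunLike.congr_fun (show (show R.complex.X 0 →ₗ[Env k A] Env k A from f) = 0 from h) x
  | succ n =>
    refine (R.extMk_eq_zero_iff _ _ rfl (resD_comp_eq_zero R hf) n rfl).trans ⟨?_, ?_⟩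
    · rintro ⟨g, hg⟩
      exact ⟨g.hom, congrArg ModuleCat.Hom.hom hg⟩
    · rintro ⟨g, hg⟩
      exact ⟨ModuleCat.ofHom g, by ext x; exact DFunLike.congr_fun hg x⟩

theorem isClassMap_extClass (n : ℕ) : IsClassMap (P := fun n => R.complex.X n) (d := resD R) (extClass R n) where
  surjective x := by
    obtain ⟨f, hf, h⟩ := R.extMk_surjective x (n + 1) rfl
    exact ⟨⟨f.hom, EnvDual.ext fun x => DFunLike.congr_fun (congrArg ModuleCat.Hom.hom hf) x⟩, h⟩
  eq_zero_iff z := extClassFun_eq_zero_iff R n z.1 z.2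

end ExtClass

section Restriction

variable {k : Type v} {A D : Type u} [CommRing k] [Ring A] [Ring D] [Algebra k A] [Algebra k D]
  (ι : A →ₐ[k] D)

/-- The homomorphism of enveloping algebras that is induced by a homomorphism of algebras. -/
def envMap : Env k A →+* Env k D := (Algebra.TensorProduct.map ι (AlgHom.op ι)).toRingHom

theorem envMap_tmul (a b : A) : envMap ι (a ⊗ₜ op b) = ι a ⊗ₜ op (ι b) := rfl

theorem envMap_lft (a : A) : envMap ι (lft k a) = lft k (ι a) := by
  rw [lft, ← op_one, envMap_tmul, map_one, op_one]

theorem envMap_rgt (a : A) : envMap ι (rgt k a) = rgt k (ι a) := by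
  rw [rgt, envMap_tmul, map_one]

/-- The `A`-bimodule structure of `N` is the restriction of the `D`-bimodule structure. -/
class IsRestriction (N : Type*) [AddCommGroup N] [Module (Env k A) N] [Module (Env k D) N] :
    Prop where
  smul_eq : ∀ (e : Env k A) (n : N), e • n = envMap ι e • n

variable {M N : Type u} [AddCommGroup M] [AddCommGroup N] [Module (Env k A) M] [Module (Env k D) M]
  [Module (Env k A) N] [Module (Env k D) N] [IsRestriction ι M] [IsRestriction ι N]

theorem res_lft (a : A) (n : N) : lft k a • n = lft k (ι a) • n := by
  rw [IsRestriction.smul_eq (ι := ι), envMap_lft]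

theorem res_rgt (a : A) (n : N) : rgt k a • n = rgt k (ι a) • n := by
  rw [IsRestriction.smul_eq (ι := ι), envMap_rgt]

/-- A map of `D`-bimodules, as a map of `A`-bimodules. -/
def resHom (f : M →ₗ[Env k D] N) : M →ₗ[Env k A] N where
  toFun := f
  map_add' := f.map_add
  map_smul' e m := by
    rw [IsRestriction.smul_eq (ι := ι), map_smul, RingHom.id_apply,
      IsRestriction.smul_eq (ι := ι)]

theorem resHom_apply (f : M →ₗ[Env k D] N) (m : M) : resHom ι f m = f m := rfl

/-- The identification of the two restrictions of scalars. -/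
def alongEquiv (N : Type*) [AddCommGroup N] [Module (Env k A) N] [Module (Env k D) N]
    [IsRestriction ι N] : Along (envMap ι) N ≃ₗ[Env k A] N where
  toFun n := n
  invFun n := n
  left_inv _ := rfl
  right_inv _ := rfl
  map_add' _ _ := rfl
  map_smul' e n := (IsRestriction.smul_eq (ι := ι) (N := N) e n).symm

end Restriction

/-- A Frobenius system of index `l` for the extension `ι : A → D`. -/
structure FrobeniusSystem {k : Type v} {A D : Type u} [CommRing k] [Ring A] [Ring D] [Algebra k A]
    [Algebra k D] (ι : A →ₐ[k] D) (l : ℕ) (T : Type*) [Fintype T] where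
  /-- the Frobenius homomorphism -/
  E : D →ₗ[k] A
  /-- the first dual basis -/
  X : T → D
  /-- the second dual basis -/
  Y : T → D
  E_mul_left : ∀ a x, E (ι a * x) = a * E x
  E_mul_right : ∀ x a, E (x * ι a) = E x * a
  sum_left : ∀ x, ∑ t, X t * ι (E (Y t * x)) = x
  sum_right : ∀ x, ∑ t, ι (E (x * X t)) * Y t = x
  sum_mul : ∑ t, X t * Y t = l

namespace FrobeniusSystem

variable {k : Type v} {A D : Type u} [CommRing k] [Ring A] [Ring D] [Algebra k A] [Algebra k D]
  {ι : A →ₐ[k] D} {l : ℕ} {T : Type*} [Fintype T] (S : FrobeniusSystem ι l T)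

section Averaging

theorem lft_sum {B R : Type*} {k : Type*} [CommRing k] [Ring R] [Algebra k R] (s : Finset B)
    (f : B → R) : lft k (∑ i ∈ s, f i) = ∑ i ∈ s, lft k (f i) := TensorProduct.sum_tmul _ _ _

theorem rgt_sum {B R : Type*} {k : Type*} [CommRing k] [Ring R] [Algebra k R] (s : Finset B)
    (f : B → R) : rgt k (∑ i ∈ s, f i) = ∑ i ∈ s, rgt k (f i) := by
  rw [rgt, Finset.op_sum, TensorProduct.tmul_sum]

variable {M N L : Type u} [AddCommGroup M] [AddCommGroup N] [AddCommGroup L] [Module (Env k D) M]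
  [Module (Env k D) N] [Module (Env k D) L]

/-- The average of an additive map with respect to the left actions. -/
def avL (h : M →+ N) : M →+ N :=
  ∑ t, (DistribSMul.toAddMonoidHom N (lft k (S.X t))).comp
    (h.comp (DistribSMul.toAddMonoidHom M (lft k (S.Y t))))

/-- The average of an additive map with respect to the right actions. -/
def avR (h : M →+ N) : M →+ N :=
  ∑ t, (DistribSMul.toAddMonoidHom N (rgt k (S.Y t))).comp
    (h.comp (DistribSMul.toAddMonoidHom M (rgt k (S.X t))))

theorem avL_apply (h : M →+ N) (m : M) :
    S.avL h m = ∑ t, lft k (S.X t) • h (lft k (S.Y t) • m) := by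
  simp [avL]

theorem avR_apply (h : M →+ N) (m : M) :
    S.avR h m = ∑ t, rgt k (S.Y t) • h (rgt k (S.X t) • m) := by
  simp [avR]

theorem avL_lft {h : M →+ N} (hl : ∀ a m, h (lft k (ι a) • m) = lft k (ι a) • h m) (x : D) (m : M) :
    S.avL h (lft k x • m) = lft k x • S.avL h m := by
  have h1 : ∀ t, h (lft k (S.Y t) • lft k x • m) =
      ∑ u, lft k (ι (S.E (S.Y t * (x * S.X u)))) • h (lft k (S.Y u) • m) := by
    intro t
    rw [← lft_mul_smul]
    conv_lhs => rw [← S.sum_right (S.Y t * x), lft_sum, Finset.sum_smul, map_sum]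
    refine Finset.sum_congr rfl fun u _ => ?_
    rw [lft_mul_smul, hl, mul_assoc]
  simp only [avL_apply, h1, Finset.smul_sum]
  rw [Finset.sum_comm]
  refine Finset.sum_congr rfl fun u _ => ?_
  simp only [← lft_mul_smul]
  rw [← Finset.sum_smul, ← lft_sum, S.sum_left]

theorem avR_rgt {h : M →+ N} (hr : ∀ a m, h (rgt k (ι a) • m) = rgt k (ι a) • h m) (x : D) (m : M) :
    S.avR h (rgt k x • m) = rgt k x • S.avR h m := by
  have h1 : ∀ t, h (rgt k (S.X t) • rgt k x • m) =
      ∑ u, rgt k (ι (S.E (S.Y u * x * S.X t))) • h (rgt k (S.X u) • m) := by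
    intro t
    rw [← rgt_mul_smul]
    conv_lhs => rw [← S.sum_left (x * S.X t), rgt_sum, Finset.sum_smul, map_sum]
    refine Finset.sum_congr rfl fun u _ => ?_
    rw [rgt_mul_smul, hr, mul_assoc]
  simp only [avR_apply, h1, Finset.smul_sum]
  rw [Finset.sum_comm]
  refine Finset.sum_congr rfl fun u _ => ?_
  simp only [← rgt_mul_smul]
  rw [← Finset.sum_smul, ← rgt_sum, S.sum_right]

theorem avL_rgt {h : M →+ N} {x : D} (hr : ∀ m, h (rgt k x • m) = rgt k x • h m) (m : M) :
    S.avL h (rgt k x • m) = rgt k x • S.avL h m := by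
  simp only [avL_apply, Finset.smul_sum]
  refine Finset.sum_congr rfl fun t _ => ?_
  rw [← rgt_lft_comm, hr, rgt_lft_comm]

theorem avR_lft {h : M →+ N} {x : D} (hl : ∀ m, h (lft k x • m) = lft k x • h m) (m : M) :
    S.avR h (lft k x • m) = lft k x • S.avR h m := by
  simp only [avR_apply, Finset.smul_sum]
  refine Finset.sum_congr rfl fun t _ => ?_
  rw [rgt_lft_comm, hl, rgt_lft_comm]

theorem avL_of_lft {h : M →+ N} (hl : ∀ (x : D) m, h (lft k x • m) = lft k x • h m) (m : M) :
    S.avL h m = l • h m := by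
  have : (l : Env k D) = lft k (l : D) := (map_natCast (lftRing k D) l).symm
  simp only [avL_apply, hl, ← lft_mul_smul]
  rw [← Finset.sum_smul, ← lft_sum, S.sum_mul, ← this, Nat.cast_smul_eq_nsmul]

theorem avR_of_rgt {h : M →+ N} (hr : ∀ (x : D) m, h (rgt k x • m) = rgt k x • h m) (m : M) :
    S.avR h m = l • h m := by
  have : (l : Env k D) = rgt k (l : D) := by
    rw [rgt, op_natCast]; exact (map_natCast (rgtRing k D) l).symm
  simp only [avR_apply, hr, ← rgt_mul_smul]
  rw [← Finset.sum_smul, ← rgt_sum, S.sum_mul, ← this, Nat.cast_smul_eq_nsmul]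

variable [Module (Env k A) M] [Module (Env k A) N] [IsRestriction ι M] [IsRestriction ι N]

/-- The average of a map of `A`-bimodules is a map of `D`-bimodules. -/
def av (h : M →ₗ[Env k A] N) : M →ₗ[Env k D] N :=
  bimoduleHom (S.avL (S.avR h.toAddMonoidHom))
    (S.avL_lft fun a => S.avR_lft fun m => by
      change h (lft k (ι a) • m) = lft k (ι a) • h m
      rw [← res_lft ι, ← res_lft ι, map_smul])
    (fun x => S.avL_rgt (S.avR_rgt (fun a m => by
      change h (rgt k (ι a) • m) = rgt k (ι a) • h m
      rw [← res_rgt ι, ← res_rgt ι, map_smul]) x))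

theorem av_def (h : M →ₗ[Env k A] N) (m : M) :
    S.av h m = S.avL (S.avR h.toAddMonoidHom) m := rfl

theorem av_apply (h : M →ₗ[Env k A] N) (m : M) :
    S.av h m = ∑ t, lft k (S.X t) • ∑ s, rgt k (S.Y s) • h (rgt k (S.X s) • lft k (S.Y t) • m) := by
  rw [av_def, avL_apply]
  simp only [avR_apply]
  rfl

theorem av_add (h h' : M →ₗ[Env k A] N) : S.av (h + h') = S.av h + S.av h' := by
  ext m
  simp only [av_apply, LinearMap.add_apply, smul_add, Finset.sum_add_distrib]

theorem comp_av [Module (Env k A) L] [IsRestriction ι L] (g : N →ₗ[Env k D] L)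
    (h : M →ₗ[Env k A] N) (m : M) : g (S.av h m) = S.av (resHom ι g ∘ₗ h) m := by
  simp only [av_apply, map_sum, map_smul]
  rfl

theorem av_comp [Module (Env k A) L] [IsRestriction ι L] (g : L →ₗ[Env k D] M)
    (h : M →ₗ[Env k A] N) (x : L) : S.av h (g x) = S.av (h ∘ₗ resHom ι g) x := by
  simp only [av_apply, ← map_smul]
  rfl

theorem av_resHom (h : M →ₗ[Env k D] N) (m : M) :
    S.av (resHom ι h) m = l • l • h m := by
  rw [av_def]
  have hR : ∀ m, S.avR (resHom ι h).toAddMonoidHom m = l • h m := S.avR_of_rgt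
    fun x m => map_smul h _ _
  rw [S.avL_of_lft fun x m => by rw [hR, hR, map_smul, smul_comm], hR]

end Averaging

section Base

/-- The Frobenius homomorphism as a map of bimodules. -/
def EHom [Module (Env k A) D] [IsRestriction ι D] : D →ₗ[Env k A] A :=
  bimoduleHom S.E.toAddMonoidHom
    (fun a x => by
      rw [res_lft ι, lft_smul_self, lft_smul_self]
      exact S.E_mul_left a x)
    (fun a x => by
      rw [res_rgt ι, rgt_smul_self, rgt_smul_self]
      exact S.E_mul_right x a)

theorem EHom_apply [Module (Env k A) D] [IsRestriction ι D] (x : D) : S.EHom x = S.E x := rfl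

variable (ι) in
/-- The inclusion as a map of bimodules. -/
def iotaHom [Module (Env k A) D] [IsRestriction ι D] : A →ₗ[Env k A] D :=
  bimoduleHom ι.toRingHom.toAddMonoidHom
    (fun a x => by
      rw [res_lft (N := D) ι, lft_smul_self, lft_smul_self]
      exact map_mul ι a x)
    (fun a x => by
      rw [res_rgt (N := D) ι, rgt_smul_self, rgt_smul_self]
      exact map_mul ι x a)

theorem av_iota_E [Module (Env k A) D] [IsRestriction ι D] (x : D) :
    S.av (iotaHom ι ∘ₗ S.EHom) x = l • x := by
  have hR : S.avR (iotaHom ι ∘ₗ S.EHom).toAddMonoidHom = AddMonoidHom.id D := by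
    ext y
    rw [avR_apply]
    simp only [rgt_smul_self]
    exact S.sum_right y
  rw [av_def, hR]
  exact S.avL_of_lft (h := AddMonoidHom.id D) (fun _ _ => rfl) x

variable [Module (Env k A) (Env k D)] [IsRestriction ι (Env k D)]

/-- The map of bimodules `x ⊗ y ↦ E(x a) ⊗ E(b y)`. -/
def coord (a b : D) : Env k D →ₗ[Env k A] Env k A :=
  bimoduleHom (TensorProduct.map (S.E ∘ₗ LinearMap.mulRight k a)
      ((opLinearEquiv k).toLinearMap ∘ₗ S.E ∘ₗ LinearMap.mulLeft k b ∘ₗ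
        (opLinearEquiv k).symm.toLinearMap)).toAddMonoidHom
    (fun c e => by
      rw [res_lft ι, smul_eq_mul, smul_eq_mul]
      induction e using TensorProduct.induction_on with
      | zero => simp
      | tmul x y =>
        simp only [LinearMap.toAddMonoidHom_coe, Algebra.TensorProduct.tmul_mul_tmul, one_mul,
          TensorProduct.map_tmul, LinearMap.comp_apply, LinearMap.mulRight_apply]
        rw [mul_assoc, S.E_mul_left]
      | add x y hx hy => rw [mul_add, map_add, map_add, mul_add, hx, hy])
    (fun c e => by
      rw [res_rgt ι, smul_eq_mul, smul_eq_mul]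
      induction e using TensorProduct.induction_on with
      | zero => simp
      | tmul x y =>
        induction y using MulOpposite.rec'
        simp only [LinearMap.toAddMonoidHom_coe, Algebra.TensorProduct.tmul_mul_tmul, one_mul,
          TensorProduct.map_tmul, LinearMap.comp_apply, LinearMap.mulLeft_apply,
          LinearEquiv.coe_coe, coe_opLinearEquiv, coe_opLinearEquiv_symm, ← op_mul, unop_op]
        rw [← mul_assoc, S.E_mul_right]
      | add x y hx hy => rw [mul_add, map_add, map_add, mul_add, hx, hy])

theorem coord_tmul (a b x y : D) : S.coord a b (x ⊗ₜ op y) = S.E (x * a) ⊗ₜ op (S.E (b * y)) := rfl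

theorem sum_coord (e : Env k D) :
    ∑ t, ∑ s, S.coord (S.X t) (S.Y s) e • (S.Y t ⊗ₜ op (S.X s) : Env k D) = e := by
  induction e using TensorProduct.induction_on with
  | zero =>
    refine Finset.sum_eq_zero fun t _ => Finset.sum_eq_zero fun s _ => ?_
    rw [map_zero]
    exact zero_smul (Env k A) (S.Y t ⊗ₜ op (S.X s) : Env k D)
  | tmul x y =>
    induction y using MulOpposite.rec' with | _ y
    have h : ∀ t s, S.coord (S.X t) (S.Y s) (x ⊗ₜ op y) • (S.Y t ⊗ₜ op (S.X s) : Env k D) =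
        (ι (S.E (x * S.X t)) * S.Y t) ⊗ₜ op (S.X s * ι (S.E (S.Y s * y))) := fun t s => by
      rw [coord_tmul, IsRestriction.smul_eq (ι := ι), envMap_tmul, smul_eq_mul,
        Algebra.TensorProduct.tmul_mul_tmul, ← op_mul]
    simp only [h, ← TensorProduct.tmul_sum, ← TensorProduct.sum_tmul, ← Finset.op_sum]
    rw [S.sum_left, S.sum_right]
  | add x y hx hy =>
    conv_rhs => rw [← hx, ← hy]
    simp only [map_add, add_smul, Finset.sum_add_distrib]

include S in
theorem finite_env : Module.Finite (Env k A) (Env k D) :=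
  Module.Finite.of_surjective (Fintype.linearCombination (Env k A)
    fun i : T × T => (S.Y i.1 ⊗ₜ op (S.X i.2) : Env k D)) fun e => ⟨fun i =>
      S.coord (S.X i.1) (S.Y i.2) e, by
        rw [Fintype.linearCombination_apply, Fintype.sum_prod_type]
        exact S.sum_coord e⟩

include S in
theorem projective_env : Module.Projective (Env k A) (Env k D) :=
  Module.Projective.of_split
    (LinearMap.pi fun i : T × T => S.coord (S.X i.1) (S.Y i.2))
    (Fintype.linearCombination (Env k A) fun i : T × T => (S.Y i.1 ⊗ₜ op (S.X i.2) : Env k D))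
    (LinearMap.ext fun e => by
      rw [LinearMap.comp_apply, Fintype.linearCombination_apply, Fintype.sum_prod_type]
      exact S.sum_coord e)

end Base

end FrobeniusSystem

theorem exists_finite_projective_cover (S : Type u) [Ring S] (U : Type u) [AddCommGroup U]
    [Module S U] [Module.Finite S U] : ∃ F : ModuleCat.{u} S, Module.Finite S F ∧
      Module.Projective S F ∧ ∃ π : F →ₗ[S] U, Function.Surjective π := by
  obtain ⟨n, f, hf⟩ := Module.Finite.exists_fin' S U
  exact ⟨ModuleCat.of S (Fin n → S), inferInstanceAs (Module.Finite S (Fin n → S)),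
    inferInstanceAs (Module.Projective S (Fin n → S)), f, hf⟩

theorem projective_of_dualBasis {B N : Type*} [Ring B] [AddCommGroup N] [Module B N] {T : Type*}
    [Fintype T] (f : T → N →ₗ[B] B) (y : T → N) (h : ∀ x, ∑ t, f t x • y t = x) :
    Module.Projective B N :=
  Module.Projective.of_split (LinearMap.pi f) (Fintype.linearCombination B y)
    (LinearMap.ext fun x => by
      rw [LinearMap.comp_apply, Fintype.linearCombination_apply]
      exact h x)

/-- Division by a natural number that is invertible in the ring of scalars. -/
theorem exists_div_nat {S : Type*} [Ring S] {l : ℕ} (hl : IsUnit (l : S)) (N : Type*)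
    [AddCommGroup N] [Module S N] :
    ∃ c : N →ₗ[S] N, (∀ n, c (l • n) = n) ∧ ∀ n, l • c n = n := by
  obtain ⟨v, hv⟩ := hl
  have h : ∀ n : N, l • n = v • n := fun n => by
    rw [Units.smul_def, hv, Nat.cast_smul_eq_nsmul]
  let e : N ≃ₗ[S] N := LinearEquiv.ofBijective (l • LinearMap.id) (by
    have : ⇑(l • LinearMap.id : N →ₗ[S] N) = fun n => v • n := funext h
    rw [this]
    exact MulAction.bijective v)
  exact ⟨e.symm.toLinearMap, fun n => e.symm_apply_apply n, fun n => e.apply_symm_apply n⟩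

section Coboundaries

variable {S : Type*} [Ring S] {P : ℕ → Type*} [∀ n, AddCommGroup (P n)] [∀ n, Module S (P n)]
  {N N' : Type*} [AddCommGroup N] [Module S N] [AddCommGroup N'] [Module S N']
  {d : ∀ n, P (n + 1) →ₗ[S] P n}

theorem comp_mem_coboundaries (g : N →ₗ[S] N') {n : ℕ} {f : P n →ₗ[S] N}
    (hf : f ∈ coboundaries N d n) : g ∘ₗ f ∈ coboundaries N' d n :=
  map_mem_coboundaries (fun n => AddMonoidHom.mk' (fun f : P n →ₗ[S] N => g ∘ₗ f)
    fun _ _ => LinearMap.comp_add _ _ _) (fun _ _ => rfl) hf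

end Coboundaries

namespace FrobeniusSystem

variable {k : Type v} {A D : Type u} [CommRing k] [Ring A] [Ring D] [Algebra k A] [Algebra k D]
  {ι : A →ₐ[k] D} {l : ℕ} {T : Type*} [Fintype T] (S : FrobeniusSystem ι l T)

theorem isUnit_env (hl : IsUnit (l : D)) : IsUnit (l : Env k D) := by
  have := hl.map (lftRing k D)
  rwa [map_natCast] at this

include S in
theorem projective_of_restriction (hl : IsUnit (l : D)) (M : Type u) [AddCommGroup M]
    [Module (Env k A) M] [Module (Env k D) M] [IsRestriction ι M]
    [Module.Projective (Env k A) M] : Module.Projective (Env k D) M := by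
  obtain ⟨F, hF, π, hπ⟩ := exists_projective_cover (Env k D) M
  let _ : Module (Env k A) F := Module.compHom F (envMap ι)
  have : IsRestriction ι F := ⟨fun _ _ => rfl⟩
  obtain ⟨h, hh⟩ := Module.projective_lifting_property (resHom ι π) LinearMap.id hπ
  obtain ⟨c, hc, -⟩ := exists_div_nat (isUnit_env (k := k) hl) M
  refine Module.Projective.of_split (S.av h) (c ∘ₗ c ∘ₗ π) (LinearMap.ext fun m => ?_)
  have : π (S.av h m) = l • l • m := by
    rw [comp_av, hh]
    exact S.av_resHom (LinearMap.id : M →ₗ[Env k D] M) m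
  simp only [LinearMap.comp_apply, this, hc, LinearMap.id_apply]

include S in
theorem hasFiniteResolution_of_restriction (hl : IsUnit (l : D)) (n : ℕ) :
    ∀ (M : Type u) [AddCommGroup M] [Module (Env k D) M],
      HasFiniteResolution (Env k A) n (Along (envMap ι) M) → HasFiniteResolution (Env k D) n M := by
  induction n with
  | zero =>
    rintro M _ _ ⟨h₁, h₂⟩
    let _ : Module (Env k A) M := Module.compHom M (envMap ι)
    have : IsRestriction ι M := ⟨fun _ _ => rfl⟩
    have : Module.Projective (Env k A) M := h₂
    exact ⟨finite_of_along (envMap ι), S.projective_of_restriction hl M⟩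
  | succ n ih =>
    intro M _ _ h
    have := h.finite
    have := finite_of_along (envMap ι) (M := M)
    obtain ⟨F, hF₁, hF₂, π, hπ⟩ := exists_finite_projective_cover (Env k D) M
    let _ : Module (Env k A) (Env k D) := Module.compHom (Env k D) (envMap ι)
    have : IsRestriction ι (Env k D) := ⟨fun _ _ => rfl⟩
    have : Module.Finite (Env k A) (Along (envMap ι) (Env k D)) := S.finite_env
    have : Module.Projective (Env k A) (Along (envMap ι) (Env k D)) := S.projective_env
    have : Module.Finite (Env k A) (Along (envMap ι) F) := finite_along (envMap ι)
    have : Module.Projective (Env k A) (Along (envMap ι) F) := projective_along (envMap ι)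
    refine ⟨F, π, hF₁, hF₂, hπ, ih _ ?_⟩
    exact (h.ker (alongMap (envMap ι) π) hπ).of_equiv
      { toFun := fun x => x
        invFun := fun x => x
        left_inv := fun _ => rfl
        right_inv := fun _ => rfl
        map_add' := fun _ _ => rfl
        map_smul' := fun _ _ => rfl }

section TensorD

variable [Module (Env k A) D] [IsRestriction ι D]

include S in
theorem projective_left : Module.Projective A (Along (lftRing k A) D) := by
  have hs : ∀ (a : A) (x : D), lft k a • x = ι a * x := fun a x => by
    rw [res_lft ι, lft_smul_self]
  let g : T → D →+ A := fun t => S.E.toAddMonoidHom.comp (AddMonoidHom.mulRight (S.X t))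
  have hg : ∀ t (a : A) x, g t (lft k a • x) = a * g t x := fun t a x => by
    change S.E (lft k a • x * S.X t) = a * S.E (x * S.X t)
    rw [hs, mul_assoc, S.E_mul_left]
  refine projective_of_dualBasis (N := Along (lftRing k A) D)
    (fun t => { toFun := g t, map_add' := (g t).map_add, map_smul' := hg t }) S.Y fun x => ?_
  have h : ∀ x : D, ∑ t, lft k (S.E (x * S.X t)) • S.Y t = x := fun x => by
    simp only [hs, S.sum_right]
  exact h x

include S in
theorem projective_right : Module.Projective Aᵐᵒᵖ (Along (rgtRing k A) D) := by
  have hs : ∀ (a : A) (x : D), rgt k a • x = x * ι a := fun a x => by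
    rw [res_rgt ι, rgt_smul_self]
  let g : T → D →+ Aᵐᵒᵖ := fun t => opAddEquiv.toAddMonoidHom.comp
    (S.E.toAddMonoidHom.comp (AddMonoidHom.mulLeft (S.Y t)))
  have hg : ∀ t (a : Aᵐᵒᵖ) x, g t (rgt k a.unop • x) = a * g t x := fun t a x => by
    change op (S.E (S.Y t * (rgt k a.unop • x))) = a * op (S.E (S.Y t * x))
    rw [hs, ← mul_assoc, S.E_mul_right, op_mul, op_unop]
  refine projective_of_dualBasis (N := Along (rgtRing k A) D)
    (fun t => { toFun := g t, map_add' := (g t).map_add, map_smul' := hg t }) S.X fun x => ?_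
  have h : ∀ x : D, ∑ t, rgt k (S.E (S.Y t * x)) • S.X t = x := fun x => by
    simp only [hs, S.sum_left]
  exact h x

include S in
theorem finite_btensor (P : Type u) [AddCommGroup P] [Module (Env k A) P]
    [Module.Finite (Env k A) P] : Module.Finite (Env k A) (BTensor k A P D) := by
  obtain ⟨n, p, hp⟩ := Module.Finite.exists_fin (R := Env k A) (M := P)
  let W := Submodule.span (Env k A) (Set.range fun i : Fin n × T => btmul k A (p i.1) (S.X i.2))
  have hgen : ∀ i x, btmul k A (p i) x ∈ W := fun i x => by
    rw [← S.sum_left x]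
    have h := map_sum (btmulHom (k := k) (A := A) (N := D) (p i))
      (fun t => S.X t * ι (S.E (S.Y t * x))) Finset.univ
    refine (congrArg (· ∈ W) h).mpr (sum_mem fun t _ => ?_)
    change btmul k A (p i) (S.X t * ι (S.E (S.Y t * x))) ∈ W
    rw [← rgt_smul_self k, ← res_rgt ι, ← rgt_smul_btmul]
    exact W.smul_mem _ (Submodule.subset_span ⟨(i, t), rfl⟩)
  have hall : ∀ y x, btmul k A y x ∈ W := fun y => by
    have hy : y ∈ Submodule.span (Env k A) (Set.range p) := hp ▸ Submodule.mem_top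
    induction hy using Submodule.span_induction with
    | mem y hy =>
      obtain ⟨i, rfl⟩ := hy
      exact hgen i
    | zero => exact fun x => by rw [zero_btmul]; exact W.zero_mem
    | add y z _ _ hy hz => exact fun x => by rw [add_btmul]; exact W.add_mem (hy x) (hz x)
    | smul e y _ hy =>
      clear * - hy
      induction e using env_induction generalizing y with
      | lft a => exact fun x => by rw [← lft_smul_btmul]; exact W.smul_mem _ (hy x)
      | rgt a => exact fun x => by rw [rgt_btmul]; exact hy _
      | mul e e' he he' =>
        rw [mul_smul]
        exact he _ (he' _ hy)
      | add e e' he he' =>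
        intro x
        rw [add_smul, add_btmul]
        exact W.add_mem (he _ hy x) (he' _ hy x)
  refine ⟨Submodule.fg_def.2 ⟨_, Set.finite_range
    (fun i : Fin n × T => btmul k A (p i.1) (S.X i.2)), top_le_iff.1 fun x _ => ?_⟩⟩
  change x ∈ W
  induction x using BTensor.induction with
  | zero => exact W.zero_mem
  | tmul y x => exact hall y x
  | add x y hx hy => exact W.add_mem (hx trivial) (hy trivial)

end TensorD

include S in
theorem hasFiniteResolution (hl : IsUnit (l : D)) {P : ℕ → Type u} [∀ n, AddCommGroup (P n)]
    [∀ n, Module (Env k A) (P n)] [∀ n, Module.Finite (Env k A) (P n)]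
    [∀ n, Module.Projective (Env k A) (P n)]
    {d : ∀ n, P (n + 1) →ₗ[Env k A] P n} {ε : P 0 →ₗ[Env k A] A} (hP : IsResolution d ε) {n : ℕ}
    (hn : ∀ i, n < i → Subsingleton (P i)) : HasFiniteResolution (Env k D) n D := by
  refine S.hasFiniteResolution_of_restriction hl n D ?_
  let _ : Module (Env k A) D := Module.compHom D (envMap ι)
  have : IsRestriction ι D := ⟨fun _ _ => rfl⟩
  have := S.projective_left
  have := S.projective_right
  refine HasFiniteResolution.of_resolution (M := D) (hP.mapLeft D) (fun i => S.finite_btensor (P i))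
    (fun i => projective_btensor_right) (fun i hi => ?_)
  have := hn i hi
  refine subsingleton_of_forall_eq 0 fun x => ?_
  induction x using BTensor.induction with
  | zero => rfl
  | tmul p x => rw [Subsingleton.elim p 0, zero_btmul]
  | add x y hx hy => rw [hx, hy, add_zero]

section Comparison

variable {P R : ℕ → Type u} [∀ n, AddCommGroup (P n)] [∀ n, AddCommGroup (R n)]
  [∀ n, Module (Env k A) (P n)] [∀ n, Module (Env k A) (R n)] [∀ n, Module (Env k D) (R n)]
  [∀ n, IsRestriction ι (R n)]
  {d : ∀ n, P (n + 1) →ₗ[Env k A] P n} {ε : P 0 →ₗ[Env k A] A}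
  {dR : ∀ n, R (n + 1) →ₗ[Env k D] R n} {εR : R 0 →ₗ[Env k D] D}

theorem isAugmented_resHom [Module (Env k A) D] [IsRestriction ι D] (h : IsAugmented dR εR) :
    IsAugmented (fun n => resHom ι (dR n)) (resHom ι εR) :=
  ⟨h.d_d, h.ε_d⟩

theorem isResolution_resHom [Module (Env k A) D] [IsRestriction ι D] (h : IsResolution dR εR) :
    IsResolution (fun n => resHom ι (dR n)) (resHom ι εR) :=
  ⟨isAugmented_resHom h.toIsAugmented, h.surjective, h.exact_zero, h.exact_succ⟩

include S in
theorem projective_restriction (N : Type u) [AddCommGroup N] [Module (Env k A) N]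
    [Module (Env k D) N] [IsRestriction ι N] [Module.Projective (Env k D) N] :
    Module.Projective (Env k A) N := by
  let _ : Module (Env k A) (Env k D) := Module.compHom (Env k D) (envMap ι)
  have : IsRestriction ι (Env k D) := ⟨fun _ _ => rfl⟩
  have : Module.Projective (Env k A) (Along (envMap ι) (Env k D)) := S.projective_env
  have : Module.Projective (Env k A) (Along (envMap ι) N) := projective_along (envMap ι)
  exact Module.Projective.of_equiv' (alongEquiv ι N)

variable {i : ∀ n, P n →ₗ[Env k A] R n}
  {p : ∀ n, R n →ₗ[Env k A] P n} (hi : IsChainMap d (fun n => resHom ι (dR n)) i)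
  (hiε : ∀ x, εR (i 0 x) = ι (ε x)) (hp : IsChainMap (fun n => resHom ι (dR n)) d p)
  (hpε : ∀ x, ε (p 0 x) = S.E (εR x)) (hR : IsResolution dR εR) (hl : IsUnit (l : D))
  {N : Type u} [AddCommGroup N] [Module (Env k A) N] [Module (Env k D) N] [IsRestriction ι N]

include hp in
theorem av_comp_mem_coboundaries {n : ℕ} {f : P n →ₗ[Env k A] N} (hf : f ∈ coboundaries N d n) :
    S.av (f ∘ₗ p n) ∈ coboundaries N dR n :=
  map_mem_coboundaries (fun n => AddMonoidHom.mk' (fun f : P n →ₗ[Env k A] N => S.av (f ∘ₗ p n))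
    fun f g => by rw [LinearMap.add_comp, av_add]) (fun n g => by
      ext x
      refine Eq.trans ?_ (S.av_comp (dR n) (g ∘ₗ p n) x).symm
      exact congrArg (fun h => S.av h x) (LinearMap.ext fun y => congrArg g (hp n y))) hf

variable [∀ n, Module.Projective (Env k D) (R n)]

include hi hiε hp hpε hR hl in
/-- A cocycle on a resolution of `D` is a coboundary if its restriction to a resolution of `A`
is one. -/
theorem mem_coboundaries_of_restriction {n : ℕ} {F : R n →ₗ[Env k D] N} (hF : IsCocycle dR F)
    (hf : resHom ι F ∘ₗ i n ∈ coboundaries N d n) : F ∈ coboundaries N dR n := by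
  let _ : Module (Env k A) D := Module.compHom D (envMap ι)
  have : IsRestriction ι D := ⟨fun _ _ => rfl⟩
  have h1 : F ∘ₗ S.av (i n ∘ₗ p n) ∈ coboundaries N dR n := by
    have : F ∘ₗ S.av (i n ∘ₗ p n) = S.av ((resHom ι F ∘ₗ i n) ∘ₗ p n) :=
      LinearMap.ext fun x => S.comp_av F _ x
    rw [this]
    exact S.av_comp_mem_coboundaries hp hf
  have h2 := comp_sub_comp_mem_coboundaries hR.toIsAugmented hR
    (F := fun n => S.av (i n ∘ₗ p n)) (G := fun n => l • LinearMap.id)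
    (fun n x => by
      rw [comp_av, av_comp]
      refine congrArg (fun h => S.av h x) (LinearMap.ext fun y => ?_)
      exact (hi n (p (n + 1) y)).trans (congrArg (i n) (hp n y)))
    (fun n x => by simp) (fun x => by
      rw [comp_av]
      have : resHom ι εR ∘ₗ i 0 ∘ₗ p 0 = (iotaHom ι ∘ₗ S.EHom) ∘ₗ resHom ι εR :=
        LinearMap.ext fun y => (hiε (p 0 y)).trans (congrArg ι (hpε y))
      rw [this, ← av_comp, av_iota_E]
      simp) hF
  have h3 : l • F ∈ coboundaries N dR n := by
    have := sub_mem h1 h2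
    rwa [sub_sub_cancel, LinearMap.comp_smul, LinearMap.comp_id] at this
  obtain ⟨c, hc, -⟩ := exists_div_nat (isUnit_env (k := k) hl) N
  have h4 := comp_mem_coboundaries c h3
  rwa [show c ∘ₗ (l • F) = F from LinearMap.ext fun x => hc (F x)] at h4

include hi hiε hp hpε hR hl in
theorem mem_coboundaries_of_forall {n : ℕ}
    (hn : ∀ f : P n →ₗ[Env k A] Env k A, IsCocycle d f → f ∈ coboundaries (Env k A) d n)
    {F : R n →ₗ[Env k D] Env k D} (hF : IsCocycle dR F) : F ∈ coboundaries (Env k D) dR n := by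
  let _ : Module (Env k A) (Env k D) := Module.compHom (Env k D) (envMap ι)
  have : IsRestriction ι (Env k D) := ⟨fun _ _ => rfl⟩
  refine S.mem_coboundaries_of_restriction hi hiε hp hpε hR hl hF ?_
  have h : resHom ι F ∘ₗ i n = ∑ t, ∑ s, LinearMap.toSpanSingleton (Env k A) (Env k D)
      (S.Y t ⊗ₜ op (S.X s)) ∘ₗ S.coord (S.X t) (S.Y s) ∘ₗ resHom ι F ∘ₗ i n := by
    ext x
    simp only [LinearMap.sum_apply, LinearMap.comp_apply, LinearMap.toSpanSingleton_apply]
    exact (S.sum_coord _).symm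
  rw [h]
  refine sum_mem fun t _ => sum_mem fun s _ => comp_mem_coboundaries _ (hn _ fun x => ?_)
  have : F (i n (d n x)) = 0 := by
    rw [← hi n x]
    exact hF _
  simp only [LinearMap.comp_apply, resHom_apply, this, map_zero]

end Comparison

end FrobeniusSystem

/-- A Frobenius system for an extension `A → D`, together with a grading of `D` by `ℤ/l` for which
`A` is the component of degree zero, and an invertible component `U` of degree one. -/
structure GradedFrobeniusSystem {k : Type v} {A D : Type u} [CommRing k] [Ring A] [Ring D]
    [Algebra k A] [Algebra k D] (ι : A →ₐ[k] D) (l : ℕ) [NeZero l] (T : Type*) [Fintype T]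
    (U : Type u) [AddCommGroup U] [Module (Env k A) U] (I : Type*) [Fintype I]
    extends FrobeniusSystem ι l T where
  /-- the projections onto the components -/
  pr : ZMod l → D →ₗ[k] D
  /-- the inclusion of the component of degree one -/
  j : U →+ D
  /-- the first half of a decomposition of the unit -/
  y : I → D
  /-- the second half of a decomposition of the unit -/
  x : I → U
  pr_zero : ∀ z, pr 0 z = ι (E z)
  sum_pr : ∀ z, ∑ b, pr b z = z
  pr_mul_left : ∀ b a z, pr b (ι a * z) = ι a * pr b z
  pr_one_mul_j : ∀ z u, pr 1 (z * j u) = ι (E z) * j u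
  pr_one_mul_right : ∀ z a, pr 1 (z * ι a) = pr 1 z * ι a
  j_lft : ∀ a u, j (lft k a • u) = ι a * j u
  j_rgt : ∀ a u, j (rgt k a • u) = j u * ι a
  j_injective : Function.Injective j
  sum_y_x : ∑ i, y i * j (x i) = 1
  pr_y_mul : ∀ b i z, pr b (y i * z) = y i * pr (b + 1) z
  j_mul_y : ∀ u i, ι (E (j u * y i)) = j u * y i

namespace GradedFrobeniusSystem

variable {k : Type v} {A D : Type u} [CommRing k] [Ring A] [Ring D] [Algebra k A] [Algebra k D]
  {ι : A →ₐ[k] D} {l : ℕ} [NeZero l] {T : Type*} [Fintype T] {U : Type u} [AddCommGroup U]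
  [Module (Env k A) U] {I : Type*} [Fintype I] (S : GradedFrobeniusSystem ι l T U I)

theorem sum_lft_x (u : U) : ∑ i, lft k (S.E (S.j u * S.y i)) • S.x i = u := by
  apply S.j_injective
  rw [map_sum]
  simp only [S.j_lft, S.j_mul_y, mul_assoc]
  rw [← Finset.mul_sum, S.sum_y_x, mul_one]

section Gamma

variable {P N L : Type u} [AddCommGroup P] [AddCommGroup N] [AddCommGroup L] [Module (Env k A) P]
  [Module (Env k A) N] [Module (Env k D) N] [IsRestriction ι N] [Module (Env k A) L]
  [Module (Env k D) L] [IsRestriction ι L]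

/-- The map `p ⊗ u ↦ f(p) u`. -/
def hat (f : P →ₗ[Env k A] N) : BTensor k A P U →ₗ[Env k A] N :=
  BTensor.liftHom (AddMonoidHom.mk' (fun p => AddMonoidHom.mk' (fun u => rgt k (S.j u) • f p)
      (fun u u' => by rw [map_add, rgt_add, add_smul]))
      (fun p p' => by
        ext u
        change rgt k (S.j u) • f (p + p') = rgt k (S.j u) • f p + rgt k (S.j u) • f p'
        rw [map_add, smul_add]))
    (fun p a u => by
      change rgt k (S.j u) • f (rgt k a • p) = rgt k (S.j (lft k a • u)) • f p
      rw [map_smul, res_rgt ι, S.j_lft, rgt_mul_smul])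
    (fun a p u => by
      change rgt k (S.j u) • f (lft k a • p) = lft k a • rgt k (S.j u) • f p
      rw [map_smul, res_lft ι, res_lft ι, rgt_lft_comm])
    (fun a p u => by
      change rgt k (S.j (rgt k a • u)) • f p = rgt k a • rgt k (S.j u) • f p
      rw [S.j_rgt, rgt_mul_smul, res_rgt ι])

theorem hat_btmul (f : P →ₗ[Env k A] N) (p : P) (u : U) :
    S.hat f (btmul k A p u) = rgt k (S.j u) • f p := rfl

theorem hat_add (f g : P →ₗ[Env k A] N) : S.hat (f + g) = S.hat f + S.hat g :=
  BTensor.linearMap_ext fun _ _ => smul_add _ _ _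

theorem hat_comp (f : N →ₗ[Env k D] L) (g : P →ₗ[Env k A] N) (z : BTensor k A P U) :
    S.hat (resHom ι f ∘ₗ g) z = f (S.hat g z) :=
  DFunLike.congr_fun (BTensor.linearMap_ext (f := S.hat (resHom ι f ∘ₗ g))
    (g := resHom ι f ∘ₗ S.hat g) fun _ _ => (map_smul f _ _).symm) z

theorem hat_mapLeft {P' : Type u} [AddCommGroup P'] [Module (Env k A) P'] (f : P →ₗ[Env k A] N)
    (d : P' →ₗ[Env k A] P) (z : BTensor k A P' U) :
    S.hat f (BTensor.mapLeft U d z) = S.hat (f ∘ₗ d) z :=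
  DFunLike.congr_fun (BTensor.linearMap_ext (f := S.hat f ∘ₗ BTensor.mapLeft U d)
    (g := S.hat (f ∘ₗ d)) fun _ _ => rfl) z

variable (σ : BTensor k A U P →ₗ[Env k A] BTensor k A P U)

/-- The conjugate of a map of bimodules by the component of degree one. -/
def gamma (f : P →ₗ[Env k A] N) : P →ₗ[Env k A] N :=
  bimoduleHom (AddMonoidHom.mk'
      (fun p => ∑ i, lft k (S.y i) • S.hat f (σ (btmul k A (S.x i) p)))
      (fun p p' => by simp only [btmul_add, map_add, smul_add, Finset.sum_add_distrib]))
    (fun a p => by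
      change ∑ i, lft k (S.y i) • S.hat f (σ (btmul k A (S.x i) (lft k a • p))) =
        lft k a • ∑ i, lft k (S.y i) • S.hat f (σ (btmul k A (S.x i) p))
      have h : ∀ i, S.hat f (σ (btmul k A (S.x i) (lft k a • p))) =
          ∑ m, lft k (S.j (S.x i) * ι a * S.y m) • S.hat f (σ (btmul k A (S.x m) p)) := fun i => by
        rw [← rgt_btmul]
        conv_lhs => rw [← S.sum_lft_x (rgt k a • S.x i)]
        let φ : U →+ N :=
          ((S.hat f).toAddMonoidHom.comp σ.toAddMonoidHom).comp (btmulHom.flip p)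
        refine (map_sum φ _ _).trans (Finset.sum_congr rfl fun m _ => ?_)
        change S.hat f (σ (btmul k A (lft k _ • S.x m) p)) = _
        rw [← lft_smul_btmul, map_smul, map_smul, res_lft ι, S.j_mul_y, S.j_rgt]
      simp only [h, Finset.smul_sum]
      rw [Finset.sum_comm]
      refine Finset.sum_congr rfl fun m _ => ?_
      simp only [← lft_mul_smul, ← mul_assoc]
      rw [← Finset.sum_smul, ← FrobeniusSystem.lft_sum, ← Finset.sum_mul, ← Finset.sum_mul,
        S.sum_y_x, one_mul, lft_mul_smul, res_lft ι])
    (fun a p => by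
      change ∑ i, lft k (S.y i) • S.hat f (σ (btmul k A (S.x i) (rgt k a • p))) =
        rgt k a • ∑ i, lft k (S.y i) • S.hat f (σ (btmul k A (S.x i) p))
      simp only [Finset.smul_sum, ← rgt_smul_btmul, map_smul]
      exact Finset.sum_congr rfl fun i _ => by rw [res_rgt ι, res_rgt ι, rgt_lft_comm])

theorem gamma_apply (f : P →ₗ[Env k A] N) (p : P) :
    S.gamma σ f p = ∑ i, lft k (S.y i) • S.hat f (σ (btmul k A (S.x i) p)) := rfl

theorem gamma_add (f g : P →ₗ[Env k A] N) :
    S.gamma σ (f + g) = S.gamma σ f + S.gamma σ g := by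
  ext p
  simp only [gamma_apply, hat_add, LinearMap.add_apply, smul_add, Finset.sum_add_distrib]

theorem comp_gamma (f : N →ₗ[Env k D] L) (g : P →ₗ[Env k A] N) :
    resHom ι f ∘ₗ S.gamma σ g = S.gamma σ (resHom ι f ∘ₗ g) := by
  ext p
  simp only [gamma_apply, LinearMap.comp_apply, resHom_apply, map_sum, map_smul, hat_comp]

theorem gamma_comp {P' : Type u} [AddCommGroup P'] [Module (Env k A) P']
    (σ' : BTensor k A U P' →ₗ[Env k A] BTensor k A P' U) (d : P' →ₗ[Env k A] P)
    (hσ : ∀ z, BTensor.mapLeft U d (σ' z) = σ (BTensor.mapRight U d z)) (f : P →ₗ[Env k A] N) :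
    S.gamma σ' (f ∘ₗ d) = S.gamma σ f ∘ₗ d := by
  ext p
  rw [LinearMap.comp_apply, gamma_apply, gamma_apply]
  simp only [← hat_mapLeft, hσ, BTensor.mapRight_btmul]

end Gamma

section Trace

variable [Module (Env k A) (Env k D)] [IsRestriction ι (Env k D)]
  {P : Type u} [AddCommGroup P] [Module (Env k A) P]

/-- The trace `p ⊗ u ↦ swap (f p) • u` with values in `D`. -/
def trace (f : P →ₗ[Env k A] Env k D) : Cyc k A (BTensor k A P U) →+ D :=
  Cyc.lift (AddMonoidHom.mk' (fun z => envSwap k D (S.hat f z) • (1 : D))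
      fun z z' => by rw [map_add, map_add, add_smul])
    fun a z => by
      change envSwap k D (S.hat f (lft k a • z)) • (1 : D) =
        envSwap k D (S.hat f (rgt k a • z)) • (1 : D)
      rw [map_smul (S.hat f), map_smul (S.hat f), res_lft ι, res_rgt ι, smul_eq_mul, smul_eq_mul,
        envSwap_mul, envSwap_mul, mul_smul, mul_smul]
      congr 1
      change rgt k (ι a) • (1 : D) = lft k (ι a) • (1 : D)
      rw [rgt_smul_self, lft_smul_self, one_mul, mul_one]

theorem trace_mk (f : P →ₗ[Env k A] Env k D) (z : BTensor k A P U) :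
    S.trace f (Cyc.mk k A z) = envSwap k D (S.hat f z) • (1 : D) := rfl

theorem trace_mk_btmul (f : P →ₗ[Env k A] Env k D) (p : P) (u : U) :
    S.trace f (Cyc.mk k A (btmul k A p u)) = envSwap k D (f p) • S.j u := by
  rw [trace_mk, hat_btmul, smul_eq_mul, envSwap_mul, mul_smul]
  congr 1
  change lft k (S.j u) • (1 : D) = S.j u
  rw [lft_smul_self, mul_one]

theorem trace_map {P' : Type u} [AddCommGroup P'] [Module (Env k A) P']
    (f : P →ₗ[Env k A] Env k D) (d : P' →ₗ[Env k A] P) (c : Cyc k A (BTensor k A P' U)) :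
    S.trace f (Cyc.map (BTensor.mapLeft U d) c) = S.trace (f ∘ₗ d) c := by
  obtain ⟨z, rfl⟩ := Cyc.mk_surjective k A c
  rw [Cyc.map_mk, trace_mk, trace_mk, hat_mapLeft]

theorem trace_zero (c : Cyc k A (BTensor k A P U)) :
    S.trace (0 : P →ₗ[Env k A] Env k D) c = 0 := by
  refine DFunLike.congr_fun (Cyc.hom_ext_btmul (g := 0) fun p u => ?_) c
  rw [trace_mk_btmul, LinearMap.zero_apply, map_zero]
  exact zero_smul (Env k D) (S.j u)

/-- The trace of the conjugate. -/
theorem trace_gamma (σ : BTensor k A U P →ₗ[Env k A] BTensor k A P U) (f : P →ₗ[Env k A] Env k D)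
    (c : Cyc k A (BTensor k A U P)) :
    S.trace (S.gamma σ f) (Cyc.rot k A U P c) = S.trace f (Cyc.map σ c) := by
  refine DFunLike.congr_fun (Cyc.hom_ext_btmul
    (f := (S.trace (S.gamma σ f)).comp (Cyc.rot k A U P))
    (g := (S.trace f).comp (Cyc.map σ)) fun u p => ?_) c
  change S.trace (S.gamma σ f) (Cyc.mk k A (btmul k A p u)) =
    envSwap k D (S.hat f (σ (btmul k A u p))) • (1 : D)
  conv_rhs => rw [← S.sum_lft_x u]
  let φ : U →+ Env k D := ((S.hat f).toAddMonoidHom.comp σ.toAddMonoidHom).comp (btmulHom.flip p)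
  have hφ : S.hat f (σ (btmul k A (∑ i, lft k (S.E (S.j u * S.y i)) • S.x i) p)) =
      ∑ i, lft k (S.j u * S.y i) * S.hat f (σ (btmul k A (S.x i) p)) := by
    refine (map_sum φ _ _).trans (Finset.sum_congr rfl fun m _ => ?_)
    change S.hat f (σ (btmul k A (lft k _ • S.x m) p)) = _
    rw [← lft_smul_btmul, map_smul, map_smul, res_lft ι, S.j_mul_y, smul_eq_mul]
  rw [hφ, trace_mk_btmul, gamma_apply, map_sum, map_sum, Finset.sum_smul, Finset.sum_smul]
  refine Finset.sum_congr rfl fun i _ => ?_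
  rw [smul_eq_mul, envSwap_mul, envSwap_mul, mul_smul, mul_smul]
  congr 1
  change rgt k (S.y i) • S.j u = rgt k (S.j u * S.y i) • (1 : D)
  rw [rgt_smul_self, rgt_smul_self, one_mul]

end Trace

section Components

variable [Module (Env k A) (Env k D)] [IsRestriction ι (Env k D)]

/-- The projection `x ⊗ y ↦ pr_b(x) ⊗ y`. -/
def prL (b : ZMod l) : Env k D →ₗ[Env k A] Env k D :=
  bimoduleHom (TensorProduct.map (S.pr b) LinearMap.id).toAddMonoidHom
    (fun a e => by
      rw [res_lft ι, res_lft ι, smul_eq_mul, smul_eq_mul]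
      induction e using TensorProduct.induction_on with
      | zero => simp
      | tmul x y =>
        change TensorProduct.map (S.pr b) LinearMap.id (lft k (ι a) * x ⊗ₜ y) =
          lft k (ι a) * TensorProduct.map (S.pr b) LinearMap.id (x ⊗ₜ y)
        simp only [Algebra.TensorProduct.tmul_mul_tmul, TensorProduct.map_tmul, S.pr_mul_left,
          LinearMap.id_apply]
      | add x y hx hy => rw [mul_add, map_add, map_add, mul_add, hx, hy])
    (fun a e => by
      rw [res_rgt ι, res_rgt ι, smul_eq_mul, smul_eq_mul]
      induction e using TensorProduct.induction_on with
      | zero => simp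
      | tmul x y =>
        change TensorProduct.map (S.pr b) LinearMap.id (rgt k (ι a) * x ⊗ₜ y) =
          rgt k (ι a) * TensorProduct.map (S.pr b) LinearMap.id (x ⊗ₜ y)
        simp only [Algebra.TensorProduct.tmul_mul_tmul, TensorProduct.map_tmul, one_mul,
          LinearMap.id_apply]
      | add x y hx hy => rw [mul_add, map_add, map_add, mul_add, hx, hy])

theorem prL_tmul (b : ZMod l) (x : D) (y : Dᵐᵒᵖ) : S.prL b (x ⊗ₜ y) = S.pr b x ⊗ₜ y := rfl

theorem sum_prL (e : Env k D) : ∑ b, S.prL b e = e := by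
  induction e using TensorProduct.induction_on with
  | zero => simp
  | tmul x y => simp only [prL_tmul, ← TensorProduct.sum_tmul, S.sum_pr]
  | add x y hx hy => simp only [map_add, Finset.sum_add_distrib, hx, hy]

theorem prL_rgt_mul (b : ZMod l) (x : D) (e : Env k D) :
    S.prL b (rgt k x * e) = rgt k x * S.prL b e := by
  induction e using TensorProduct.induction_on with
  | zero => simp
  | tmul z w => simp only [Algebra.TensorProduct.tmul_mul_tmul, prL_tmul, one_mul]
  | add x y hx hy => rw [mul_add, map_add, map_add, mul_add, hx, hy]

theorem prL_y_mul (b : ZMod l) (i : I) (e : Env k D) :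
    S.prL b (lft k (S.y i) * e) = lft k (S.y i) * S.prL (b + 1) e := by
  induction e using TensorProduct.induction_on with
  | zero => simp
  | tmul z w => simp only [Algebra.TensorProduct.tmul_mul_tmul, prL_tmul, S.pr_y_mul]
  | add x y hx hy => rw [mul_add, map_add, map_add, mul_add, hx, hy]

variable {P : Type u} [AddCommGroup P] [Module (Env k A) P]

theorem prL_gamma (σ : BTensor k A U P →ₗ[Env k A] BTensor k A P U) (f : P →ₗ[Env k A] Env k D)
    (b : ZMod l) : S.prL b ∘ₗ S.gamma σ f = S.gamma σ (S.prL (b + 1) ∘ₗ f) := by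
  have h : ∀ z, S.prL (b + 1) (S.hat f z) = S.hat (S.prL (b + 1) ∘ₗ f) z := fun z =>
    DFunLike.congr_fun (BTensor.linearMap_ext (f := S.prL (b + 1) ∘ₗ S.hat f)
      (g := S.hat (S.prL (b + 1) ∘ₗ f)) fun p u => S.prL_rgt_mul _ _ _) z
  ext p
  simp only [LinearMap.comp_apply, gamma_apply, map_sum, smul_eq_mul, prL_y_mul, h]

/-- The value of a form in degree zero of the left factor is determined by its coordinates. -/
theorem sum_coord_one (e : Env k D) :
    ∑ t, S.coord 1 (S.Y t) e • (rgt k (S.X t) : Env k D) = S.prL 0 e := by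
  induction e using TensorProduct.induction_on with
  | zero =>
    rw [map_zero]
    refine Finset.sum_eq_zero fun t _ => ?_
    rw [map_zero]
    exact zero_smul (Env k A) (rgt k (S.X t))
  | tmul x y =>
    induction y using MulOpposite.rec' with | _ y
    have h : ∀ t, S.coord 1 (S.Y t) (x ⊗ₜ op y) • (rgt k (S.X t) : Env k D) =
        ι (S.E x) ⊗ₜ op (S.X t * ι (S.E (S.Y t * y))) := fun t => by
      rw [FrobeniusSystem.coord_tmul, IsRestriction.smul_eq (ι := ι), envMap_tmul, smul_eq_mul,
        Algebra.TensorProduct.tmul_mul_tmul, ← op_mul, mul_one, mul_one]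
    simp only [h, ← TensorProduct.tmul_sum, ← Finset.op_sum, S.sum_left, prL_tmul, S.pr_zero]
  | add x y hx hy =>
    rw [map_add, ← hx, ← hy, ← Finset.sum_add_distrib]
    exact Finset.sum_congr rfl fun t _ => by rw [map_add, add_smul]

theorem j_swap_coord (e : Env k D) (z : D) (u : U) :
    S.j (envSwap k A (S.coord 1 z e) • u) =
      S.pr 1 (z * (envSwap k D (S.prL 0 e) • S.j u)) := by
  induction e using TensorProduct.induction_on with
  | zero =>
    simp only [map_zero]
    rw [zero_smul (Env k A) u, zero_smul (Env k D) (S.j u), mul_zero, map_zero, map_zero]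
  | tmul x y =>
    induction y using MulOpposite.rec' with | _ y
    rw [FrobeniusSystem.coord_tmul, prL_tmul, envSwap_tmul, envSwap_tmul, tmul_smul_self,
      tmul_eq_lft_mul_rgt, mul_smul, S.j_lft, S.j_rgt, S.pr_zero, mul_one, ← mul_assoc z,
      ← mul_assoc z, S.pr_one_mul_right, S.pr_one_mul_j, mul_assoc]
  | add x y hx hy => simp only [map_add, add_smul, mul_add, hx, hy]

end Components

end GradedFrobeniusSystem

namespace FrobeniusSystem

variable {k : Type v} {A D : Type u} [CommRing k] [Ring A] [Ring D] [Algebra k A] [Algebra k D]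
  {ι : A →ₐ[k] D} {l : ℕ} {T : Type*} [Fintype T] (S : FrobeniusSystem ι l T)

section ActRight

variable (ι) {P N : Type u} [AddCommGroup P] [Module (Env k A) P] [AddCommGroup N]
  [Module (Env k A) N] [Module (Env k D) N] [IsRestriction ι N] [Module (Env k A) D]
  [IsRestriction ι D]

/-- The map `x ⊗ z ↦ f(x) z`. -/
def actRight (f : P →ₗ[Env k A] N) : BTensor k A P D →ₗ[Env k A] N :=
  BTensor.liftHom (AddMonoidHom.mk' (fun p => AddMonoidHom.mk' (fun z => rgt k z • f p)
      (fun z z' => by rw [rgt_add, add_smul]))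
      (fun p p' => by
        ext z
        change rgt k z • f (p + p') = rgt k z • f p + rgt k z • f p'
        rw [map_add, smul_add]))
    (fun p a z => by
      change rgt k z • f (rgt k a • p) = rgt k (lft k a • z) • f p
      rw [map_smul, res_rgt ι, res_lft ι, lft_smul_self, rgt_mul_smul])
    (fun a p z => by
      change rgt k z • f (lft k a • p) = lft k a • rgt k z • f p
      rw [map_smul, res_lft ι, res_lft ι, rgt_lft_comm])
    (fun a p z => by
      change rgt k (rgt k a • z) • f p = rgt k a • rgt k z • f p
      rw [res_rgt (N := D) ι, rgt_smul_self, rgt_mul_smul, res_rgt ι])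

theorem actRight_btmul (f : P →ₗ[Env k A] N) (p : P) (z : D) :
    actRight ι f (btmul k A p z) = rgt k z • f p := rfl

end ActRight

section EnvIota

variable [Module (Env k A) (Env k D)] [IsRestriction ι (Env k D)]

variable (ι) in
/-- The ring homomorphism of enveloping algebras as a map of bimodules. -/
def envIota : Env k A →ₗ[Env k A] Env k D where
  toFun := envMap ι
  map_add' := map_add _
  map_smul' e x := by
    rw [smul_eq_mul, map_mul, RingHom.id_apply, IsRestriction.smul_eq (ι := ι), smul_eq_mul]

theorem envIota_apply (e : Env k A) : envIota ι e = envMap ι e := rfl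

variable {P : Type u} [AddCommGroup P] [Module (Env k A) P] [Module (Env k A) D]
  [IsRestriction ι D]

/-- The map `x ↦ ∑ g(x ⊗ X) Y`. -/
def contract (g : BTensor k A P D →ₗ[Env k A] Env k A) : P →ₗ[Env k A] Env k D :=
  bimoduleHom (AddMonoidHom.mk'
      (fun x => ∑ s, rgt k (S.Y s) * envMap ι (g (btmul k A x (S.X s))))
      (fun x x' => by simp only [add_btmul, map_add, mul_add, Finset.sum_add_distrib]))
    (fun a x => by
      change ∑ s, rgt k (S.Y s) * envMap ι (g (btmul k A (lft k a • x) (S.X s))) =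
        lft k a • ∑ s, rgt k (S.Y s) * envMap ι (g (btmul k A x (S.X s)))
      rw [Finset.smul_sum]
      refine Finset.sum_congr rfl fun s _ => ?_
      rw [← lft_smul_btmul, map_smul g, smul_eq_mul, map_mul, envMap_lft, res_lft ι, smul_eq_mul,
        ← mul_assoc, ← mul_assoc, commute_lft_rgt])
    (fun a x => by
      change ∑ s, rgt k (S.Y s) * envMap ι (g (btmul k A (rgt k a • x) (S.X s))) =
        rgt k a • ∑ s, rgt k (S.Y s) * envMap ι (g (btmul k A x (S.X s)))
      have h : ∀ s, g (btmul k A (rgt k a • x) (S.X s)) =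
          ∑ t, rgt k (S.E (S.Y t * ι a * S.X s)) * g (btmul k A x (S.X t)) := fun s => by
        rw [rgt_btmul, res_lft ι, lft_smul_self]
        conv_lhs => rw [← S.sum_left (ι a * S.X s)]
        let ψ : D →+ Env k A := g.toAddMonoidHom.comp (btmulHom x)
        refine (map_sum ψ _ _).trans (Finset.sum_congr rfl fun t _ => ?_)
        change g (btmul k A x (S.X t * ι (S.E (S.Y t * (ι a * S.X s))))) = _
        rw [← rgt_smul_self k, ← res_rgt ι, ← rgt_smul_btmul, map_smul g, smul_eq_mul, mul_assoc]
      simp only [h, map_sum, Finset.mul_sum, Finset.smul_sum, map_mul, envMap_rgt]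
      rw [Finset.sum_comm]
      refine Finset.sum_congr rfl fun t _ => ?_
      simp only [← mul_assoc, ← rgt_mul]
      rw [← Finset.sum_mul, ← rgt_sum, S.sum_right, rgt_mul, res_rgt ι, smul_eq_mul, mul_assoc])

theorem contract_apply (g : BTensor k A P D →ₗ[Env k A] Env k A) (x : P) :
    S.contract g x = ∑ s, rgt k (S.Y s) * envMap ι (g (btmul k A x (S.X s))) := rfl

theorem contract_add (g g' : BTensor k A P D →ₗ[Env k A] Env k A) :
    S.contract (g + g') = S.contract g + S.contract g' := by
  ext x
  simp only [contract_apply, LinearMap.add_apply, map_add, mul_add, Finset.sum_add_distrib]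

theorem contract_comp_augRight (f : P →ₗ[Env k A] Env k A) :
    S.contract (f ∘ₗ BTensor.augRight P S.EHom) = envIota ι ∘ₗ f := by
  ext x
  rw [contract_apply, LinearMap.comp_apply, envIota_apply]
  have h : ∀ s, rgt k (S.Y s) *
      envMap ι ((f ∘ₗ BTensor.augRight P S.EHom) (btmul k A x (S.X s))) =
        rgt k (ι (S.E (1 * S.X s)) * S.Y s) * envMap ι (f x) := fun s => by
    rw [LinearMap.comp_apply, BTensor.augRight_btmul, map_smul f, smul_eq_mul, map_mul, envMap_rgt,
      EHom_apply, rgt_mul, one_mul, mul_assoc]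
  rw [Finset.sum_congr rfl fun s _ => h s, ← Finset.sum_mul, ← rgt_sum, S.sum_right]
  exact one_mul _

end EnvIota

end FrobeniusSystem

namespace GradedFrobeniusSystem

open FrobeniusSystem

variable {k : Type v} {A D : Type u} [CommRing k] [Ring A] [Ring D] [Algebra k A] [Algebra k D]
  {ι : A →ₐ[k] D} {l : ℕ} [NeZero l] {T : Type*} [Fintype T] {U : Type u} [AddCommGroup U]
  [Module (Env k A) U] {I : Type*} [Fintype I] (S : GradedFrobeniusSystem ι l T U I)

include S in
theorem projective_U : Module.Projective A (Along (lftRing k A) U) := by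
  refine projective_of_dualBasis (T := I) (N := Along (lftRing k A) U) (fun i =>
    { toFun := fun u => S.E (S.j u * S.y i)
      map_add' := fun u u' => by
        change S.E (S.j (show U from u + u') * S.y i) = _
        exact (by rw [map_add, add_mul, map_add] :
          S.E (S.j ((show U from u) + (show U from u')) * S.y i) = _)
      map_smul' := fun a u => by
        change S.E (S.j (lft k a • (show U from u)) * S.y i) = a * S.E (S.j u * S.y i)
        rw [S.j_lft, mul_assoc, S.E_mul_left] }) S.x fun u => S.sum_lft_x u

theorem hat_iota [Module (Env k A) D] [IsRestriction ι D] {Q : Type u} [AddCommGroup Q] [Module (Env k A) Q] (e : Q →ₗ[Env k A] A)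
    (z : BTensor k A Q U) : S.hat (iotaHom ι ∘ₗ e) z = S.j (BTensor.augLeft U e z) := by
  refine DFunLike.congr_fun (BTensor.hom_ext (f := (S.hat (iotaHom ι ∘ₗ e)).toAddMonoidHom)
    (g := S.j.comp (BTensor.augLeft U e).toAddMonoidHom) fun q u => ?_) z
  change rgt k (S.j u) • ι (e q) = S.j (lft k (e q) • u)
  rw [rgt_smul_self, S.j_lft]

variable [Module (Env k A) (Env k D)] [IsRestriction ι (Env k D)]

theorem trace_add {P : Type u} [AddCommGroup P] [Module (Env k A) P] (f g : P →ₗ[Env k A] Env k D)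
    (c : Cyc k A (BTensor k A P U)) : S.trace (f + g) c = S.trace f c + S.trace g c := by
  refine DFunLike.congr_fun (Cyc.hom_ext_btmul (f := S.trace (f + g))
    (g := S.trace f + S.trace g) fun p u => ?_) c
  rw [AddMonoidHom.add_apply, trace_mk_btmul, trace_mk_btmul, trace_mk_btmul, LinearMap.add_apply,
    map_add, add_smul]

/-- The trace as an additive map of the form. -/
def traceHom {P : Type u} [AddCommGroup P] [Module (Env k A) P] (c : Cyc k A (BTensor k A P U)) :
    (P →ₗ[Env k A] Env k D) →+ D := AddMonoidHom.mk' (fun f => S.trace f c)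
      fun f g => S.trace_add f g c

theorem prL_zero_mul_envMap (x y : D) (e : Env k A) :
    S.prL 0 (lft k x * (rgt k y * envMap ι e)) = lft k (ι (S.E x)) * (rgt k y * envMap ι e) := by
  induction e using TensorProduct.induction_on with
  | zero => simp
  | tmul a b =>
    induction b using MulOpposite.rec' with | _ b
    rw [envMap_tmul, Algebra.TensorProduct.tmul_mul_tmul, Algebra.TensorProduct.tmul_mul_tmul,
      Algebra.TensorProduct.tmul_mul_tmul, prL_tmul, S.pr_zero, one_mul, S.E_mul_right, map_mul]
  | add x y hx hy => simp only [map_add, mul_add, hx, hy]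

section Resolutions

variable {P R : ℕ → Type u} [∀ n, AddCommGroup (P n)] [∀ n, AddCommGroup (R n)]
  [∀ n, Module (Env k A) (P n)] [∀ n, Module (Env k A) (R n)] [∀ n, Module (Env k D) (R n)]
  [∀ n, IsRestriction ι (R n)]
  {d : ∀ n, P (n + 1) →ₗ[Env k A] P n} {ε : P 0 →ₗ[Env k A] A}
  {dR : ∀ n, R (n + 1) →ₗ[Env k D] R n} {εR : R 0 →ₗ[Env k D] D}

theorem trace_rot_eq_zero {n : ℕ} {c : Cyc k A (BTensor k A U (P n))} (hc : IsCycCycle d U n c)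
    {f : P n →ₗ[Env k A] Env k D} (hf : f ∈ coboundaries (Env k D) d n) :
    S.trace f (Cyc.rot k A U (P n) c) = 0 := by
  cases n with
  | zero =>
    obtain rfl : f = 0 := hf
    exact S.trace_zero _
  | succ n =>
    obtain ⟨g, hg⟩ := mem_coboundaries_succ.1 hf
    obtain rfl : g ∘ₗ d n = f := LinearMap.ext hg
    rw [← trace_map, ← Cyc.rot_mapRight, show Cyc.map (BTensor.mapRight U (d n)) c = 0 from hc,
      map_zero, map_zero]

theorem trace_rot_eq {n : ℕ} {c : Cyc k A (BTensor k A U (P n))} (hc : IsCycCycle d U n c)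
    {f g : P n →ₗ[Env k A] Env k D} (hfg : f - g ∈ coboundaries (Env k D) d n) :
    S.trace f (Cyc.rot k A U (P n) c) = S.trace g (Cyc.rot k A U (P n) c) := by
  rw [← sub_eq_zero]
  exact (map_sub (S.traceHom (Cyc.rot k A U (P n) c)) f g).symm.trans
    (S.trace_rot_eq_zero hc hfg)

section Sigma

variable {σ : ∀ n, BTensor k A U (P n) →ₗ[Env k A] BTensor k A (P n) U}
  (hσ : IsChainMap (P := fun n => BTensor k A U (P n)) (Q := fun n => BTensor k A (P n) U)
    (fun n => BTensor.mapRight U (d n)) (fun n => BTensor.mapLeft U (d n)) σ)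
  (hσε : ∀ x, BTensor.augLeft U ε (σ 0 x) = BTensor.augRight U ε x)

include hσ in
theorem gamma_mem_coboundaries {n : ℕ} {f : P n →ₗ[Env k A] Env k D}
    (hf : f ∈ coboundaries (Env k D) d n) :
    S.gamma (σ n) f ∈ coboundaries (Env k D) d n := by
  let Φ : ∀ n, (P n →ₗ[Env k A] Env k D) →+ (P n →ₗ[Env k A] Env k D) := fun n =>
    AddMonoidHom.mk' (M := P n →ₗ[Env k A] Env k D) (G := P n →ₗ[Env k A] Env k D)
      (fun f => S.gamma (σ n) f) (S.gamma_add (σ n))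
  exact map_mem_coboundaries (d' := d) Φ
    (fun n g => S.gamma_comp (σ n) (σ (n + 1)) (d n) (hσ n) g) hf

include hσ hσε in
theorem trace_gamma_rot [Module.Projective k A] [∀ n, Module.Projective (Env k A) (P n)]
    (hP : IsResolution d ε) {n : ℕ} {c : Cyc k A (BTensor k A U (P n))} (hc : IsCycCycle d U n c)
    {f : P n →ₗ[Env k A] Env k D} (hf : IsCocycle d f) :
    S.trace (S.gamma (σ n) f) (Cyc.rot k A U (P n) c) = S.trace f (Cyc.rot k A U (P n) c) := by
  have := S.projective_U
  obtain ⟨b, hb⟩ := rotationProperty hP n U σ hσ hσε c hc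
  have h0 : f ∘ₗ d n = 0 := LinearMap.ext hf
  rw [trace_gamma, ← sub_eq_zero, ← map_sub, ← hb, trace_map, h0, trace_zero]

variable [Module (Env k A) D] [IsRestriction ι D]

variable {i : ∀ n, P n →ₗ[Env k A] R n} (hi : IsChainMap d (fun n => resHom ι (dR n)) i)
  (hiε : ∀ x, εR (i 0 x) = ι (ε x))

include hσ hσε hi hiε in
theorem gamma_sub_mem_coboundaries [∀ n, Module.Projective (Env k A) (P n)]
    (hP : IsAugmented d ε) (hR : IsResolution dR εR) {n : ℕ} {F : R n →ₗ[Env k D] Env k D}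
    (hF : IsCocycle dR F) :
    S.gamma (σ n) (resHom ι F ∘ₗ i n) - resHom ι F ∘ₗ i n ∈ coboundaries (Env k D) d n := by
  rw [← comp_gamma]
  refine comp_sub_comp_mem_coboundaries hP (isResolution_resHom hR)
    (F := fun n => S.gamma (σ n) (i n)) (G := i) (fun n x => ?_) hi (fun x => ?_) (fun x => hF x)
  · have h : resHom ι (dR n) ∘ₗ i (n + 1) = i n ∘ₗ d n := LinearMap.ext (hi n)
    change (resHom ι (dR n) ∘ₗ S.gamma (σ (n + 1)) (i (n + 1))) x = _
    rw [comp_gamma, h, S.gamma_comp (σ n) (σ (n + 1)) (d n) (hσ n)]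
    rfl
  · have h : resHom ι εR ∘ₗ i 0 = iotaHom ι ∘ₗ ε := LinearMap.ext hiε
    change (resHom ι εR ∘ₗ S.gamma (σ 0) (i 0)) x = (resHom ι εR ∘ₗ i 0) x
    rw [comp_gamma, h, gamma_apply]
    simp only [hat_iota, hσε, BTensor.augRight_btmul, S.j_rgt, lft_smul_self, ← mul_assoc]
    rw [← Finset.sum_mul, S.sum_y_x, one_mul]
    rfl

end Sigma

end Resolutions

end GradedFrobeniusSystem

namespace GradedFrobeniusSystem

open FrobeniusSystem

variable {k : Type v} {A D : Type u} [CommRing k] [Ring A] [Ring D] [Algebra k A] [Algebra k D]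
  {ι : A →ₐ[k] D} {l : ℕ} [NeZero l] {T : Type*} [Fintype T] {U : Type u} [AddCommGroup U]
  [Module (Env k A) U] {I : Type*} [Fintype I] (S : GradedFrobeniusSystem ι l T U I)

theorem j_swap (e : Env k A) (u : U) :
    S.j (envSwap k A e • u) = envSwap k D (envMap ι e) • S.j u := by
  induction e using TensorProduct.induction_on with
  | zero =>
    simp only [map_zero]
    rw [zero_smul (Env k A) u, zero_smul (Env k D) (S.j u), map_zero]
  | tmul a b =>
    induction b using MulOpposite.rec' with | _ b
    rw [envMap_tmul, envSwap_tmul, envSwap_tmul, tmul_smul_self, tmul_eq_lft_mul_rgt, mul_smul,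
      S.j_lft, S.j_rgt, mul_assoc]
  | add x y hx hy => simp only [map_add, add_smul, hx, hy]

section Cocycles

variable [Module (Env k A) (Env k D)] [IsRestriction ι (Env k D)] {P R : ℕ → Type u}
  [∀ n, AddCommGroup (P n)] [∀ n, AddCommGroup (R n)]
  [∀ n, Module (Env k A) (P n)] [∀ n, Module (Env k A) (R n)] [∀ n, Module (Env k D) (R n)]
  [∀ n, IsRestriction ι (R n)] {d : ∀ n, P (n + 1) →ₗ[Env k A] P n}
  {dR : ∀ n, R (n + 1) →ₗ[Env k D] R n}

theorem isCocycle_comp {i : ∀ n, P n →ₗ[Env k A] R n}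
    (hi : IsChainMap d (fun n => resHom ι (dR n)) i) {n : ℕ} {F : R n →ₗ[Env k D] Env k D}
    (hF : IsCocycle dR F) {N : Type u} [AddCommGroup N] [Module (Env k A) N]
    (g : Env k D →ₗ[Env k A] N) : IsCocycle d (g ∘ₗ resHom ι F ∘ₗ i n) := fun x => by
  have h := hF (i (n + 1) x)
  rw [LinearMap.comp_apply, LinearMap.comp_apply, ← hi n x, resHom_apply, resHom_apply, h, map_zero]

theorem isCocycle_av {q : ∀ n, R n →ₗ[Env k A] P n}
    (hq : IsChainMap (fun n => resHom ι (dR n)) d q) {n : ℕ} {f : P n →ₗ[Env k A] Env k A} (hf : IsCocycle d f) :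
    IsCocycle dR (S.av (envIota ι ∘ₗ f ∘ₗ q n)) := fun x => by
  have h : (envIota ι ∘ₗ f ∘ₗ q n) ∘ₗ resHom ι (dR n) = 0 := LinearMap.ext fun y => by
    have := hq n y
    rw [LinearMap.comp_apply, LinearMap.comp_apply, LinearMap.comp_apply, ← this, hf, map_zero]
    rfl
  rw [av_comp, h, av_apply]
  simp

end Cocycles

section Components

variable [Module (Env k A) (Env k D)] [IsRestriction ι (Env k D)] [Module (Env k A) D]
  [IsRestriction ι D] {P R : ℕ → Type u} [∀ n, AddCommGroup (P n)] [∀ n, AddCommGroup (R n)]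
  [∀ n, Module (Env k A) (P n)] [∀ n, Module (Env k A) (R n)] [∀ n, Module (Env k D) (R n)]
  [∀ n, IsRestriction ι (R n)] [∀ n, Module.Projective (Env k A) (P n)]
  {d : ∀ n, P (n + 1) →ₗ[Env k A] P n} {ε : P 0 →ₗ[Env k A] A}
  {dR : ∀ n, R (n + 1) →ₗ[Env k D] R n} {εR : R 0 →ₗ[Env k D] D}
  {σ : ∀ n, BTensor k A U (P n) →ₗ[Env k A] BTensor k A (P n) U}
  (hσ : IsChainMap (P := fun n => BTensor k A U (P n)) (Q := fun n => BTensor k A (P n) U)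
    (fun n => BTensor.mapRight U (d n)) (fun n => BTensor.mapLeft U (d n)) σ)
  (hσε : ∀ x, BTensor.augLeft U ε (σ 0 x) = BTensor.augRight U ε x)
  {i : ∀ n, P n →ₗ[Env k A] R n} (hi : IsChainMap d (fun n => resHom ι (dR n)) i)
  (hiε : ∀ x, εR (i 0 x) = ι (ε x)) (hR : IsResolution dR εR) {n : ℕ}
  {F : R n →ₗ[Env k D] Env k D} (hF : IsCocycle dR F)

include hσ hσε hi hiε hR hF in
theorem gamma_prL_sub_mem_coboundaries (hP : IsAugmented d ε) (b : ZMod l) :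
    S.gamma (σ n) (S.prL (b + 1) ∘ₗ resHom ι F ∘ₗ i n) - S.prL b ∘ₗ resHom ι F ∘ₗ i n ∈
      coboundaries (Env k D) d n := by
  rw [← prL_gamma, ← LinearMap.comp_sub]
  exact comp_mem_coboundaries _ (S.gamma_sub_mem_coboundaries hσ hσε hi hiε hP hR hF)

include hσ hσε hi hiε hR hF in
theorem prL_mem_coboundaries (hP : IsAugmented d ε)
    (h : S.prL 0 ∘ₗ resHom ι F ∘ₗ i n ∈ coboundaries (Env k D) d n) (m : ℕ) :
    S.prL (-m) ∘ₗ resHom ι F ∘ₗ i n ∈ coboundaries (Env k D) d n := by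
  induction m with
  | zero => simpa using h
  | succ m ih =>
    have h1 := S.gamma_prL_sub_mem_coboundaries hσ hσε hi hiε hR hF hP (-(m + 1 : ℕ))
    have h2 : (-(m + 1 : ℕ) + 1 : ZMod l) = -m := by push_cast; ring
    rw [h2] at h1
    have h3 := sub_mem (S.gamma_mem_coboundaries hσ ih) h1
    exact (sub_sub_cancel (S.gamma (σ n) (S.prL (-m) ∘ₗ resHom ι F ∘ₗ i n))
      (S.prL (-(m + 1 : ℕ)) ∘ₗ resHom ι F ∘ₗ i n)) ▸ h3

include hσ hσε hi hiε hR hF in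
theorem mem_coboundaries_of_prL_zero (hP : IsAugmented d ε)
    (h : S.prL 0 ∘ₗ resHom ι F ∘ₗ i n ∈ coboundaries (Env k D) d n) :
    resHom ι F ∘ₗ i n ∈ coboundaries (Env k D) d n := by
  have h1 : resHom ι F ∘ₗ i n = ∑ b, S.prL b ∘ₗ resHom ι F ∘ₗ i n := by
    ext x
    rw [LinearMap.sum_apply]
    exact (S.sum_prL _).symm
  rw [h1]
  refine sum_mem fun b _ => ?_
  have h2 := S.prL_mem_coboundaries hσ hσε hi hiε hR hF hP h (-b).val
  rwa [ZMod.natCast_zmod_val, neg_neg] at h2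

include hσ hσε hi hiε hR hF in
theorem trace_prL_rot [Module.Projective k A] (hP : IsResolution d ε)
    {c : Cyc k A (BTensor k A U (P n))} (hc : IsCycCycle d U n c) (m : ℕ) :
    S.trace (S.prL m ∘ₗ resHom ι F ∘ₗ i n) (Cyc.rot k A U (P n) c) =
      S.trace (S.prL 0 ∘ₗ resHom ι F ∘ₗ i n) (Cyc.rot k A U (P n) c) := by
  induction m with
  | zero => rw [Nat.cast_zero]
  | succ m ih =>
    rw [← ih, Nat.cast_succ, ← S.trace_gamma_rot hσ hσε hP hc (isCocycle_comp hi hF _)]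
    exact S.trace_rot_eq hc
      (S.gamma_prL_sub_mem_coboundaries hσ hσε hi hiε hR hF hP.toIsAugmented m)

include hσ hσε hi hiε hR hF in
theorem trace_rot_eq_smul [Module.Projective k A] (hP : IsResolution d ε)
    {c : Cyc k A (BTensor k A U (P n))} (hc : IsCycCycle d U n c) :
    S.trace (resHom ι F ∘ₗ i n) (Cyc.rot k A U (P n) c) =
      l • S.trace (S.prL 0 ∘ₗ resHom ι F ∘ₗ i n) (Cyc.rot k A U (P n) c) := by
  have h1 : resHom ι F ∘ₗ i n = ∑ b, S.prL b ∘ₗ resHom ι F ∘ₗ i n := by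
    ext x
    rw [LinearMap.sum_apply]
    exact (S.sum_prL _).symm
  have h2 : ∀ b : ZMod l, S.trace (S.prL b ∘ₗ resHom ι F ∘ₗ i n) (Cyc.rot k A U (P n) c) =
      S.trace (S.prL 0 ∘ₗ resHom ι F ∘ₗ i n) (Cyc.rot k A U (P n) c) := fun b => by
    rw [← S.trace_prL_rot hσ hσε hi hiε hR hF hP hc b.val, ZMod.natCast_zmod_val]
  conv_lhs => rw [h1]
  refine (map_sum (S.traceHom (Cyc.rot k A U (P n) c)) _ _).trans ?_
  refine (Finset.sum_congr rfl fun b _ => h2 b).trans ?_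
  rw [Finset.sum_const, Finset.card_univ, ZMod.card]

end Components

section FundamentalClass

variable [Module (Env k A) (Env k D)] [IsRestriction ι (Env k D)] {P : ℕ → Type u}
  [∀ n, AddCommGroup (P n)] [∀ n, Module (Env k A) (P n)]
  {d : ∀ n, P (n + 1) →ₗ[Env k A] P n} {n : ℕ} {cls : cocycles d n →ₗ[Env k A] U}
  {m : ℕ} {t : Fin m → U} {p : Fin m → P n}

theorem trace_rot_sum (f : P n →ₗ[Env k A] Env k D) :
    S.trace f (Cyc.rot k A U (P n) (∑ s, Cyc.mk k A (btmul k A (t s) (p s)))) =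
      ∑ s, envSwap k D (f (p s)) • S.j (t s) := by
  rw [map_sum, map_sum]
  exact Finset.sum_congr rfl fun s _ => S.trace_mk_btmul f (p s) (t s)

variable (hfc : ∀ z : cocycles d n, ∑ s, envSwap k A (z.1 (p s)) • t s = cls z)

include hfc in
theorem prL_zero_mem_coboundaries (hcls : IsClassMap cls) {f : P n →ₗ[Env k A] Env k D}
    (hf : IsCocycle d f)
    (h : S.trace (S.prL 0 ∘ₗ f)
      (Cyc.rot k A U (P n) (∑ s, Cyc.mk k A (btmul k A (t s) (p s)))) = 0) :
    S.prL 0 ∘ₗ f ∈ coboundaries (Env k D) d n := by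
  have h1 : ∀ r, S.coord 1 (S.Y r) ∘ₗ f ∈ coboundaries (Env k A) d n := fun r => by
    let z : cocycles d n := ⟨(show EnvDual k A (P n) from S.coord 1 (S.Y r) ∘ₗ f),
      mem_cocycles.2 fun x => by
        change S.coord 1 (S.Y r) (f (d n x)) = 0
        rw [hf x, map_zero]⟩
    refine (hcls.eq_zero_iff z).1 (S.j_injective ?_)
    rw [← hfc, map_sum, map_zero]
    have h2 : ∀ s, S.j (envSwap k A (z.1 (p s)) • t s) =
        S.pr 1 (S.Y r * (envSwap k D ((S.prL 0 ∘ₗ f) (p s)) • S.j (t s))) := fun s =>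
      S.j_swap_coord (f (p s)) (S.Y r) (t s)
    rw [Finset.sum_congr rfl fun s _ => h2 s, ← map_sum, ← Finset.mul_sum, ← trace_rot_sum, h,
      mul_zero, map_zero]
  have h3 : S.prL 0 ∘ₗ f = ∑ r, LinearMap.toSpanSingleton (Env k A) (Env k D) (rgt k (S.X r)) ∘ₗ
      (S.coord 1 (S.Y r) ∘ₗ f) := by
    ext x
    rw [LinearMap.sum_apply]
    exact (S.sum_coord_one (f x)).symm
  rw [h3]
  exact sum_mem fun r _ => comp_mem_coboundaries _ (h1 r)

include hfc in
theorem trace_envIota (z : cocycles d n) :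
    S.trace (envIota ι ∘ₗ (show P n →ₗ[Env k A] Env k A from z.1))
      (Cyc.rot k A U (P n) (∑ s, Cyc.mk k A (btmul k A (t s) (p s)))) = S.j (cls z) := by
  rw [trace_rot_sum, ← hfc, map_sum]
  exact Finset.sum_congr rfl fun s _ => (S.j_swap _ _).symm

end FundamentalClass

section Transfer

variable [Module (Env k A) (Env k D)] [IsRestriction ι (Env k D)] [Module (Env k A) D]
  [IsRestriction ι D] {P R : ℕ → Type u} [∀ n, AddCommGroup (P n)] [∀ n, AddCommGroup (R n)]
  [∀ n, Module (Env k A) (P n)] [∀ n, Module (Env k A) (R n)] [∀ n, Module (Env k D) (R n)]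
  [∀ n, IsRestriction ι (R n)]
  {d : ∀ n, P (n + 1) →ₗ[Env k A] P n} {ε : P 0 →ₗ[Env k A] A}
  {dR : ∀ n, R (n + 1) →ₗ[Env k D] R n} {εR : R 0 →ₗ[Env k D] D}
  {i : ∀ n, P n →ₗ[Env k A] R n} (hi : IsChainMap d (fun n => resHom ι (dR n)) i)
  (hiε : ∀ x, εR (i 0 x) = ι (ε x)) {q : ∀ n, R n →ₗ[Env k A] P n}
  (hq : IsChainMap (fun n => resHom ι (dR n)) d q) (hqε : ∀ x, ε (q 0 x) = S.E (εR x))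

theorem prL_zero_av_comp {n : ℕ} (f : P n →ₗ[Env k A] Env k A) :
    S.prL 0 ∘ₗ resHom ι (S.av (envIota ι ∘ₗ f ∘ₗ q n)) ∘ₗ i n =
      S.contract (f ∘ₗ q n ∘ₗ actRight ι (i n)) := by
  ext x
  rw [LinearMap.comp_apply, LinearMap.comp_apply, resHom_apply, av_apply, contract_apply]
  simp only [map_sum, smul_eq_mul, Finset.mul_sum, LinearMap.comp_apply, envIota_apply,
    prL_zero_mul_envMap]
  rw [Finset.sum_comm]
  refine Finset.sum_congr rfl fun s _ => ?_
  rw [actRight_btmul]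
  have h : ∀ r, lft k (ι (S.E (S.X r))) * (rgt k (S.Y s) *
      envMap ι (f (q n (rgt k (S.X s) • lft k (S.Y r) • i n x)))) =
      rgt k (S.Y s) * envMap ι (f (q n (rgt k (S.X s) •
        lft k (ι (S.E (1 * S.X r)) * S.Y r) • i n x))) := fun r => by
    rw [lft_mul_smul, rgt_lft_comm _ (ι _), ← res_lft ι, map_smul (q n), map_smul f, smul_eq_mul,
      map_mul, envMap_lft, one_mul, ← mul_assoc, ← mul_assoc,
      commute_lft_rgt]
  rw [Finset.sum_congr rfl fun r _ => h r, ← Finset.mul_sum, ← map_sum, ← map_sum, ← map_sum,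
    ← Finset.smul_sum, ← Finset.sum_smul, ← lft_sum, S.sum_right, lft_one_smul]

include hi hiε hq hqε in
theorem prL_zero_av_sub_mem_coboundaries [∀ n, Module.Projective (Env k A) (P n)]
    (hP : IsResolution d ε) {n : ℕ}
    {f : P n →ₗ[Env k A] Env k A} (hf : IsCocycle d f) :
    S.prL 0 ∘ₗ resHom ι (S.av (envIota ι ∘ₗ f ∘ₗ q n)) ∘ₗ i n - envIota ι ∘ₗ f ∈
      coboundaries (Env k D) d n := by
  rw [prL_zero_av_comp, ← S.contract_comp_augRight f]
  have := S.projective_right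
  have hproj : ∀ n, Module.Projective (Env k A) (BTensor k A (P n) D) := fun n =>
    projective_btensor_right
  have h := comp_sub_comp_mem_coboundaries (P := fun n => BTensor k A (P n) D)
    (dP := fun n => BTensor.mapLeft D (d n)) (εP := BTensor.augLeft D ε)
    (hP.toIsAugmented.mapLeft D) hP
    (F := fun n => q n ∘ₗ actRight ι (i n)) (G := fun n => BTensor.augRight (P n) S.EHom)
    (fun n z => ?_) (fun n z => ?_) (fun z => ?_) hf
  · let Φ : ∀ n, (BTensor k A (P n) D →ₗ[Env k A] Env k A) →+ (P n →ₗ[Env k A] Env k D) := fun n =>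
      AddMonoidHom.mk' (M := BTensor k A (P n) D →ₗ[Env k A] Env k A)
        (G := P n →ₗ[Env k A] Env k D) (fun g => S.contract g) S.contract_add
    have h' := map_mem_coboundaries (P := fun n => BTensor k A (P n) D) (d' := d) Φ
      (fun n g => rfl) h
    exact (map_sub (Φ n) _ _) ▸ h'
  · induction z using BTensor.induction with
    | zero => simp only [map_zero]
    | tmul x z =>
      change d n (q (n + 1) (rgt k z • i (n + 1) x)) = q n (rgt k z • i n (d n x))
      have h1 := hq n (rgt k z • i (n + 1) x)
      have h2 := hi n x
      rw [resHom_apply] at h2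
      rw [h1, resHom_apply, map_smul, h2]
    | add z z' hz hz' => simp only [map_add] at hz hz' ⊢; rw [hz, hz']
  · induction z using BTensor.induction with
    | zero => simp only [map_zero]
    | tmul x z =>
      change d n (rgt k (S.EHom z) • x) = rgt k (S.EHom z) • d n x
      rw [map_smul]
    | add z z' hz hz' => simp only [map_add] at hz hz' ⊢; rw [hz, hz']
  · induction z using BTensor.induction with
    | zero => simp only [map_zero]
    | tmul x z =>
      change ε (q 0 (rgt k z • i 0 x)) = ε (rgt k (S.EHom z) • x)
      rw [hqε, map_smul εR, map_smul ε, hiε, rgt_smul_self, rgt_smul_self, S.E_mul_left, EHom_apply]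
    | add z z' hz hz' => simp only [map_add] at hz hz' ⊢; rw [hz, hz']

end Transfer

end GradedFrobeniusSystem

theorem nonempty_linearEquiv_of_ker_eq {S M N N' : Type*} [Ring S] [AddCommGroup M]
    [AddCommGroup N] [AddCommGroup N'] [Module S M] [Module S N] [Module S N'] (f : M →ₗ[S] N)
    (g : M →ₗ[S] N') (hf : Function.Surjective f) (hg : Function.Surjective g)
    (h : ∀ x, f x = 0 ↔ g x = 0) : Nonempty (N ≃ₗ[S] N') :=
  ⟨(f.quotKerEquivOfSurjective hf).symm.trans
    ((Submodule.quotEquivOfEq _ _ (Submodule.ext fun x => by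
      rw [LinearMap.mem_ker, LinearMap.mem_ker, h])).trans (g.quotKerEquivOfSurjective hg))⟩

namespace GradedFrobeniusSystem

open FrobeniusSystem

variable {k : Type v} {A D : Type u} [CommRing k] [Ring A] [Ring D] [Algebra k A] [Algebra k D]
  {ι : A →ₐ[k] D} {l : ℕ} [NeZero l] {T : Type*} [Fintype T] {U : Type u} [AddCommGroup U]
  [Module (Env k A) U] {I : Type*} [Fintype I] (S : GradedFrobeniusSystem ι l T U I)

theorem nonempty_equiv [Module.Projective k A] [Module (Env k A) (Env k D)]
    [IsRestriction ι (Env k D)] [Module (Env k A) D]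
    [IsRestriction ι D] {P R : ℕ → Type u} [∀ n, AddCommGroup (P n)] [∀ n, AddCommGroup (R n)]
    [∀ n, Module (Env k A) (P n)] [∀ n, Module (Env k A) (R n)] [∀ n, Module (Env k D) (R n)]
    [∀ n, IsRestriction ι (R n)] [∀ n, Module.Finite (Env k A) (P n)]
    [∀ n, Module.Projective (Env k A) (P n)] [∀ n, Module.Projective (Env k D) (R n)]
    {d : ∀ n, P (n + 1) →ₗ[Env k A] P n} {ε : P 0 →ₗ[Env k A] A}
    {dR : ∀ n, R (n + 1) →ₗ[Env k D] R n} {εR : R 0 →ₗ[Env k D] D}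
    (hP : IsResolution d ε) (hR : IsResolution dR εR)
    {i : ∀ n, P n →ₗ[Env k A] R n} (hi : IsChainMap d (fun n => resHom ι (dR n)) i)
    (hiε : ∀ x, εR (i 0 x) = ι (ε x)) {q : ∀ n, R n →ₗ[Env k A] P n}
    (hq : IsChainMap (fun n => resHom ι (dR n)) d q) (hqε : ∀ x, ε (q 0 x) = S.E (εR x))
    (hl : IsUnit (l : D)) {N : ℕ} (hN : ∀ i, N < i → Subsingleton (P i)) {n : ℕ}
    (hn : ∀ i, n < i → ∀ f : P i →ₗ[Env k A] Env k A, IsCocycle d f →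
      f ∈ coboundaries (Env k A) d i)
    {cls : cocycles d n →ₗ[Env k A] U} (hcls : IsClassMap cls)
    {V : Type*} [AddCommGroup V] [Module (Env k D) V] {clsR : cocycles dR n →ₗ[Env k D] V}
    (hclsR : IsClassMap clsR) : Nonempty (V ≃ₗ[Env k D] D) := by
  have := S.projective_U
  have hproj : ∀ n, Module.Projective (Env k A) (BTensor k A U (P n)) := fun n =>
    projective_btensor_left
  obtain ⟨σ, hσ, hσε⟩ := exists_chainMap (P := fun n => BTensor k A U (P n))
    (Q := fun n => BTensor k A (P n) U) (hP.toIsAugmented.mapRight U) (hP.mapLeft U) LinearMap.id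
  obtain ⟨m, t, p, hfc, hc⟩ := hcls.exists_fundamentalClass hP.d_d hN hn
  let Θ : cocycles dR n →ₗ[Env k D] D :=
    EnvDual.combination (fun s => i n (p s)) (fun s => S.j (t s)) ∘ₗ (cocycles dR n).subtype
  have hΘ : ∀ z : cocycles dR n, Θ z =
      S.trace (resHom ι (show R n →ₗ[Env k D] Env k D from z.1) ∘ₗ i n)
        (Cyc.rot k A U (P n) (∑ s, Cyc.mk k A (btmul k A (t s) (p s)))) := fun z => by
    rw [trace_rot_sum]
    rfl
  have hz : ∀ z : cocycles dR n, IsCocycle dR (show R n →ₗ[Env k D] Env k D from z.1) :=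
    fun z => mem_cocycles.1 z.2
  refine nonempty_linearEquiv_of_ker_eq (S := Env k D) (M := cocycles dR n) clsR Θ hclsR.surjective ?_ fun z => ?_
  · have h1 : ∀ u, l • S.j u ∈ LinearMap.range Θ := fun u => by
      obtain ⟨z, rfl⟩ := hcls.surjective u
      have hz' := mem_cocycles.1 z.2
      have hF := S.isCocycle_av hq hz'
      refine ⟨⟨(show EnvDual k D (R n) from S.av (envIota ι ∘ₗ (show P n →ₗ[Env k A] Env k A
        from z.1) ∘ₗ q n)), mem_cocycles.2 hF⟩, ?_⟩
      rw [hΘ, ← S.trace_envIota hfc z]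
      refine (S.trace_rot_eq_smul hσ hσε hi hiε hR hF hP hc).trans (congrArg (l • ·) ?_)
      exact S.trace_rot_eq hc (S.prL_zero_av_sub_mem_coboundaries hi hiε hq hqε hP hz')
    have h2 : (l : D) ∈ LinearMap.range Θ := by
      have h3 : (l : D) = ∑ i, lft k (S.y i) • l • S.j (S.x i) := by
        simp only [lft_smul_self, mul_smul_comm]
        rw [← Finset.smul_sum, S.sum_y_x, nsmul_one]
      rw [h3]
      exact sum_mem fun i _ => Submodule.smul_mem _ _ (h1 _)
    obtain ⟨c, hc'⟩ := hl
    refine LinearMap.range_eq_top.1 (Submodule.eq_top_iff'.2 fun x => ?_)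
    have h4 := Submodule.smul_mem (LinearMap.range Θ) (lft k (x * ↑c⁻¹)) h2
    rwa [lft_smul_self, ← hc', mul_assoc, Units.inv_mul, mul_one] at h4
  · rw [hclsR.eq_zero_iff, hΘ]
    constructor
    · intro h
      refine S.trace_rot_eq_zero hc ?_
      let Φ : ∀ n, (R n →ₗ[Env k D] Env k D) →+ (P n →ₗ[Env k A] Env k D) := fun n =>
        AddMonoidHom.mk' (M := R n →ₗ[Env k D] Env k D) (G := P n →ₗ[Env k A] Env k D)
          (fun F => resHom ι F ∘ₗ i n) fun _ _ => rfl
      refine map_mem_coboundaries (d' := d) Φ (fun n g => LinearMap.ext fun x => ?_) h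
      change g (dR n (i (n + 1) x)) = g (i n (d n x))
      rw [← hi n x]
      rfl
    · intro h
      refine S.mem_coboundaries_of_restriction hi hiε hq hqε hR hl (hz z) ?_
      refine S.mem_coboundaries_of_prL_zero hσ hσε hi hiε hR (hz z) hP.toIsAugmented ?_
      refine S.prL_zero_mem_coboundaries hfc hcls
        (isCocycle_comp hi (hz z) (LinearMap.id (R := Env k A))) ?_
      have h5 := (S.trace_rot_eq_smul hσ hσε hi hiε hR (hz z) hP hc).symm.trans h
      obtain ⟨c, hc'⟩ := hl
      rw [nsmul_eq_mul, ← hc'] at h5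
      exact c.mul_right_eq_zero.1 h5

/-- A strongly `ℤ/l`-graded extension of an algebra with van den Bergh duality whose component of
degree one is the dualizing bimodule is a Calabi-Yau algebra. -/
theorem isCalabiYau [Module.Projective k A] {n : ℕ} (hA : HasVdBDuality k A n)
    (S : GradedFrobeniusSystem ι l T (ExtEnv k A n) I) (hl : IsUnit (l : D)) :
    IsCalabiYau k D n := by
  obtain ⟨Q, hfin, N, hN⟩ := hA.resolution
  have hproj : ∀ n, Module.Projective (Env k A) (Q.complex.X n) := fun n =>
    (IsProjective.iff_projective _).2 (Q.projective n)
  have hN' : ∀ i, N < i → Subsingleton (Q.complex.X i) := fun i hi =>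
    ModuleCat.subsingleton_of_isZero (hN i hi)
  have hQ := isResolution_projectiveResolution Q
  obtain ⟨R, dR, εR, hR, hRfin, hRproj, hRN⟩ :=
    (S.hasFiniteResolution hl (P := fun n => Q.complex.X n) hQ hN').exists_resolution
  obtain ⟨R', hR'⟩ := exists_projectiveResolution hR hRproj
  have hfin' : ∀ n, Module.Finite (Env k D) (R'.complex.X n) := fun n => by
    rw [hR']
    exact hRfin n
  have hzero' : ∀ i, N < i → Limits.IsZero (R'.complex.X i) := fun i hi => by
    rw [hR']
    have := hRN i hi
    exact ModuleCat.isZero_of_subsingleton _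
  have hproj' : ∀ n, Module.Projective (Env k D) (R'.complex.X n) := fun n =>
    (IsProjective.iff_projective _).2 (R'.projective n)
  have hres := isResolution_projectiveResolution R'
  let _ : Module (Env k A) (Env k D) := Module.compHom _ (envMap ι)
  let _ : Module (Env k A) D := Module.compHom _ (envMap ι)
  let _ : ∀ n, Module (Env k A) (R'.complex.X n) := fun n => Module.compHom _ (envMap ι)
  have : IsRestriction ι (Env k D) := ⟨fun _ _ => rfl⟩
  have : IsRestriction ι D := ⟨fun _ _ => rfl⟩
  have : ∀ n, IsRestriction ι (R'.complex.X n) := fun n => ⟨fun _ _ => rfl⟩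
  have hprojA : ∀ n, Module.Projective (Env k A) (R'.complex.X n) := fun n =>
    S.projective_restriction _
  obtain ⟨i, hi, hiε⟩ := exists_chainMap (P := fun n => Q.complex.X n)
    (Q := fun n => R'.complex.X n) hQ.toIsAugmented (isResolution_resHom (ι := ι)
      (R := fun n => R'.complex.X n) hres) (iotaHom ι)
  obtain ⟨q, hq, hqε⟩ := exists_chainMap (P := fun n => R'.complex.X n)
    (Q := fun n => Q.complex.X n) (isAugmented_resHom (ι := ι)
      (R := fun n => R'.complex.X n) hres.toIsAugmented) hQ S.EHom
  have hcob : ∀ m, m ≠ n → ∀ f : Q.complex.X m →ₗ[Env k A] Env k A,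
      IsCocycle (P := fun n => Q.complex.X n) (fun n => (Q.complex.d (n + 1) n).hom) f →
      f ∈ coboundaries (P := fun n => Q.complex.X n) (Env k A)
        (fun n => (Q.complex.d (n + 1) n).hom) m := fun m hm f hf => by
    have := hA.ext_eq_zero m hm
    exact ((isClassMap_extClass Q m).eq_zero_iff ⟨f, mem_cocycles.2 hf⟩).1 (Subsingleton.elim _ _)
  refine ⟨⟨R', hfin', N, hzero'⟩, fun m hm => ?_, ?_⟩
  · have h : ∀ x : ExtEnv k D m, x = 0 := fun x => by
      obtain ⟨z, rfl⟩ := (isClassMap_extClass R' m).surjective x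
      refine ((isClassMap_extClass R' m).eq_zero_iff z).2 ?_
      exact S.mem_coboundaries_of_forall (P := fun n => Q.complex.X n)
        (R := fun n => R'.complex.X n) hi hiε hq hqε hres hl (hcob m hm) (mem_cocycles.1 z.2)
    exact ⟨fun x y => (h x).trans (h y).symm⟩
  · exact S.nonempty_equiv (P := fun n => Q.complex.X n) (R := fun n => R'.complex.X n) hQ hres hi
      hiε hq hqε hl hN' (fun m hm => hcob m hm.ne') (isClassMap_extClass Q n)
      (isClassMap_extClass R' n)

end GradedFrobeniusSystem

namespace TensorAlg

variable {k : Type v} {A : Type u} [CommRing k] [Ring A] [Algebra k A] {U : Type u}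
  [AddCommGroup U] [Module (Env k A) U]

variable (k A U) in
/-- The component in degree `n`. -/
def component (n : ℕ) : TensorAlg k A U →ₗ[Env k A] TPow k A U n :=
  DirectSum.component (Env k A) ℕ (fun n => TPow k A U n) n

theorem component_of (n : ℕ) (t : TPow k A U n) : component k A U n (of k A U n t) = t :=
  DirectSum.component.lof_self (Env k A) (M := fun n => TPow k A U n) n t

theorem component_of_ne {n m : ℕ} (h : m ≠ n) (t : TPow k A U m) :
    component k A U n (of k A U m t) = 0 :=
  (DirectSum.component.of (Env k A) (M := fun n => TPow k A U n) n m t).trans (dif_neg h)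

theorem of_injective (n : ℕ) : Function.Injective (of k A U n) :=
  Function.LeftInverse.injective (component_of n)

/-- The linear map out of `A[U]` with given restrictions to the components. -/
def toLinear {M : Type*} [AddCommGroup M] [Module (Env k A) M]
    (f : ∀ n, TPow k A U n →ₗ[Env k A] M) : TensorAlg k A U →ₗ[Env k A] M :=
  DirectSum.toModule (Env k A) ℕ M f

theorem toLinear_of {M : Type*} [AddCommGroup M] [Module (Env k A) M]
    (f : ∀ n, TPow k A U n →ₗ[Env k A] M) (n : ℕ) (t : TPow k A U n) :
    toLinear f (of k A U n t) = f n t :=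
  DirectSum.toModule_lof (Env k A) (M := fun n => TPow k A U n) n t

theorem ofBase_mul (a : A) (x : TensorAlg k A U) : ofBase k A U a * x = lft k a • x :=
  of_zero_mul a x

theorem mul_ofBase (x : TensorAlg k A U) (a : A) : x * ofBase k A U a = rgt k a • x :=
  mul_of_zero x a

theorem smul_eq_lft (c : k) (x : TensorAlg k A U) : c • x = lft k (algebraMap k A c) • x :=
  (Algebra.smul_def c x).trans (ofBase_mul _ x)

variable (k A U) in
/-- The inclusion of `U` as the component of degree one. -/
def gen : U →+ TensorAlg k A U := (consHom (k := k) (A := A)).flip 1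

theorem gen_mul (u : U) (x : TensorAlg k A U) : gen k A U u * x = consHom u x :=
  (consHom_mul u 1 x).trans (congrArg _ (one_mul x))

theorem gen_lft (a : A) (u : U) : gen k A U (lft k a • u) = ofBase k A U a * gen k A U u := by
  rw [ofBase_mul]
  exact consHom_lft u a 1

theorem gen_rgt (a : A) (u : U) : gen k A U (rgt k a • u) = gen k A U u * ofBase k A U a := by
  rw [gen_mul]
  refine (consHom_rgt u a 1).trans ?_
  rw [← ofBase_mul, mul_one]

theorem of_succ (n : ℕ) (u : U) (t : TPow k A U n) :
    of k A U (n + 1) (TPow.succEquiv k A U n (btmul k A u t)) = gen k A U u * of k A U n t := by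
  rw [gen_mul, consHom_of]

theorem gen_eq (u : U) :
    gen k A U u = of k A U 1 (TPow.succEquiv k A U 0 (btmul k A u (TPow.zeroEquiv k A U 1))) := by
  rw [of_succ]
  exact (mul_one _).symm

theorem exists_of_eq_mul : ∀ (n m N : ℕ) (_ : N = n + m) (t : TPow k A U n) (s : TPow k A U m),
    ∃ r, of k A U N r = of k A U n t * of k A U m s := by
  intro n
  induction n with
  | zero =>
    intro m N h t s
    obtain rfl : N = m := by omega
    obtain ⟨a, rfl⟩ := (TPow.zeroEquiv k A U).surjective t
    exact ⟨lft k a • s, by rw [map_smul, of_zero_mul]⟩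
  | succ n ih =>
    intro m N h t s
    obtain ⟨N, rfl⟩ : ∃ N', N = N' + 1 := ⟨n + m, by omega⟩
    obtain ⟨t, rfl⟩ := (TPow.succEquiv k A U n).surjective t
    induction t using BTensor.induction with
    | zero => exact ⟨0, by simp only [map_zero, zero_mul]⟩
    | tmul u t =>
      obtain ⟨r, hr⟩ := ih m N (by omega) t s
      exact ⟨TPow.succEquiv k A U N (btmul k A u r), by rw [of_succ, of_succ, hr, mul_assoc]⟩
    | add t t' ht ht' =>
      obtain ⟨r, hr⟩ := ht
      obtain ⟨r', hr'⟩ := ht'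
      exact ⟨r + r', by rw [map_add, map_add, map_add, hr, hr', add_mul]⟩

/-- An element of degree `n + m` is a sum of products of elements of degrees `n` and `m`. -/
theorem exists_eq_sum_mul : ∀ (n m N : ℕ) (_ : N = n + m) (t : TPow k A U N),
    ∃ (r : ℕ) (a : Fin r → TPow k A U n) (b : Fin r → TPow k A U m),
      of k A U N t = ∑ i, of k A U n (a i) * of k A U m (b i) := by
  intro n
  induction n with
  | zero =>
    intro m N h t
    obtain rfl : N = m := by omega
    refine ⟨1, fun _ => TPow.zeroEquiv k A U 1, fun _ => t, ?_⟩
    rw [Fin.sum_univ_one, of_zero_mul, lft_one_smul]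
  | succ n ih =>
    intro m N h t
    obtain ⟨N, rfl⟩ : ∃ N', N = N' + 1 := ⟨n + m, by omega⟩
    obtain ⟨t, rfl⟩ := (TPow.succEquiv k A U N).surjective t
    induction t using BTensor.induction with
    | zero => exact ⟨0, Fin.elim0, Fin.elim0, by simp⟩
    | tmul u t =>
      obtain ⟨r, a, b, hr⟩ := ih m N (by omega) t
      refine ⟨r, fun i => TPow.succEquiv k A U n (btmul k A u (a i)), b, ?_⟩
      simp only [of_succ, hr, mul_assoc, Finset.mul_sum]
    | add t t' ht ht' =>
      obtain ⟨r, a, b, hr⟩ := ht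
      obtain ⟨r', a', b', hr'⟩ := ht'
      refine ⟨r + r', Fin.append a a', Fin.append b b', ?_⟩
      rw [map_add, map_add, hr, hr', Fin.sum_univ_add]
      simp only [Fin.append_left, Fin.append_right]

theorem of_tprod_init (n : ℕ) (v : Fin (n + 1) → U) :
    of k A U (n + 1) (TPow.tprod k A U (n + 1) v) =
      of k A U n (TPow.tprod k A U n (Fin.init v)) * gen k A U (v (Fin.last n)) := by
  induction n with
  | zero =>
    change of k A U 1 (TPow.succEquiv k A U 0 (btmul k A (v 0) (TPow.zeroEquiv k A U 1))) =
      1 * gen k A U (v 0)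
    rw [one_mul, gen_eq]
  | succ n ih =>
    change of k A U (n + 1 + 1) (TPow.succEquiv k A U (n + 1) (btmul k A (v 0)
        (TPow.tprod k A U (n + 1) (Fin.tail v)))) =
      of k A U (n + 1) (TPow.succEquiv k A U n (btmul k A (v 0)
        (TPow.tprod k A U n (Fin.tail (Fin.init v))))) * _
    rw [of_succ, of_succ, ih, mul_assoc]
    rfl

theorem tpow_induction {n : ℕ} {p : TPow k A U n → Prop} (zero : p 0)
    (tprod : ∀ (a : A) v, p (lft k a • TPow.tprod k A U n v))
    (add : ∀ x y, p x → p y → p (x + y)) (x) : p x := by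
  induction n with
  | zero =>
    obtain ⟨a, rfl⟩ := (TPow.zeroEquiv k A U).surjective x
    have := tprod a Fin.elim0
    change p (lft k a • TPow.zeroEquiv k A U 1) at this
    rwa [← map_smul, lft_smul_self, mul_one] at this
  | succ n ih =>
    obtain ⟨x, rfl⟩ := (TPow.succEquiv k A U n).surjective x
    induction x using BTensor.induction with
    | zero => rwa [map_zero]
    | add x y hx hy => rw [map_add]; exact add _ _ hx hy
    | tmul u t =>
      refine ih (p := fun t => p (TPow.succEquiv k A U n (btmul k A u t))) ?_ ?_ ?_ t
      · rwa [btmul_zero, map_zero]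
      · intro a v
        have h := tprod 1 (Fin.cons (α := fun _ => U) (rgt k a • u) v)
        rw [lft_one_smul] at h
        change p (TPow.succEquiv k A U n (btmul k A (rgt k a • u) (TPow.tprod k A U n v))) at h
        rwa [rgt_btmul] at h
      · intro x y hx hy
        rw [btmul_add, map_add]
        exact add _ _ hx hy

end TensorAlg

namespace CyclicQuotient

open TensorAlg

variable {k : Type v} {A : Type u} [CommRing k] [Ring A] [Algebra k A] {U : Type u}
  [AddCommGroup U] [Module (Env k A) U] {l : ℕ} (φ : TPow k A U l ≃ₗ[Env k A] A)

/-- The map `A[U] → A[U]` that applies `φ` in degree `l` and is the identity in the other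
degrees. -/
def collapse : TensorAlg k A U →ₗ[Env k A] TensorAlg k A U :=
  LinearMap.id + (of k A U 0 ∘ₗ (TPow.zeroEquiv k A U).toLinearMap ∘ₗ φ.toLinearMap - of k A U l) ∘ₗ
    component k A U l

theorem collapse_of (t : TPow k A U l) : collapse φ (of k A U l t) = ofBase k A U (φ t) := by
  change of k A U l t + (ofBase k A U (φ (component k A U l (of k A U l t))) -
    of k A U l (component k A U l (of k A U l t))) = _
  rw [component_of, add_sub_cancel]

theorem collapse_of_ne {n : ℕ} (h : n ≠ l) (t : TPow k A U n) :
    collapse φ (of k A U n t) = of k A U n t := by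
  change of k A U n t + (ofBase k A U (φ (component k A U l (of k A U n t))) -
    of k A U l (component k A U l (of k A U n t))) = _
  rw [component_of_ne h, map_zero, map_zero, map_zero, sub_zero, add_zero]

/-- The map `u ⊗ t ↦ u f(t)`. -/
def consLinear {n : ℕ} (f : TPow k A U n →ₗ[Env k A] TensorAlg k A U) :
    BTensor k A U (TPow k A U n) →ₗ[Env k A] TensorAlg k A U :=
  BTensor.liftHom (consHom.compl₂ f.toAddMonoidHom)
    (fun u a t => by
      change consHom (rgt k a • u) (f t) = consHom u (f (lft k a • t))
      rw [map_smul f, consHom_rgt])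
    (fun a u t => consHom_lft u a (f t))
    (fun a u t => by
      change consHom u (f (rgt k a • t)) = rgt k a • consHom u (f t)
      rw [map_smul f, consHom_smul_rgt])

theorem consLinear_btmul {n : ℕ} (f : TPow k A U n →ₗ[Env k A] TensorAlg k A U) (u : U)
    (t : TPow k A U n) : consLinear f (btmul k A u t) = gen k A U u * f t :=
  (gen_mul u (f t)).symm

/-- Reduction of the tensors of degree `n` to degrees smaller than `l`. -/
def foldAux : ∀ n, TPow k A U n →ₗ[Env k A] TensorAlg k A U
  | 0 => of k A U 0
  | n + 1 => collapse φ ∘ₗ consLinear (foldAux n) ∘ₗ (TPow.succEquiv k A U n).symm.toLinearMap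

/-- Reduction of tensors to degrees smaller than `l`. -/
def fold : TensorAlg k A U →ₗ[Env k A] TensorAlg k A U := toLinear (foldAux φ)

theorem fold_ofBase (a : A) : fold φ (ofBase k A U a) = ofBase k A U a := toLinear_of _ _ _

theorem fold_gen_mul (u : U) (x : TensorAlg k A U) :
    fold φ (gen k A U u * x) = collapse φ (gen k A U u * fold φ x) := by
  induction x using TensorAlg.induction with
  | zero => simp only [mul_zero, map_zero]
  | add x y hx hy => simp only [mul_add, map_add, hx, hy]
  | of n t =>
    rw [← of_succ, fold, toLinear_of, toLinear_of, ← consLinear_btmul]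
    rfl

theorem fold_of_lt {n : ℕ} (h : n < l) (t : TPow k A U n) :
    fold φ (of k A U n t) = of k A U n t := by
  induction n with
  | zero => exact toLinear_of _ _ _
  | succ n ih =>
    obtain ⟨t, rfl⟩ := (TPow.succEquiv k A U n).surjective t
    induction t using BTensor.induction with
    | zero => simp only [map_zero]
    | add x y hx hy => simp only [map_add, hx, hy]
    | tmul u t =>
      rw [of_succ, fold_gen_mul, ih (by omega), ← of_succ, collapse_of_ne φ h.ne]

theorem fold_of (hl : l ≠ 0) (t : TPow k A U l) : fold φ (of k A U l t) = ofBase k A U (φ t) := by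
  obtain ⟨n, rfl⟩ := Nat.exists_eq_succ_of_ne_zero hl
  obtain ⟨t, rfl⟩ := (TPow.succEquiv k A U n).surjective t
  induction t using BTensor.induction with
  | zero => simp only [map_zero]
  | add x y hx hy => simp only [map_add, hx, hy]
  | tmul u t => rw [of_succ, fold_gen_mul, fold_of_lt φ (Nat.lt_succ_self n), ← of_succ, collapse_of]

/-- Elements of `A[U]` of degrees smaller than `n`. -/
def lower (n : ℕ) : AddSubgroup (TensorAlg k A U) :=
  AddSubgroup.closure {x | ∃ m < n, ∃ t, of k A U m t = x}

theorem of_mem_lower {n m : ℕ} (h : m < n) (t : TPow k A U m) : of k A U m t ∈ lower n :=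
  AddSubgroup.subset_closure ⟨m, h, t, rfl⟩

theorem lower_induction {n : ℕ} {p : TensorAlg k A U → Prop} (zero : p 0)
    (of : ∀ m < n, ∀ t, p (of k A U m t)) (add : ∀ x y, p x → p y → p (x + y))
    {x : TensorAlg k A U} (hx : x ∈ lower n) : p x := by
  induction hx using AddSubgroup.closure_induction'' with
  | zero => exact zero
  | mem x hx => obtain ⟨m, hm, t, rfl⟩ := hx; exact of m hm t
  | neg_mem x hx => obtain ⟨m, hm, t, rfl⟩ := hx; rw [← map_neg]; exact of m hm (-t)
  | add x y _ _ hx hy => exact add x y hx hy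

theorem fold_mem_lower (hl : l ≠ 0) (x : TensorAlg k A U) : fold φ x ∈ lower l := by
  induction x using TensorAlg.induction' with
  | zero => rw [map_zero]; exact zero_mem _
  | add x y hx hy => rw [map_add]; exact add_mem hx hy
  | scalar a =>
    rw [fold_of_lt φ (Nat.pos_of_ne_zero hl)]
    exact of_mem_lower (Nat.pos_of_ne_zero hl) _
  | cons u n t h =>
    rw [← gen_mul, fold_gen_mul]
    refine lower_induction (n := l) (p := fun x => collapse φ (gen k A U u * x) ∈ lower l) ?_ ?_ ?_ h
    · rw [mul_zero, map_zero]
      exact zero_mem _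
    · intro m hm t
      rw [← of_succ]
      obtain rfl | hne := eq_or_ne (m + 1) l
      · rw [collapse_of]
        exact of_mem_lower (Nat.pos_of_ne_zero hl) _
      · rw [collapse_of_ne φ hne]
        exact of_mem_lower (by omega) _
    · intro x y hx hy
      rw [mul_add, map_add]
      exact add_mem hx hy

theorem fold_eq_self {x : TensorAlg k A U} (hx : x ∈ lower l) : fold φ x = x :=
  lower_induction (p := fun x => fold φ x = x) (map_zero _) (fun m hm t => fold_of_lt φ hm t)
    (fun x y hx hy => by rw [map_add, hx, hy]) hx

theorem fold_mul_fold (hl : l ≠ 0) (x y : TensorAlg k A U) :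
    fold φ (x * fold φ y) = fold φ (x * y) := by
  induction x using TensorAlg.induction' with
  | zero => simp only [zero_mul]
  | add x y hx hy => simp only [add_mul, map_add, hx, hy]
  | scalar a =>
    rw [TensorAlg.of_zero_mul, TensorAlg.of_zero_mul, map_smul, map_smul, fold_eq_self φ (fold_mem_lower φ hl y)]
  | cons u n t h =>
    rw [← gen_mul, mul_assoc, mul_assoc, fold_gen_mul, fold_gen_mul, h]

/-- Associativity of `φ` as an identity in `A[U]`. -/
theorem gen_mul_ofBase {n : ℕ} {φ : TPow k A U (n + 1) ≃ₗ[Env k A] A} (hφ : IsAssociative φ)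
    (u w : U) (t : TPow k A U n) (r : TPow k A U (n + 1))
    (hr : of k A U (n + 1) r = of k A U n t * gen k A U w) :
    gen k A U u * ofBase k A U (φ r) =
      ofBase k A U (φ (TPow.succEquiv k A U n (btmul k A u t))) * gen k A U w := by
  induction t using tpow_induction generalizing r with
  | zero =>
    rw [map_zero, zero_mul] at hr
    rw [TensorAlg.of_injective _ (hr.trans (map_zero _).symm), btmul_zero]
    simp only [map_zero, mul_zero, zero_mul]
  | add t t' ht ht' =>
    obtain ⟨s, hs⟩ := exists_of_eq_mul n 1 (n + 1) rfl t
      (TPow.succEquiv k A U 0 (btmul k A w (TPow.zeroEquiv k A U 1)))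
    obtain ⟨s', hs'⟩ := exists_of_eq_mul n 1 (n + 1) rfl t'
      (TPow.succEquiv k A U 0 (btmul k A w (TPow.zeroEquiv k A U 1)))
    rw [← gen_eq] at hs hs'
    have h : r = s + s' := TensorAlg.of_injective _ (by rw [hr, map_add, map_add, hs, hs', add_mul])
    rw [h, btmul_add]
    simp only [map_add, mul_add, add_mul]
    rw [ht s hs, ht' s' hs']
  | tprod a v =>
    let z : Fin (n + 1) → U := Fin.snoc (α := fun _ => U) v w
    have h1 : of k A U (n + 1) (TPow.tprod k A U (n + 1) z) =
        of k A U n (TPow.tprod k A U n v) * gen k A U w := by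
      rw [of_tprod_init]
      simp only [z, Fin.init_snoc, Fin.snoc_last]
    have h2 : r = lft k a • TPow.tprod k A U (n + 1) z := TensorAlg.of_injective _ (by
      rw [hr, map_smul, map_smul, lft_smul_mul, h1])
    have h3 := hφ (Fin.cons (α := fun _ => U) (rgt k a • u) z)
    have h4 : TPow.tprod k A U (n + 1) (Fin.init (Fin.cons (α := fun _ => U) (rgt k a • u) z)) =
        TPow.succEquiv k A U n (btmul k A u (lft k a • TPow.tprod k A U n v)) := by
      rw [Fin.cons_snoc_eq_snoc_cons, Fin.init_snoc, ← rgt_btmul]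
      rfl
    have h5 : Fin.cons (α := fun _ => U) (rgt k a • u) z (Fin.last (n + 1)) = w :=
      Fin.snoc_last (α := fun _ => U) w v
    rw [h4, h5, Fin.tail_cons, Fin.cons_zero] at h3
    have h6 := congrArg (gen k A U) h3
    rw [gen_lft, gen_rgt, gen_rgt] at h6
    rw [h6, h2, map_smul, lft_smul_self, map_mul, mul_assoc]

theorem fold_of_mul_of {φ : TPow k A U l ≃ₗ[Env k A] A} (hφ : IsAssociative φ) {m : ℕ}
    (hm : m < l) (t : TPow k A U l) (s : TPow k A U m) :
    fold φ (of k A U l t * of k A U m s) = lft k (φ t) • of k A U m s := by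
  have hl : l ≠ 0 := by omega
  obtain ⟨n, rfl⟩ : ∃ n, l = n + 1 := ⟨l - 1, by omega⟩
  induction m generalizing t with
  | zero =>
    obtain ⟨a, rfl⟩ := (TPow.zeroEquiv k A U).surjective s
    rw [mul_of_zero, map_smul, fold_of φ hl, ← mul_ofBase, ofBase_mul]
    rfl
  | succ m ih =>
    obtain ⟨s, rfl⟩ := (TPow.succEquiv k A U m).surjective s
    induction s using BTensor.induction with
    | zero => simp only [map_zero, mul_zero, smul_zero]
    | add x y hx hy => simp only [map_add, mul_add, smul_add, hx, hy]
    | tmul w s =>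
      obtain ⟨t, rfl⟩ := (TPow.succEquiv k A U n).surjective t
      induction t using BTensor.induction with
      | zero =>
        simp only [map_zero, zero_mul]
        rw [lft_zero]
        exact (zero_smul (Env k A) (_ : TensorAlg k A U)).symm
      | add x y hx hy => simp only [map_add, add_mul, lft_add, add_smul, hx, hy]
      | tmul u t =>
        obtain ⟨r, hr⟩ := exists_of_eq_mul n 1 (n + 1) rfl t
          (TPow.succEquiv k A U 0 (btmul k A w (TPow.zeroEquiv k A U 1)))
        rw [← gen_eq] at hr
        rw [of_succ, of_succ, mul_assoc, ← mul_assoc (of k A U n t), ← hr, fold_gen_mul,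
          ih s (by omega) r, ← ofBase_mul, ← ofBase_mul, ← mul_assoc, gen_mul_ofBase hφ u w t r hr,
          mul_assoc, ofBase_mul, map_smul, ← of_succ, collapse_of_ne φ hm.ne]

end CyclicQuotient

namespace CyclicQuotient

open TensorAlg

variable {k : Type v} {A : Type u} [CommRing k] [Ring A] [Algebra k A] {U : Type u}
  [AddCommGroup U] [Module (Env k A) U] {l : ℕ} (φ : TPow k A U l ≃ₗ[Env k A] A)

theorem mk_surjective : Function.Surjective (CyclicQuotient.mk φ) := RingCon.mkₐ_surjective _

theorem mk_eq_iff {x y : TensorAlg k A U} :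
    CyclicQuotient.mk φ x = CyclicQuotient.mk φ y ↔ x - y ∈ relIdeal φ :=
  (RingCon.eq _).trans (TwoSidedIdeal.rel_iff _ _ _)

theorem mk_of (t : TPow k A U l) :
    CyclicQuotient.mk φ (of k A U l t) = CyclicQuotient.mk φ (ofBase k A U (φ t)) :=
  (mk_eq_iff φ).2 (TwoSidedIdeal.subset_span ⟨t, rfl⟩)

theorem mk_collapse (x : TensorAlg k A U) :
    CyclicQuotient.mk φ (collapse φ x) = CyclicQuotient.mk φ x := by
  induction x using TensorAlg.induction with
  | zero => rw [map_zero]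
  | add x y hx hy => simp only [map_add, hx, hy]
  | of n t =>
    obtain rfl | h := eq_or_ne n l
    · rw [collapse_of, mk_of]
    · rw [collapse_of_ne φ h]

theorem mk_fold (x : TensorAlg k A U) :
    CyclicQuotient.mk φ (fold φ x) = CyclicQuotient.mk φ x := by
  induction x using TensorAlg.induction' with
  | zero => rw [map_zero]
  | add x y hx hy => simp only [map_add, hx, hy]
  | scalar a => exact congrArg _ (fold_ofBase φ a)
  | cons u n t h => rw [← gen_mul, fold_gen_mul, mk_collapse, map_mul, map_mul, h]

/-- The two-sided ideal of the elements all of whose right multiples reduce to zero. -/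
def foldIdeal (hl : l ≠ 0) : TwoSidedIdeal (TensorAlg k A U) :=
  TwoSidedIdeal.mk' {x | ∀ y, fold φ (x * y) = 0}
    (fun y => by rw [zero_mul, map_zero])
    (fun {x x'} hx hx' y => by rw [add_mul, map_add, hx, hx', add_zero])
    (fun {x} hx y => by rw [neg_mul, map_neg, hx, neg_zero])
    (fun {x x'} hx y => by
      rw [mul_assoc, ← fold_mul_fold φ hl, hx, mul_zero, map_zero])
    (fun {x x'} hx y => by rw [mul_assoc, hx])

variable {φ}

theorem relIdeal_le_foldIdeal (hφ : IsAssociative φ) (hl : l ≠ 0) :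
    relIdeal φ ≤ foldIdeal φ hl := by
  rw [relIdeal, TwoSidedIdeal.span_le]
  rintro _ ⟨t, rfl⟩
  refine (TwoSidedIdeal.mem_mk' _ _ _ _ _ _ _).2 fun y => ?_
  rw [← fold_mul_fold φ hl]
  refine lower_induction (n := l)
    (p := fun y => fold φ ((of k A U l t - ofBase k A U (φ t)) * y) = 0) ?_ ?_ ?_
    (fold_mem_lower φ hl y)
  · rw [mul_zero, map_zero]
  · intro m hm s
    rw [sub_mul, map_sub, fold_of_mul_of hφ hm, ofBase_mul, map_smul, fold_of_lt φ hm, sub_self]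
  · intro x y hx hy
    rw [mul_add, map_add, hx, hy, add_zero]

theorem fold_eq_of_mk_eq (hφ : IsAssociative φ) (hl : l ≠ 0) {x y : TensorAlg k A U}
    (h : CyclicQuotient.mk φ x = CyclicQuotient.mk φ y) : fold φ x = fold φ y := by
  have h1 := relIdeal_le_foldIdeal hφ hl ((mk_eq_iff φ).1 h)
  have h2 := (TwoSidedIdeal.mem_mk' _ _ _ _ _ _ _).1 h1 1
  rw [mul_one, map_sub] at h2
  exact sub_eq_zero.1 h2

/-- The representative of an element of `D` of degrees smaller than `l`. -/
def rep (hφ : IsAssociative φ) (hl : l ≠ 0) : CyclicQuotient φ →+ TensorAlg k A U :=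
  AddMonoidHom.mk' (fun x => fold φ (Function.surjInv (mk_surjective φ) x)) fun x y => by
    rw [← map_add]
    refine fold_eq_of_mk_eq hφ hl ?_
    simp only [map_add, Function.surjInv_eq (mk_surjective φ)]

theorem rep_mk (hφ : IsAssociative φ) (hl : l ≠ 0) (x : TensorAlg k A U) :
    rep hφ hl (CyclicQuotient.mk φ x) = fold φ x :=
  fold_eq_of_mk_eq hφ hl (Function.surjInv_eq _ _)

theorem rep_mem_lower (hφ : IsAssociative φ) (hl : l ≠ 0) (x : CyclicQuotient φ) :
    rep hφ hl x ∈ lower l := fold_mem_lower φ hl _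

theorem mk_rep (hφ : IsAssociative φ) (hl : l ≠ 0) (x : CyclicQuotient φ) :
    CyclicQuotient.mk φ (rep hφ hl x) = x := by
  obtain ⟨z, rfl⟩ := mk_surjective φ x
  rw [rep_mk, mk_fold]

theorem induction_lower (hφ : IsAssociative φ) (hl : l ≠ 0) {p : CyclicQuotient φ → Prop}
    (zero : p 0) (of : ∀ m < l, ∀ t, p (CyclicQuotient.mk φ (of k A U m t)))
    (add : ∀ x y, p x → p y → p (x + y)) (x) : p x := by
  rw [← mk_rep hφ hl x]
  refine lower_induction (p := fun y => p (CyclicQuotient.mk φ y)) ?_ of ?_ (rep_mem_lower hφ hl x)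
  · rwa [map_zero]
  · intro x y hx hy
    rw [map_add]
    exact add _ _ hx hy

theorem induction_of {p : CyclicQuotient φ → Prop} (zero : p 0)
    (of : ∀ n t, p (CyclicQuotient.mk φ (of k A U n t)))
    (add : ∀ x y, p x → p y → p (x + y)) (x) : p x := by
  obtain ⟨z, rfl⟩ := mk_surjective φ x
  induction z using TensorAlg.induction with
  | zero => rwa [map_zero]
  | of n t => exact of n t
  | add x y hx hy => rw [map_add]; exact add _ _ hx hy

section Basis

/-- The isomorphism of `⨁_{i < l} U^{⊗ i}` with `D`. -/
theorem exists_equiv (hφ : IsAssociative φ) (hl : l ≠ 0) :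
    ∃ e : (⨁ i : Fin l, TPow k A U i) ≃+ CyclicQuotient φ,
      (∀ (i : Fin l) (x : TPow k A U i), e (DirectSum.of (fun i : Fin l => TPow k A U i) i x) =
        CyclicQuotient.mk φ (of k A U i x)) ∧
      ∀ (a b : A) (x : ⨁ i : Fin l, TPow k A U i), e ((a ⊗ₜ[k] op b : Env k A) • x) =
        CyclicQuotient.mk φ (ofBase k A U a) * e x * CyclicQuotient.mk φ (ofBase k A U b) := by
  let f : (⨁ i : Fin l, TPow k A U i) →ₗ[Env k A] TensorAlg k A U :=
    DirectSum.toModule (Env k A) (Fin l) _ fun i => of k A U i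
  have hf : ∀ (i : Fin l) (x : TPow k A U i),
      f (DirectSum.of (fun i : Fin l => TPow k A U i) i x) = of k A U i x := fun i x =>
    DirectSum.toModule_lof (Env k A) (M := fun i : Fin l => TPow k A U i) i x
  let g : (⨁ i : Fin l, TPow k A U i) →+ CyclicQuotient φ :=
    (CyclicQuotient.mk φ : TensorAlg k A U →+ CyclicQuotient φ).comp f.toAddMonoidHom
  have hg : ∀ x, g x = CyclicQuotient.mk φ (f x) := fun x => rfl
  have hmem : ∀ x, f x ∈ lower l := fun x => by
    induction x using DirectSum.induction_on with
    | zero => rw [map_zero]; exact zero_mem _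
    | of i x => rw [hf]; exact of_mem_lower i.2 x
    | add x y hx hy => rw [map_add]; exact add_mem hx hy
  have hcomp : ∀ (x : ⨁ i : Fin l, TPow k A U i) (i : Fin l), component k A U i (f x) = x i := by
    intro x i
    induction x using DirectSum.induction_on with
    | zero => rw [map_zero, map_zero, DirectSum.zero_apply]
    | add x y hx hy => rw [map_add, map_add, DirectSum.add_apply, hx, hy]
    | of j x =>
      rw [hf]
      obtain rfl | h := eq_or_ne j i
      · rw [component_of, DirectSum.of_eq_same]
      · rw [component_of_ne (fun h' => h (Fin.ext h')), DirectSum.of_eq_of_ne _ _ _ h.symm]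
  have hinj : Function.Injective g := (injective_iff_map_eq_zero g).2 fun x hx => by
    have h1 := congrArg (rep hφ hl) hx
    rw [hg, rep_mk, map_zero, fold_eq_self φ (hmem x)] at h1
    refine DFunLike.ext _ _ fun i => ?_
    rw [← hcomp, h1, map_zero]
    rfl
  have hsurj : Function.Surjective g := fun x => by
    induction x using induction_lower hφ hl with
    | zero => exact ⟨0, map_zero _⟩
    | of m hm t => exact ⟨DirectSum.of (fun i : Fin l => TPow k A U i) ⟨m, hm⟩ t, by rw [hg, hf]⟩
    | add x y hx hy =>
      obtain ⟨x', rfl⟩ := hx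
      obtain ⟨y', rfl⟩ := hy
      exact ⟨x' + y', map_add _ _ _⟩
  refine ⟨AddEquiv.ofBijective g ⟨hinj, hsurj⟩, fun i x => ?_, fun a b x => ?_⟩
  · change g _ = _
    rw [hg, hf]
  · change g _ = _ * g x * _
    rw [hg, hg, map_smul, ← map_mul, ← map_mul, ofBase_mul, mul_ofBase, ← mul_smul,
      tmul_eq_lft_mul_rgt, commute_lft_rgt]

end Basis

end CyclicQuotient

namespace TensorAlg

variable {k : Type v} {A : Type u} [CommRing k] [Ring A] [Algebra k A] {U : Type u}
  [AddCommGroup U] [Module (Env k A) U]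

theorem gen_injective : Function.Injective (gen k A U) := by
  refine Function.LeftInverse.injective
    (g := fun x => BTensor.augRight U (TPow.zeroEquiv k A U).symm.toLinearMap
      ((TPow.succEquiv k A U 0).symm (component k A U 1 x))) fun u => ?_
  simp only [gen_eq, component_of, LinearEquiv.symm_apply_apply, BTensor.augRight_btmul,
    LinearEquiv.coe_coe, rgt_one_smul]

theorem exists_gen_eq (s : TPow k A U 1) : ∃ u, gen k A U u = of k A U 1 s := by
  obtain ⟨s, rfl⟩ := (TPow.succEquiv k A U 0).surjective s
  induction s using BTensor.induction with
  | zero => exact ⟨0, by simp only [map_zero]⟩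
  | tmul u t =>
    obtain ⟨a, rfl⟩ := (TPow.zeroEquiv k A U).surjective t
    exact ⟨rgt k a • u, by rw [of_succ, gen_rgt]; rfl⟩
  | add x y hx hy =>
    obtain ⟨u, hu⟩ := hx
    obtain ⟨w, hw⟩ := hy
    exact ⟨u + w, by simp only [map_add, hu, hw]⟩

variable (k A U) in
/-- The inclusion of `A` in `A[U]` as a homomorphism of algebras. -/
def baseHom : A →ₐ[k] TensorAlg k A U := { ofBase k A U with commutes' := fun _ => rfl }

variable (k A U) in
/-- The projection onto the sum of the components of degree congruent to `b` modulo `l`. -/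
def residue {l : ℕ} (b : ZMod l) : TensorAlg k A U →ₗ[Env k A] TensorAlg k A U :=
  toLinear fun n => if (n : ZMod l) = b then of k A U n else 0

theorem residue_of {l : ℕ} (b : ZMod l) (n : ℕ) (t : TPow k A U n) :
    residue k A U b (of k A U n t) = if (n : ZMod l) = b then of k A U n t else 0 := by
  rw [residue, toLinear_of]
  split_ifs <;> rfl

theorem residue_gen_mul {l : ℕ} (b : ZMod l) (u : U) (x : TensorAlg k A U) :
    residue k A U (b + 1) (gen k A U u * x) = gen k A U u * residue k A U b x := by
  induction x using TensorAlg.induction with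
  | zero => simp only [map_zero, mul_zero]
  | add x y hx hy => simp only [map_add, mul_add, hx, hy]
  | of n t =>
    rw [← of_succ, residue_of, residue_of, of_succ]
    simp only [Nat.cast_add, Nat.cast_one, add_left_inj]
    split_ifs
    · rfl
    · rw [mul_zero]

end TensorAlg

namespace CyclicQuotient

open TensorAlg

variable {k : Type v} {A : Type u} [CommRing k] [Ring A] [Algebra k A] {U : Type u}
  [AddCommGroup U] [Module (Env k A) U] {l : ℕ} (φ : TPow k A U l ≃ₗ[Env k A] A)

theorem residue_collapse (b : ZMod l) (x : TensorAlg k A U) :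
    residue k A U b (collapse φ x) = collapse φ (residue k A U b x) := by
  induction x using TensorAlg.induction with
  | zero => simp only [map_zero]
  | add x y hx hy => simp only [map_add, hx, hy]
  | of n t =>
    obtain rfl | h := eq_or_ne n l
    · rw [collapse_of, residue_of, ZMod.natCast_self]
      refine (residue_of b 0 _).trans ?_
      rw [Nat.cast_zero]
      split_ifs
      · rw [collapse_of]
        rfl
      · rw [map_zero]
    · rw [collapse_of_ne φ h, residue_of]
      split_ifs
      · rw [collapse_of_ne φ h]
      · rw [map_zero]

theorem residue_fold (b : ZMod l) (x : TensorAlg k A U) :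
    residue k A U b (fold φ x) = fold φ (residue k A U b x) := by
  induction x using TensorAlg.induction' generalizing b with
  | zero => simp only [map_zero]
  | add x y hx hy => simp only [map_add, hx, hy]
  | scalar a =>
    have h := fold_ofBase φ a
    change residue k A U b (fold φ (ofBase k A U a)) = _
    rw [h]
    change residue k A U b (of k A U 0 (TPow.zeroEquiv k A U a)) = _
    rw [residue_of]
    split_ifs
    · exact h.symm
    · rw [map_zero]
  | cons u n t h =>
    obtain ⟨c, rfl⟩ : ∃ c, b = c + 1 := ⟨b - 1, by rw [sub_add_cancel]⟩
    rw [← gen_mul, fold_gen_mul, residue_collapse, residue_gen_mul, residue_gen_mul, h,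
      fold_gen_mul]

variable {φ} (hφ : IsAssociative φ) (hl : l ≠ 0)

theorem rep_mk_smul (e : Env k A) (x : TensorAlg k A U) :
    rep hφ hl (CyclicQuotient.mk φ (e • x)) = e • rep hφ hl (CyclicQuotient.mk φ x) := by
  rw [rep_mk, rep_mk, map_smul]

theorem eq_zero_of_mk_of_eq_zero (hφ : IsAssociative φ) (hl : l ≠ 0) {n : ℕ} (hn : n ≤ l)
    {t : TPow k A U n} (h : CyclicQuotient.mk φ (of k A U n t) = 0) : t = 0 := by
  have h1 := congrArg (rep hφ hl) h
  rw [map_zero, rep_mk] at h1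
  obtain rfl | hne := eq_or_ne n l
  · rw [fold_of φ hl] at h1
    have h2 : TPow.zeroEquiv k A U (φ t) = 0 :=
      TensorAlg.of_injective 0 (h1.trans (map_zero _).symm)
    rwa [LinearEquiv.map_eq_zero_iff, LinearEquiv.map_eq_zero_iff] at h2
  · rw [fold_of_lt φ (by omega)] at h1
    exact TensorAlg.of_injective n (h1.trans (map_zero _).symm)

/-- The projection of `D` onto the component of degree `b` modulo `l`. -/
def proj (b : ZMod l) : CyclicQuotient φ →ₗ[k] CyclicQuotient φ where
  toFun x := CyclicQuotient.mk φ (residue k A U b (rep hφ hl x))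
  map_add' x y := by rw [map_add, map_add, map_add]
  map_smul' c x := by
    obtain ⟨z, rfl⟩ := mk_surjective φ x
    rw [← map_smul, smul_eq_lft, rep_mk_smul, map_smul, ← smul_eq_lft, map_smul, RingHom.id_apply]

theorem proj_mk (b : ZMod l) (x : TensorAlg k A U) :
    proj hφ hl b (CyclicQuotient.mk φ x) = CyclicQuotient.mk φ (residue k A U b x) := by
  change CyclicQuotient.mk φ (residue k A U b (rep hφ hl (CyclicQuotient.mk φ x))) = _
  rw [rep_mk, residue_fold, mk_fold]

theorem proj_mk_of (b : ZMod l) (n : ℕ) (t : TPow k A U n) :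
    proj hφ hl b (CyclicQuotient.mk φ (of k A U n t)) =
      if (n : ZMod l) = b then CyclicQuotient.mk φ (of k A U n t) else 0 := by
  rw [proj_mk, residue_of]
  split_ifs
  · rfl
  · rw [map_zero]

theorem proj_of_mul (b : ZMod l) (n : ℕ) (t : TPow k A U n) (x : CyclicQuotient φ) :
    proj hφ hl b (CyclicQuotient.mk φ (of k A U n t) * x) =
      CyclicQuotient.mk φ (of k A U n t) * proj hφ hl (b - n) x := by
  induction x using induction_of with
  | zero => simp only [map_zero, mul_zero]
  | add x y hx hy => simp only [map_add, mul_add, hx, hy]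
  | of m s =>
    obtain ⟨r, hr⟩ := exists_of_eq_mul n m (n + m) rfl t s
    rw [← map_mul, ← hr, proj_mk_of, proj_mk_of, hr, map_mul]
    simp only [Nat.cast_add, eq_sub_iff_add_eq, add_comm (m : ZMod l)]
    split_ifs
    · rfl
    · rw [mul_zero]

theorem proj_mul_of (b : ZMod l) (n : ℕ) (t : TPow k A U n) (x : CyclicQuotient φ) :
    proj hφ hl b (x * CyclicQuotient.mk φ (of k A U n t)) =
      proj hφ hl (b - n) x * CyclicQuotient.mk φ (of k A U n t) := by
  induction x using induction_of with
  | zero => simp only [map_zero, zero_mul]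
  | add x y hx hy => simp only [map_add, add_mul, hx, hy]
  | of m s =>
    obtain ⟨r, hr⟩ := exists_of_eq_mul m n (m + n) rfl s t
    rw [← map_mul, ← hr, proj_mk_of, proj_mk_of, hr, map_mul]
    simp only [Nat.cast_add, eq_sub_iff_add_eq]
    split_ifs
    · rfl
    · rw [zero_mul]

theorem sum_proj [NeZero l] (x : CyclicQuotient φ) : ∑ b, proj hφ hl b x = x := by
  induction x using induction_of with
  | zero => simp only [map_zero, Finset.sum_const_zero]
  | add x y hx hy => simp only [map_add, Finset.sum_add_distrib, hx, hy]
  | of m s =>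
    simp only [proj_mk_of]
    rw [Finset.sum_ite_eq, if_pos (Finset.mem_univ _)]

/-- The inclusion of `A` in `D`. -/
def base (φ : TPow k A U l ≃ₗ[Env k A] A) : A →ₐ[k] CyclicQuotient φ :=
  (CyclicQuotient.mk φ).comp (baseHom k A U)

theorem base_apply (a : A) : base φ a = CyclicQuotient.mk φ (ofBase k A U a) := rfl

theorem base_mul_mk (a : A) (x : TensorAlg k A U) :
    base φ a * CyclicQuotient.mk φ x = CyclicQuotient.mk φ (lft k a • x) := by
  rw [base_apply, ← map_mul, ofBase_mul]

theorem mk_mul_base (a : A) (x : TensorAlg k A U) :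
    CyclicQuotient.mk φ x * base φ a = CyclicQuotient.mk φ (rgt k a • x) := by
  rw [base_apply, ← map_mul, mul_ofBase]

/-- The projection of `D` onto `A`. -/
def expect : CyclicQuotient φ →ₗ[k] A where
  toFun x := (TPow.zeroEquiv k A U).symm (component k A U 0 (rep hφ hl x))
  map_add' x y := by rw [map_add, map_add, map_add]
  map_smul' c x := by
    obtain ⟨z, rfl⟩ := mk_surjective φ x
    rw [← map_smul, smul_eq_lft, rep_mk_smul, map_smul, map_smul, RingHom.id_apply, lft_smul_self,
      Algebra.smul_def]

theorem expect_def (x : CyclicQuotient φ) :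
    expect hφ hl x = (TPow.zeroEquiv k A U).symm (component k A U 0 (rep hφ hl x)) := rfl

theorem expect_base (a : A) : expect hφ hl (base φ a) = a := by
  rw [expect_def, base_apply, rep_mk, fold_ofBase]
  change (TPow.zeroEquiv k A U).symm (component k A U 0 (of k A U 0 (TPow.zeroEquiv k A U a))) = a
  rw [component_of, LinearEquiv.symm_apply_apply]

theorem expect_base_mul (a : A) (x : CyclicQuotient φ) :
    expect hφ hl (base φ a * x) = a * expect hφ hl x := by
  obtain ⟨z, rfl⟩ := mk_surjective φ x
  rw [base_mul_mk, expect_def, expect_def, rep_mk_smul, map_smul, map_smul, lft_smul_self]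

theorem expect_mul_base (x : CyclicQuotient φ) (a : A) :
    expect hφ hl (x * base φ a) = expect hφ hl x * a := by
  obtain ⟨z, rfl⟩ := mk_surjective φ x
  rw [mk_mul_base, expect_def, expect_def, rep_mk_smul, map_smul, map_smul, rgt_smul_self]

theorem proj_zero (x : CyclicQuotient φ) : proj hφ hl 0 x = base φ (expect hφ hl x) := by
  induction x using induction_lower hφ hl with
  | zero => simp only [map_zero]
  | add x y hx hy => simp only [map_add, hx, hy]
  | of m hm t =>
    rw [proj_mk_of]
    obtain rfl | hne := eq_or_ne m 0
    · obtain ⟨a, rfl⟩ := (TPow.zeroEquiv k A U).surjective t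
      rw [Nat.cast_zero, if_pos rfl]
      exact (congrArg (base φ) (expect_base hφ hl a)).symm
    · rw [if_neg, expect_def, rep_mk, fold_of_lt φ hm, component_of_ne hne, map_zero, map_zero]
      rw [ZMod.natCast_eq_zero_iff]
      exact Nat.not_dvd_of_pos_of_lt (Nat.pos_of_ne_zero hne) hm

end CyclicQuotient

namespace CyclicQuotient

open TensorAlg

variable {k : Type v} {A : Type u} [CommRing k] [Ring A] [Algebra k A] {U : Type u}
  [AddCommGroup U] [Module (Env k A) U] {l : ℕ} {φ : TPow k A U l ≃ₗ[Env k A] A}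

theorem exists_sum_mul_eq_one (φ : TPow k A U l ≃ₗ[Env k A] A) {n m : ℕ} (h : l = n + m) :
    ∃ (r : ℕ) (a : Fin r → TPow k A U n) (b : Fin r → TPow k A U m),
      ∑ i, CyclicQuotient.mk φ (of k A U n (a i)) * CyclicQuotient.mk φ (of k A U m (b i)) = 1 := by
  obtain ⟨r, a, b, hr⟩ := exists_eq_sum_mul n m l h (φ.symm 1)
  refine ⟨r, a, b, ?_⟩
  have h1 := mk_of φ (φ.symm 1)
  rw [hr, LinearEquiv.apply_symm_apply, map_one, map_one, map_sum] at h1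
  simpa only [map_mul] using h1

/-- The algebra `D` carries a graded Frobenius system over `A`. -/
theorem exists_gradedFrobeniusSystem [NeZero l] (hφ : IsAssociative φ) :
    ∃ (T I : Type) (_ : Fintype T) (_ : Fintype I),
      Nonempty (GradedFrobeniusSystem (base φ) l T U I) := by
  have hl : l ≠ 0 := NeZero.ne l
  have hb : ∀ b : ZMod l, l = b.val + (l - b.val) := fun b => by
    have := ZMod.val_lt b
    omega
  choose r f g hfg using fun b : ZMod l => exists_sum_mul_eq_one φ (hb b)
  obtain ⟨m, y, s, hys⟩ := exists_sum_mul_eq_one φ (show l = (l - 1) + 1 by omega)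
  choose x hx using fun i => exists_gen_eq (s i)
  have hneg : ∀ b : ZMod l, ((l - b.val : ℕ) : ZMod l) = -b := fun b => by
    rw [Nat.cast_sub (ZMod.val_lt b).le, ZMod.natCast_self, ZMod.natCast_zmod_val, zero_sub]
  have hone : ((l - 1 : ℕ) : ZMod l) = -1 := by
    rw [Nat.cast_sub (by omega), ZMod.natCast_self, Nat.cast_one, zero_sub]
  have hgen : ∀ u, ∃ t, CyclicQuotient.mk φ (gen k A U u) = CyclicQuotient.mk φ (of k A U 1 t) :=
    fun u => ⟨_, congrArg _ (gen_eq u)⟩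
  have hbase : ∀ a, ∃ t, base φ a = CyclicQuotient.mk φ (of k A U 0 t) := fun a => ⟨_, rfl⟩
  refine ⟨Σ b : ZMod l, Fin (r b), Fin m, inferInstance, inferInstance, ⟨{
    E := expect hφ hl
    X := fun t => CyclicQuotient.mk φ (of k A U t.1.val (f t.1 t.2))
    Y := fun t => CyclicQuotient.mk φ (of k A U (l - t.1.val) (g t.1 t.2))
    E_mul_left := expect_base_mul hφ hl
    E_mul_right := expect_mul_base hφ hl
    sum_left := fun z => ?_
    sum_right := fun z => ?_
    sum_mul := ?_
    pr := proj hφ hl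
    j := (CyclicQuotient.mk φ : TensorAlg k A U →+ CyclicQuotient φ).comp (gen k A U)
    y := fun i => CyclicQuotient.mk φ (of k A U (l - 1) (y i))
    x := x
    pr_zero := proj_zero hφ hl
    sum_pr := sum_proj hφ hl
    pr_mul_left := fun b a z => ?_
    pr_one_mul_j := fun z u => ?_
    pr_one_mul_right := fun z a => ?_
    j_lft := fun a u => ?_
    j_rgt := fun a u => ?_
    j_injective := ?_
    sum_y_x := ?_
    pr_y_mul := fun b i z => ?_
    j_mul_y := fun u i => ?_ }⟩⟩
  · simp only [← proj_zero, proj_of_mul, hneg, zero_sub, neg_neg, ← mul_assoc]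
    rw [Fintype.sum_sigma]
    simp only [← Finset.sum_mul, hfg, one_mul, sum_proj]
  · simp only [← proj_zero, proj_mul_of, ZMod.natCast_zmod_val, zero_sub, mul_assoc]
    rw [Fintype.sum_sigma]
    simp only [← Finset.mul_sum, hfg, mul_one]
    exact (Equiv.sum_comp (Equiv.neg (ZMod l)) fun b => proj hφ hl b z).trans (sum_proj hφ hl z)
  · rw [Fintype.sum_sigma]
    simp only [hfg]
    rw [Finset.sum_const, Finset.card_univ, ZMod.card, nsmul_one]
  · obtain ⟨t, ht⟩ := hbase a
    rw [ht, proj_of_mul, Nat.cast_zero, sub_zero]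
  · change proj hφ hl 1 (z * CyclicQuotient.mk φ (gen k A U u)) =
      _ * CyclicQuotient.mk φ (gen k A U u)
    obtain ⟨t, ht⟩ := hgen u
    rw [ht, proj_mul_of, Nat.cast_one, sub_self, proj_zero]
  · obtain ⟨t, ht⟩ := hbase a
    rw [ht, proj_mul_of, Nat.cast_zero, sub_zero]
  · change CyclicQuotient.mk φ (gen k A U (lft k a • u)) = _ * CyclicQuotient.mk φ (gen k A U u)
    rw [gen_lft, map_mul, base_apply]
  · change CyclicQuotient.mk φ (gen k A U (rgt k a • u)) = CyclicQuotient.mk φ (gen k A U u) * _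
    rw [gen_rgt, map_mul, base_apply]
  · refine (injective_iff_map_eq_zero _).2 fun u hu => ?_
    change CyclicQuotient.mk φ (gen k A U u) = 0 at hu
    rw [gen_eq] at hu
    have h := eq_zero_of_mk_of_eq_zero hφ hl (by omega) hu
    refine gen_injective (k := k) (A := A) ?_
    rw [gen_eq, h, map_zero, map_zero]
  · change ∑ i, CyclicQuotient.mk φ (of k A U (l - 1) (y i)) *
      CyclicQuotient.mk φ (gen k A U (x i)) = 1
    simp only [hx]
    exact hys
  · rw [proj_of_mul, hone, sub_neg_eq_add]
  · change base φ (expect hφ hl (CyclicQuotient.mk φ (gen k A U u) * _)) =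
      CyclicQuotient.mk φ (gen k A U u) * _
    obtain ⟨t, ht⟩ := hgen u
    rw [ht, ← proj_zero, proj_of_mul, proj_mk_of, hone, Nat.cast_one, zero_sub, if_pos rfl]

end CyclicQuotient

/-- The zero algebra is Calabi-Yau of every dimension. -/
theorem isCalabiYau_of_subsingleton (k : Type v) (D : Type u) [CommRing k] [Ring D] [Algebra k D]
    [Subsingleton D] (n : ℕ) : IsCalabiYau k D n := by
  have h1 : (1 : Env k D) = 0 := by
    rw [Algebra.TensorProduct.one_def, Subsingleton.elim (1 : D) 0, TensorProduct.zero_tmul]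
  have : Subsingleton (Env k D) := subsingleton_of_zero_eq_one h1.symm
  have hs : ∀ i, Subsingleton (ExtEnv k D i) := fun i => Module.subsingleton (Env k D) _
  have hres : HasFiniteResolution (Env k D) 0 D := ⟨inferInstance, inferInstance⟩
  obtain ⟨R, dR, εR, hR, hfin, hproj, hN⟩ := hres.exists_resolution
  obtain ⟨R', hR'⟩ := exists_projectiveResolution hR hproj
  refine ⟨⟨R', fun i => by rw [hR']; exact hfin i, 0, fun i hi => ?_⟩, fun i _ => hs i, ?_⟩
  · rw [hR']
    have := hN i hi
    exact ModuleCat.isZero_of_subsingleton _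
  · have := hs n
    exact ⟨0, 0, fun x => Subsingleton.elim _ _, fun x => Subsingleton.elim _ _⟩

end VdB

end

theorem mainTheorem3 {k : Type v} {A : Type u} [CommRing k] [Ring A] [Algebra k A]
    [Module.Projective k A] (d : ℕ) (hA : VdB.HasVdBDuality k A d) (l : ℕ)
    (φ : VdB.TPow k A (VdB.ExtEnv k A d) l ≃ₗ[VdB.Env k A] A) (hφ : VdB.IsAssociative φ)
    (hl : IsUnit (l : A)) :
    VdB.IsCalabiYau k (VdB.CyclicQuotient φ) d ∧
      ∃ e : (⨁ i : Fin l, VdB.TPow k A (VdB.ExtEnv k A d) i) ≃+ VdB.CyclicQuotient φ,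
        (∀ (i : Fin l) (x : VdB.TPow k A (VdB.ExtEnv k A d) i),
          e (DirectSum.of (fun i : Fin l => VdB.TPow k A (VdB.ExtEnv k A d) i) i x) =
            VdB.CyclicQuotient.mk φ (VdB.TensorAlg.of k A (VdB.ExtEnv k A d) i x)) ∧
        ∀ (a b : A) (x : ⨁ i : Fin l, VdB.TPow k A (VdB.ExtEnv k A d) i),
          e ((a ⊗ₜ[k] MulOpposite.op b : VdB.Env k A) • x) =
            VdB.CyclicQuotient.mk φ (VdB.TensorAlg.ofBase k A (VdB.ExtEnv k A d) a) * e x *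
              VdB.CyclicQuotient.mk φ (VdB.TensorAlg.ofBase k A (VdB.ExtEnv k A d) b) := by
  obtain rfl | hl0 := eq_or_ne l 0
  · rw [Nat.cast_zero, isUnit_zero_iff] at hl
    have h : (1 : VdB.CyclicQuotient φ) = 0 := by
      rw [← map_one (VdB.CyclicQuotient.base φ), ← hl, map_zero]
    have : Subsingleton (VdB.CyclicQuotient φ) := subsingleton_of_zero_eq_one h.symm
    have : Subsingleton (⨁ i : Fin 0, VdB.TPow k A (VdB.ExtEnv k A d) i) :=
      ⟨fun x y => DFunLike.ext _ _ fun i => i.elim0⟩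
    exact ⟨VdB.isCalabiYau_of_subsingleton k _ d,
      ⟨⟨0, 0, fun _ => Subsingleton.elim _ _, fun _ => Subsingleton.elim _ _⟩, fun _ _ =>
        Subsingleton.elim _ _⟩, fun i => i.elim0, fun _ _ _ => Subsingleton.elim _ _⟩
  · have : NeZero l := ⟨hl0⟩
    obtain ⟨T, I, _, _, ⟨S⟩⟩ := VdB.CyclicQuotient.exists_gradedFrobeniusSystem hφ
    refine ⟨S.isCalabiYau hA ?_, VdB.CyclicQuotient.exists_equiv hφ hl0⟩
    rw [← map_natCast (VdB.CyclicQuotient.base φ)]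
    exact hl.map (VdB.CyclicQuotient.base φ)
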